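/- **Setting.** A *link* is a sequence of functions $L=(L_n)_{n\ge1}$, $L_n:\{1,\dots,n\}^2\to I$ (with $I=\mathbb Z_+$ or $\mathbb Z_+^2$, say); it is symmetric if $L_n(i,j)=L_n(j,i)$. Put $\Delta_L=\sup_n\sup_{t}\sup_{1\le k\le n}\#\{l\le n: L_n(k,l)=t\}$; $L$ has *Property B* if $\Delta_L<\infty$. Put $k_n=\#\{L_n(i,j):1\le i,j\le n\}$ and $\alpha_n=\max_v\#\{(i,j):L_n(i,j)=v\}$; the *growth conditions* are $k_n\to\infty$ and $k_n\alpha_n=O(n^2)$. An input family $(x_i)_{i\in I}$ of independent real random variables with mean $0$ and variance $1$ satisfies (A1) if it is uniformly bounded, (A2) if it is identically distributed, (A3) if $\sup_i\mathbb E|x_i|^m<\infty$ for every $m$. The patterned matrix is $X_n=(x_{L_n(i,j)})_{i,j\le n}$. A *circuit* of length $h$ is a map $\pi:\{0,\dots,h\}\to\{1,\dots,n\}$ with $\pi(0)=\pi(h)$. A *word* of length $h$ is a sequence $w[1]\cdots w[h]$ of letters whose first occurrences are in alphabetical order; it is *pair-matched* if each of its letters occurs exactly twice, and $\mathcal W_{2k}$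 is the set of pair-matched words of length $2k$. Let $\Pi_L(w)$ be the set of circuits $\pi$ with $w[i]=w[j]\Leftrightarrow L_n(\pi(i-1),\pi(i))=L_n(\pi(j-1),\pi(j))$ for all $i,j$. **Theorem.** Let $L_X,L_Y$ be symmetric links with Property B, and suppose that for all $k$ and all $w,w'\in\mathcal W_{2k}$ the limit $$p_Z(w,w')=\lim_{n\to\infty}n^{-(1+k)}\,\#\bigl(\Pi_{L_X}(w)\cap\Pi_{L_Y}(w')\bigr)$$ exists. Put $\beta_h=0$ for odd $h$ and $\beta_{2k}=\sum_{w,w'\in\mathcal W_{2k}}p_Z(w,w')$. Then $$\beta_{2k}\le\frac{(2k)!}{2^kk!}\,\Delta^k\quad(k\ge0),\qquad \Delta=\min\{\Delta_{L_X},\Delta_{L_Y}\},$$ the sequence $(\beta_h)$ satisfies Carleman's condition $\sum_{h\ge1}\beta_{2h}^{-1/(2h)}=\infty$, and there is a sub-Gaussian probability measure $\mu$ on $\mathbb R$, depending only on the two links, whose $h$-th moment is $\beta_h$ for every $h$, such that the following holds for all independent input families $(x_i)$, $(y_j)$ with patterned matrices $X_n$, $Y_n$ (links $L_X$, $L_Y$).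 Write $A_n=n^{-1/2}\,X_n\odot Y_n$ (entrywise product) and let $\beta_h(A_n)$ be the $h$-th moment of the empirical spectral distribution (ESD) of $A_n$. 1. If both input families satisfy (A1), then $\mathbb E\,\beta_h(A_n)\to\beta_h$ and $\sum_n\mathbb E[\beta_h(A_n)-\mathbb E\beta_h(A_n)]^4<\infty$ for every $h$, and almost surely the ESD of $A_n$ converges weakly to $\mu$. 2. If both links satisfy the growth conditions and both input families satisfy (A3), then almost surely the ESD of $A_n$ converges weakly to $\mu$. 3. If both links satisfy the growth conditions and each input family satisfies (A2) or (A3), then the ESD of $A_n$ converges weakly to $\mu$ in probability. -/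

import Mathlib

open MeasureTheory ProbabilityTheory Filter Topology

noncomputable section

namespace SchurHadamard

/-! ### Link functions -/

/-- A link function: a sequence `L_n : {1, …, n}² → ι`. The index set `ι` of the input variables
is arbitrary, in particular it may be `ℕ` or `ℕ × ℕ`. The index set `{1, …, n}` is `Fin n`. -/
abbrev Link (ι : Type*) := (n : ℕ) → Fin n → Fin n → ι

/-- `L(i,j) = L(j,i)` for all `i, j`. -/
def Link.IsSymm {ι : Type*} (L : Link ι) : Prop :=
  ∀ (n : ℕ) (i j : Fin n), L n i j = L n j i

/-- `Δ_L`, the supremum over `n`, over the values `t` and over the rows `k`, of the number of times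
that the value `t` appears in row `k` (values outside the range of `L` contribute `0`). -/
def Link.Delta {ι : Type*} (L : Link ι) : ℕ∞ :=
  ⨆ (n : ℕ) (t : ι) (k : Fin n), {l : Fin n | L n k l = t}.encard

/-- Property B: `Δ_L < ∞`. -/
def Link.PropertyB {ι : Type*} (L : Link ι) : Prop := L.Delta < ⊤

/-- `k_n`, the number of distinct values of `L_n`. -/
def Link.numValues {ι : Type*} (L : Link ι) (n : ℕ) : ℕ :=
  {v : ι | ∃ i j : Fin n, L n i j = v}.ncard

/-- `α_n`, the maximal number of positions at which `L_n` takes one and the same value. -/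
def Link.maxMult {ι : Type*} (L : Link ι) (n : ℕ) : ℕ :=
  ⨆ v : ι, {q : Fin n × Fin n | L n q.1 q.2 = v}.ncard

/-- The conditions `k_n → ∞` and `k_n α_n = O(n²)`. -/
def Link.GrowthCond {ι : Type*} (L : Link ι) : Prop :=
  Tendsto L.numValues atTop atTop ∧
    (fun n : ℕ => (L.numValues n : ℝ) * (L.maxMult n : ℝ)) =O[atTop] fun n : ℕ => (n : ℝ) ^ 2

/-! ### Words and circuits -/

/-- Words of length `h`: the first occurrences of the letters are in alphabetical order (each
letter that precedes the letter at position `i` in the alphabet already occurs before `i`). A word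
of length `h` has at most `h` letters, so that `Fin h` is a large enough alphabet. -/
abbrev Word (h : ℕ) := {w : Fin h → Fin h // ∀ i c, c < w i → ∃ j, j < i ∧ w j = c}

/-- Every letter of the word appears exactly twice. -/
def Word.PairMatched {h : ℕ} (w : Word h) : Prop :=
  ∀ i : Fin h, (Finset.univ.filter fun j => w.1 j = w.1 i).card = 2

instance {h : ℕ} : DecidablePred (Word.PairMatched (h := h)) := fun w => by
  unfold Word.PairMatched; infer_instance

/-- The pair-matched words of length `h`. -/
def pairMatchedWords (h : ℕ) : Finset (Word h) := Finset.univ.filter Word.PairMatched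

/-- Circuits of length `h` on `n` points: functions `π : {0, …, h} → {1, …, n}` with
`π 0 = π h`. -/
def IsCircuit {h n : ℕ} (π : Fin (h + 1) → Fin n) : Prop := π 0 = π (Fin.last h)

/-- The `L`-value of the `i`-th edge `(π (i-1), π i)`; edges are numbered from `0` here. -/
def Link.edgeValue {ι : Type*} (L : Link ι) {h n : ℕ} (π : Fin (h + 1) → Fin n) (i : Fin h) : ι :=
  L n (π i.castSucc) (π i.succ)

/-- `Π_L(w)`: the circuits whose `L`-values match exactly where the letters of `w` match. -/
def circuits {ι : Type*} (L : Link ι) {h : ℕ} (n : ℕ) (w : Word h) : Set (Fin (h + 1) → Fin n) :=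
  {π | IsCircuit π ∧ ∀ i j, w.1 i = w.1 j ↔ L.edgeValue π i = L.edgeValue π j}

/-- `Π_Z(w, w') = Π_X(w) ∩ Π_Y(w')`. -/
def jointCircuits {ι κ : Type*} (LX : Link ι) (LY : Link κ) {h : ℕ} (n : ℕ) (w w' : Word h) :
    Set (Fin (h + 1) → Fin n) :=
  circuits LX n w ∩ circuits LY n w'

/-- `p` is the family of limits `p_Z(w, w') = lim n^{-(1+k)} #Π_Z(w, w')`, for all pairs of
pair-matched words of the same length `2k`. -/
def IsWordLimit {ι κ : Type*} (LX : Link ι) (LY : Link κ) (p : (h : ℕ) → Word h → Word h → ℝ) :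
    Prop :=
  ∀ (k : ℕ) (w w' : Word (2 * k)), w.PairMatched → w'.PairMatched →
    Tendsto (fun n : ℕ => ((jointCircuits LX LY n w w').ncard : ℝ) / (n : ℝ) ^ (1 + k)) atTop
      (𝓝 (p (2 * k) w w'))

/-- `β_h`: zero for odd `h`, and the sum of `p(w, w')` over all pairs of pair-matched words of
length `h` for even `h`. -/
def limitMoment (p : (h : ℕ) → Word h → Word h → ℝ) (h : ℕ) : ℝ :=
  if Odd h then 0 else ∑ w ∈ pairMatchedWords h, ∑ w' ∈ pairMatchedWords h, p h w w'

/-- Carleman's condition `∑_{h ≥ 1} β_{2h}^{-1/(2h)} = ∞`. -/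
def Carleman (β : ℕ → ℝ) : Prop :=
  ¬ Summable fun h : ℕ => (β (2 * (h + 1))) ^ (-(1 : ℝ) / (2 * ((h : ℝ) + 1)))

/-! ### Input sequences -/

section Inputs

variable {Ω ι : Type*} [MeasurableSpace Ω]

/-- Common part of the assumptions: independent, square integrable, mean 0 and variance 1. -/
structure StandardInput (P : Measure Ω) (x : ι → Ω → ℝ) : Prop where
  measurable : ∀ i, Measurable (x i)
  indep : iIndepFun x P
  memLp : ∀ i, MemLp (x i) 2 P
  mean_zero : ∀ i, ∫ ω, x i ω ∂P = 0
  variance_one : ∀ i, variance (x i) P = 1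

/-- Independent, mean 0, variance 1, uniformly bounded. -/
def InputA1 (P : Measure Ω) (x : ι → Ω → ℝ) : Prop :=
  StandardInput P x ∧ ∃ C : ℝ, ∀ i, ∀ᵐ ω ∂P, |x i ω| ≤ C

/-- I.i.d., mean 0, variance 1. -/
def InputA2 (P : Measure Ω) (x : ι → Ω → ℝ) : Prop :=
  StandardInput P x ∧ ∀ i j, IdentDistrib (x i) (x j) P P

/-- Independent, mean 0, variance 1, with uniformly bounded moments of all orders. -/
def InputA3 (P : Measure Ω) (x : ι → Ω → ℝ) : Prop :=
  StandardInput P x ∧ ∀ m : ℕ, ∃ C : ℝ, ∀ i,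
    Integrable (fun ω => |x i ω| ^ m) P ∧ ∫ ω, |x i ω| ^ m ∂P ≤ C

end Inputs

/-! ### Matrices and spectral distributions -/

/-- The patterned matrix `((x_{L(i,j)}))`. -/
def patterned {Ω ι : Type*} (L : Link ι) (x : ι → Ω → ℝ) (n : ℕ) (ω : Ω) :
    Matrix (Fin n) (Fin n) ℝ :=
  Matrix.of fun i j => x (L n i j) ω

/-- The matrix `n^{-1/2} X_n ⊙ Y_n`. -/
def scaledProduct {Ω ι κ : Type*} (LX : Link ι) (LY : Link κ) (x : ι → Ω → ℝ) (y : κ → Ω → ℝ)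
    (n : ℕ) (ω : Ω) : Matrix (Fin n) (Fin n) ℝ :=
  (Real.sqrt n)⁻¹ • (patterned LX x n ω).hadamard (patterned LY y n ω)

/-- The empirical spectral measure of a matrix with real eigenvalues: mass `1/n` at each
eigenvalue, counted with multiplicity. -/
def esd {n : ℕ} (A : Matrix (Fin n) (Fin n) ℝ) : Measure ℝ :=
  (n : ENNReal)⁻¹ • (A.charpoly.roots.map Measure.dirac).sum

/-- `β_h(A)`, the `h`-th moment of the empirical spectral distribution. -/
def esdMoment (h : ℕ) {n : ℕ} (A : Matrix (Fin n) (Fin n) ℝ) : ℝ := ∫ t, t ^ h ∂(esd A)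

/-- The distribution function of the empirical spectral measure. -/
def esdCDF {n : ℕ} (A : Matrix (Fin n) (Fin n) ℝ) (t : ℝ) : ℝ := (esd A).real (Set.Iic t)

section Convergence

variable {Ω : Type*} [MeasurableSpace Ω]

/-- Outside a null set, the empirical spectral distribution functions of `A_n` converge to the
distribution function of `μ` at all continuity points of the latter. -/
def LSDAlmostSurely (P : Measure Ω) (A : (n : ℕ) → Ω → Matrix (Fin n) (Fin n) ℝ) (μ : Measure ℝ) :
    Prop :=
  ∀ᵐ ω ∂P, ∀ t : ℝ, ContinuousAt (cdf μ) t →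
    Tendsto (fun n => esdCDF (A n ω) t) atTop (𝓝 (cdf μ t))

/-- The same convergence, in probability. -/
def LSDInProbability (P : Measure Ω) (A : (n : ℕ) → Ω → Matrix (Fin n) (Fin n) ℝ) (μ : Measure ℝ) :
    Prop :=
  ∀ t : ℝ, ContinuousAt (cdf μ) t →
    TendstoInMeasure P (fun n ω => esdCDF (A n ω) t) atTop (fun _ => cdf μ t)

/-- The expected moments of the empirical spectral distributions exist and converge to `β`. -/
def ExpectedMomentsTendsto (P : Measure Ω) (A : (n : ℕ) → Ω → Matrix (Fin n) (Fin n) ℝ)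
    (β : ℕ → ℝ) : Prop :=
  ∀ h : ℕ, (∀ n, Integrable (fun ω => esdMoment h (A n ω)) P) ∧
    Tendsto (fun n => ∫ ω, esdMoment h (A n ω) ∂P) atTop (𝓝 (β h))

/-- `∑_n E[β_h(A_n) - E β_h(A_n)]⁴ < ∞` for every `h`. -/
def FourthMomentSummable (P : Measure Ω) (A : (n : ℕ) → Ω → Matrix (Fin n) (Fin n) ℝ) : Prop :=
  ∀ h : ℕ, (∀ n, MemLp (fun ω => esdMoment h (A n ω)) 4 P) ∧
    Summable fun n => ∫ ω, (esdMoment h (A n ω) - ∫ ω', esdMoment h (A n ω') ∂P) ^ 4 ∂P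

end Convergence

end SchurHadamard

end

/-! The h-th moment of the ESD is n^{-(1+h/2)} times a sum over circuits of an x-monomial times a
y-monomial, and independence of the two families factors its expectation. A monomial has mean 0 if
some link value along the circuit occurs only once, and mean 1 if every link value occurs exactly
twice. The rest is counting under Property B: a step with prescribed link value leaves at most Δ
choices for the next vertex, so a class of circuits has one power of n for the starting vertex and
one for each free label. Circuits that are matched but not pair-matched number O(n^{(h+1)/2}), so
only circuits pair-matched for both links survive in the limit (`expectedMomentsTendsto`). Counting
with either link alone, and bounding the number of pair-matched words by (2k)!/(2^k k!), gives the
bound on β_{2k}, with the smaller Δ.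

For almost sure convergence the fourth central moment is expanded over quadruples of circuits. A
quadruple contributes only if every link value is repeated and every circuit shares a value with
another one. There are O(n^{2h+2}) of these, two powers of n below the normalisation, because a
circuit closes by itself and so saves the label of one step (`closing_savings`,
`card_families_le_of_matched`). For two links the centred product is split as XY - EX EY = (X - EX)Y
+ EX(Y - EY), so that each half needs the count for one link only (`exists_fourth_moment_le`).

The Gaussian bound on β_{2k} makes the moment generating function entire, hence the moments
determine the law (`eq_of_hasMoments`), and with tightness convergence of moments gives weak
convergence (`tendsto_of_tendsto_moments`). The limit law is obtained from one realisation with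
Rademacher inputs, so it depends on the links alone (`exists_limit_law`).

Inputs that are only i.i.d. are replaced by bounded standardised functions of themselves
(`exists_bounded_approx`). The mean squared Frobenius distance of the two matrices is small
uniformly in n, and it controls the distribution functions (`esdCDF_le`), which gives convergence in
probability. -/

namespace SchurHadamard

/-! ### Counting families by prefixes -/

/-- If, given the values at the indices below `j`, there are at most `B j` possible values at `j`,
then a finite set of sequences has at most `∏ B j` elements. -/
theorem card_le_prod_of_prefix {α : Type*} [DecidableEq α] :
    ∀ {N : ℕ} (S : Finset (Fin N → α)) (B : Fin N → ℕ),
      (∀ j, ∀ φ₀ ∈ S, ((S.filter fun φ => ∀ i < j, φ i = φ₀ i).image fun φ => φ j).card ≤ B j) →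
      S.card ≤ ∏ j, B j := by
  intro N
  induction N with
  | zero =>
    intro S B _
    simpa using Finset.card_le_one_of_subsingleton S
  | succ N ih =>
    intro S B hB
    have h1 : (S.image Fin.init).card ≤ ∏ j : Fin N, B j.castSucc := by
      apply ih
      intro j φ₀ hφ₀
      obtain ⟨ψ₀, hψ₀, rfl⟩ := Finset.mem_image.1 hφ₀
      refine le_trans (Finset.card_le_card ?_) (hB j.castSucc ψ₀ hψ₀)
      intro a ha
      obtain ⟨φ, hφ, rfl⟩ := Finset.mem_image.1 ha
      obtain ⟨hφ, hpre⟩ := Finset.mem_filter.1 hφ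
      obtain ⟨ψ, hψ, rfl⟩ := Finset.mem_image.1 hφ
      refine Finset.mem_image.2 ⟨ψ, Finset.mem_filter.2 ⟨hψ, ?_⟩, rfl⟩
      intro i hi
      have hi' : i.val < N := lt_of_lt_of_le hi (by simp)
      exact hpre ⟨i, hi'⟩ hi
    have h2 : S.card ≤ (B (Fin.last N)) * (S.image Fin.init).card := by
      apply Finset.card_le_mul_card_image
      intro b hb
      obtain ⟨φ₀, hφ₀, rfl⟩ := Finset.mem_image.1 hb
      refine le_trans ?_ (hB (Fin.last N) φ₀ hφ₀)
      rw [← Finset.card_image_of_injOn (f := fun φ : Fin (N + 1) → α => φ (Fin.last N))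
        (s := S.filter fun φ => Fin.init φ = Fin.init φ₀)]
      · apply Finset.card_le_card
        apply Finset.image_subset_image
        intro φ hφ
        obtain ⟨hφ, he⟩ := Finset.mem_filter.1 hφ
        refine Finset.mem_filter.2 ⟨hφ, fun i hi => ?_⟩
        exact congrFun he ⟨i, hi⟩
      · intro φ hφ ψ hψ he
        have h1 := (Finset.mem_filter.1 hφ).2
        have h2 := (Finset.mem_filter.1 hψ).2
        rw [← Fin.snoc_init_self φ, ← Fin.snoc_init_self ψ, h1, h2]
        simp only at he
        rw [he]
    rw [Fin.prod_univ_castSucc, mul_comm]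
    exact h2.trans (Nat.mul_le_mul_left _ h1)

/-- Every row of `L` contains every value at most `D` times. -/
def RowBound {ι : Type*} (L : Link ι) (D : ℕ) : Prop :=
  ∀ (n : ℕ) (t : ι) (k : Fin n), {l : Fin n | L n k l = t}.ncard ≤ D

theorem rowBound_toNat_Delta {ι : Type*} {L : Link ι} (h : L.PropertyB) :
    RowBound L L.Delta.toNat := by
  intro n t k
  have h1 : {l : Fin n | L n k l = t}.encard ≤ L.Delta :=
    le_iSup_of_le n (le_iSup_of_le t (le_iSup (fun k => {l : Fin n | L n k l = t}.encard) k))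
  exact ENat.toNat_le_toNat h1 h.ne

theorem one_le_toNat_Delta {ι : Type*} {L : Link ι} (h : L.PropertyB) : 1 ≤ L.Delta.toNat := by
  refine le_trans ?_ (rowBound_toNat_Delta h 1 (L 1 0 0) 0)
  exact (Set.ncard_pos).2 ⟨0, rfl⟩

/-- A set of paths in which every step outside `F` has its link value prescribed or equal to the one
of an earlier step has at most `n ^ (1 + |F|) * D ^ (N - |F|)` elements. -/
theorem card_paths_le {ι Λ : Type*} {L : Link ι} {D : ℕ} (hD : RowBound L D) {n N : ℕ}
    (S : Finset (Fin (N + 1) → Fin n)) (F : Finset (Fin N)) (w : Fin N → Λ) (O : Set Λ) (t : Λ → ι)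
    (hw : ∀ φ ∈ S, ∀ i j, w i = w j → L.edgeValue φ i = L.edgeValue φ j)
    (hO : ∀ φ ∈ S, ∀ i, w i ∈ O → L.edgeValue φ i = t (w i))
    (hF : ∀ k ∉ F, w k ∈ O ∨ ∃ j < k, w j = w k) :
    S.card ≤ n ^ (1 + F.card) * D ^ (N - F.card) := by
  classical
  have key := card_le_prod_of_prefix S
    (Fin.cons n fun k => if k ∈ F then n else D) (by
    intro j φ₀ hφ₀
    induction j using Fin.cases with
    | zero => simpa using Finset.card_le_univ (α := Fin n) _
    | succ k =>
      simp only [Fin.cons_succ]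
      split_ifs with hk
      · simpa using Finset.card_le_univ (α := Fin n) _
      -- If all continuations of the prefix have the same value `s` at step `k`, their next vertices
      -- lie in one fibre of the row of `φ₀ k.castSucc`, and `RowBound` applies.
      · have hrow : ∀ s : ι, ((S.filter fun φ => ∀ i < k.succ, φ i = φ₀ i).image
              fun φ => φ k.succ).card ≤ D ∨
            ∃ φ ∈ S, (∀ i < k.succ, φ i = φ₀ i) ∧ L.edgeValue φ k ≠ s := by
          intro s
          by_cases hs : ∃ φ ∈ S, (∀ i < k.succ, φ i = φ₀ i) ∧ L.edgeValue φ k ≠ s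
          · exact Or.inr hs
          left
          push Not at hs
          refine le_trans ?_ (hD n s (φ₀ k.castSucc))
          rw [← Set.ncard_coe_finset]
          apply Set.ncard_le_ncard _ (Set.toFinite _)
          intro a ha
          obtain ⟨φ, hφ, rfl⟩ := Finset.mem_image.1 (Finset.mem_coe.1 ha)
          obtain ⟨hφ, hpre⟩ := Finset.mem_filter.1 hφ
          have := hs φ hφ hpre
          rw [Link.edgeValue, hpre k.castSucc Fin.castSucc_lt_succ] at this
          exact this
        rcases hF k hk with ho | ⟨j, hjk, hj⟩
        · rcases hrow (t (w k)) with h | ⟨φ, hφ, -, hne⟩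
          · exact h
          · exact absurd (hO φ hφ k ho) hne
        · rcases hrow (L.edgeValue φ₀ j) with h | ⟨φ, hφ, hpre, hne⟩
          · exact h
          · refine absurd ?_ hne
            rw [← hw φ hφ j k hj, Link.edgeValue, Link.edgeValue, hpre, hpre]
            · exact Fin.succ_lt_succ_iff.2 hjk
            · exact lt_of_lt_of_le Fin.castSucc_lt_succ (Fin.succ_le_succ_iff.2 hjk.le))
  refine key.trans (le_of_eq ?_)
  rw [Fin.prod_univ_succ]
  simp only [Fin.cons_zero, Fin.cons_succ]
  rw [Finset.prod_ite, Finset.prod_const, Finset.prod_const, pow_add, pow_one, mul_assoc]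
  congr 3
  · simp
  · rw [Finset.filter_not, Finset.filter_mem_eq_inter, Finset.univ_inter,
      ← Finset.compl_eq_univ_sdiff, Finset.card_compl, Fintype.card_fin]


/-- Circuits whose steps have their link values determined by labels: the labels outside `O` are
among `A`. -/
theorem card_circuits_le {ι Λ : Type*} {L : Link ι} {D : ℕ} (hD : RowBound L D) (hD1 : 1 ≤ D)
    {n h : ℕ} (S : Finset (Fin (h + 1) → Fin n)) (w : Fin h → Λ) (O : Set Λ) (t : Λ → ι)
    (A : Finset Λ)
    (hw : ∀ φ ∈ S, ∀ i j, w i = w j → L.edgeValue φ i = L.edgeValue φ j)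
    (hO : ∀ φ ∈ S, ∀ i, w i ∈ O → L.edgeValue φ i = t (w i))
    (hA : ∀ k, w k ∈ O ∨ w k ∈ A) :
    S.card ≤ n ^ (1 + A.card) * D ^ h := by
  classical
  rcases S.eq_empty_or_nonempty with rfl | ⟨φ, _⟩
  · simp
  have hn : 1 ≤ n := Nat.one_le_iff_ne_zero.2 (by rintro rfl; exact (φ 0).elim0)
  set F : Finset (Fin h) := Finset.univ.filter fun k => w k ∉ O ∧ ∀ j < k, w j ≠ w k with hFdef
  have hF : F.card ≤ A.card := by
    apply Finset.card_le_card_of_injOn w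
    · intro k hk
      have hk' := (Finset.mem_filter.1 (Finset.mem_coe.1 hk)).2
      exact (hA k).resolve_left hk'.1
    · intro i hi j hj hij
      have hi' := (Finset.mem_filter.1 (Finset.mem_coe.1 hi)).2
      have hj' := (Finset.mem_filter.1 (Finset.mem_coe.1 hj)).2
      rcases lt_trichotomy i j with h | h | h
      · exact absurd hij (hj'.2 i h)
      · exact h
      · exact absurd hij.symm (hi'.2 j h)
  refine (card_paths_le hD S F w O t hw hO ?_).trans ?_
  · intro k hk
    by_contra hcon
    push Not at hcon
    exact hk (Finset.mem_filter.2 ⟨Finset.mem_univ _, hcon.1, hcon.2⟩)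
  · exact Nat.mul_le_mul (Nat.pow_le_pow_right hn (by lia))
      (Nat.pow_le_pow_right hD1 (Nat.sub_le _ _))

/-- As `card_circuits_le`, but the label of one step `e` need not be counted: the circuit closes. -/
theorem card_circuits_le_of_closing {ι Λ : Type*} {L : Link ι} {D : ℕ} (hD : RowBound L D)
    (hD1 : 1 ≤ D) {n h : ℕ} (S : Finset (Fin (h + 1) → Fin n)) (hS : ∀ φ ∈ S, IsCircuit φ)
    (w : Fin h → Λ) (O : Set Λ) (t : Λ → ι) (A : Finset Λ) (e : Fin h)
    (hw : ∀ φ ∈ S, ∀ i j, w i = w j → L.edgeValue φ i = L.edgeValue φ j)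
    (hO : ∀ φ ∈ S, ∀ i, w i ∈ O → L.edgeValue φ i = t (w i))
    (hA : ∀ k, k ≠ e → w k ∈ O ∨ w k ∈ A) :
    S.card ≤ n ^ (1 + A.card) * D ^ h := by
  classical
  obtain _ | N := h
  · exact e.elim0
  -- The circuit is restarted at the endpoint of the edge `e`, and `e`, now the last edge, is
  -- dropped. Vertices wrap after `N + 1` but edges after `N`: where the two conventions differ, the
  -- vertices `0` and `Fin.last` coincide because the path is closed.
  let rot : Fin (N + 1) → Fin (N + 2) := fun k =>
    if hk : e.val + 1 + k.val ≤ N + 1 then ⟨e.val + 1 + k.val, by lia⟩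
    else ⟨e.val + 1 + k.val - (N + 1), by lia⟩
  let edge : Fin N → Fin (N + 1) := fun k =>
    if hk : e.val + 1 + k.val < N + 1 then ⟨e.val + 1 + k.val, by lia⟩
    else ⟨e.val + 1 + k.val - (N + 1), by lia⟩
  have hedge : ∀ k, edge k ≠ e := by
    intro k hk
    have := congrArg Fin.val hk
    simp only [edge] at this
    split_ifs at this <;> simp at this <;> lia
  have hval : ∀ φ ∈ S, ∀ k : Fin N, L.edgeValue (φ ∘ rot) k = L.edgeValue φ (edge k) := by
    intro φ hφ k
    have hc : φ 0 = φ (Fin.last (N + 1)) := hS φ hφ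
    have h1 : φ (rot k.castSucc) = φ (edge k).castSucc := by
      simp only [rot, edge, Fin.val_castSucc]
      rcases lt_trichotomy (e.val + 1 + k.val) (N + 1) with h | h | h
      · rw [dif_pos h.le, dif_pos h]; rfl
      · rw [dif_pos h.le, dif_neg (by lia)]
        have e1 : (⟨e.val + 1 + k.val, by lia⟩ : Fin (N + 2)) = Fin.last (N + 1) := Fin.ext h
        have e2 : (Fin.castSucc ⟨e.val + 1 + k.val - (N + 1), by lia⟩ : Fin (N + 2)) = 0 :=
          Fin.ext (by simp; lia)
        rw [e1, e2, hc]
      · rw [dif_neg (by lia), dif_neg (by lia)]; rfl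
    have h2 : φ (rot k.succ) = φ (edge k).succ := by
      congr 1
      simp only [rot, edge, Fin.val_succ]
      apply Fin.ext
      split_ifs <;> simp <;> lia
    rw [Link.edgeValue, Link.edgeValue, ← h1, ← h2]; rfl
  -- The range of `rot` is every index except `0`, and the vertex at `0` is recovered from
  -- closedness.
  have hinj : Set.InjOn (fun φ : Fin (N + 2) → Fin n => φ ∘ rot) S := by
    intro φ hφ ψ hψ hφψ
    have hpos : ∀ i : Fin (N + 2), i ≠ 0 → φ i = ψ i := by
      intro i hi
      have hi0 : i.val ≠ 0 := fun h => hi (Fin.ext h)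
      by_cases hie : e.val + 1 ≤ i.val
      · have := congrFun hφψ ⟨i.val - (e.val + 1), by lia⟩
        have hr : rot ⟨i.val - (e.val + 1), by lia⟩ = i := by
          simp only [rot]
          rw [dif_pos (by lia)]
          exact Fin.ext (by simp; lia)
        simpa [hr] using this
      · have := congrFun hφψ ⟨i.val + (N + 1) - (e.val + 1), by lia⟩
        have hr : rot ⟨i.val + (N + 1) - (e.val + 1), by lia⟩ = i := by
          simp only [rot]
          rw [dif_neg (by lia)]
          exact Fin.ext (by simp; lia)
        simpa [hr] using this
    funext i
    by_cases hi : i = 0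
    · subst hi
      have h1 : φ 0 = φ (Fin.last (N + 1)) := hS φ hφ
      have h2 : ψ 0 = ψ (Fin.last (N + 1)) := hS ψ hψ
      rw [h1, h2]
      exact hpos _ (by simp [Fin.ext_iff])
    · exact hpos i hi
  rw [← Finset.card_image_of_injOn hinj]
  refine (card_circuits_le hD hD1 (S.image fun φ => φ ∘ rot) (fun k => w (edge k)) O t A
    ?_ ?_ fun k => hA _ (hedge k)).trans ?_
  · intro φ hφ i j hij
    obtain ⟨ψ, hψ, rfl⟩ := Finset.mem_image.1 hφ
    rw [hval ψ hψ, hval ψ hψ]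
    exact hw ψ hψ _ _ hij
  · intro φ hφ i hi
    obtain ⟨ψ, hψ, rfl⟩ := Finset.mem_image.1 hφ
    rw [hval ψ hψ]
    exact hO ψ hψ _ hi
  · exact Nat.mul_le_mul_left _ (Nat.pow_le_pow_right hD1 (Nat.le_succ N))

end SchurHadamard

namespace SchurHadamard

/-! ### Families of circuits with common link values -/

/-- Every entry of the array `v` occurs at least twice. -/
def JointlyMatched {m h : ℕ} {Λ : Type*} (v : Fin m → Fin h → Λ) : Prop :=
  ∀ q : Fin m × Fin h, ∃ q' ≠ q, v q'.1 q'.2 = v q.1 q.2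

/-- Every row of the array `v` has an entry in common with another row. -/
def CrossMatched {m h : ℕ} {Λ : Type*} (v : Fin m → Fin h → Λ) : Prop :=
  ∀ j, ∃ j' ≠ j, ∃ i i', v j' i' = v j i

/-- Row `j` of `w` has an entry that occurs once in it and not at all in the rows `j'` with
`r j' j`. -/
def Closing {m h : ℕ} {Λ : Type*} (w : Fin m → Fin h → Λ) (r : Fin m → Fin m → Prop) (j : Fin m) :
    Prop :=
  ∃ e, (∀ i ≠ e, w j i ≠ w j e) ∧ ∀ j', r j' j → ∀ i, w j' i ≠ w j e

/-- The set of entries of the array `w`. -/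
def entries {m h : ℕ} {Λ : Type*} [DecidableEq Λ] (w : Fin m → Fin h → Λ) : Finset Λ :=
  Finset.univ.image fun q : Fin m × Fin h => w q.1 q.2

-- Rows are chosen in increasing order. A row costs one power of n for its starting vertex and one
-- for each label not seen in earlier rows. A closing row has a new label on a single edge, and that
-- edge is determined by the rest of the circuit, so one power is saved.
open Classical in
theorem card_families_le {ι Λ : Type*} {L : Link ι} {D : ℕ} (hD : RowBound L D)
    (hD1 : 1 ≤ D) {m n h : ℕ} (S : Finset (Fin m → Fin (h + 1) → Fin n))
    (hS : ∀ φ ∈ S, ∀ j, IsCircuit (φ j)) (w : Fin m → Fin h → Λ)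
    (hw : ∀ φ ∈ S, ∀ j i j' i', w j i = w j' i' →
      L.edgeValue (φ j) i = L.edgeValue (φ j') i') :
    ∃ E, E + (Finset.univ.filter (Closing w (· < ·))).card ≤ m + (entries w).card ∧
      S.card ≤ n ^ E * D ^ (m * h) := by
  set c : Fin m → Prop := Closing w (· < ·) with hc
  let old : Fin m → Set Λ := fun j => {l | ∃ j' < j, ∃ i, w j' i = l}
  let new : Fin m → Finset Λ := fun j => (Finset.univ.image (w j)).filter fun l => l ∉ old j
  have hex : ∀ j, ∃ A ⊆ new j, A.card + (if c j then 1 else 0) = (new j).card ∧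
      ∀ φ₀ ∈ S, ((S.filter fun φ => ∀ i < j, φ i = φ₀ i).image fun φ => φ j).card
        ≤ n ^ (1 + A.card) * D ^ h := by
    intro j
    have hlab : ∀ k, w j k ∈ old j ∨ w j k ∈ new j := by
      intro k
      by_cases hk : w j k ∈ old j
      · exact Or.inl hk
      · exact Or.inr (Finset.mem_filter.2 ⟨Finset.mem_image_of_mem _ (Finset.mem_univ _), hk⟩)
    have hdata : ∀ φ₀ ∈ S, ∃ t : Λ → ι,
        ∀ ψ ∈ (S.filter fun φ => ∀ i < j, φ i = φ₀ i).image fun φ => φ j,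
          IsCircuit ψ ∧ (∀ i i', w j i = w j i' → L.edgeValue ψ i = L.edgeValue ψ i') ∧
          ∀ i, w j i ∈ old j → L.edgeValue ψ i = t (w j i) := by
      intro φ₀ hφ₀
      by_cases hh : h = 0
      · subst hh
        by_cases hne : Nonempty ι
        · refine ⟨fun _ => hne.some, ?_⟩
          intro ψ hψ
          obtain ⟨φ, hφ, rfl⟩ := Finset.mem_image.1 hψ
          exact ⟨hS φ (Finset.mem_filter.1 hφ).1 j, fun i => i.elim0, fun i => i.elim0⟩
        · exact absurd ⟨L n (φ₀ j 0) (φ₀ j 0)⟩ hne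
      have hι : Nonempty ι := ⟨L n (φ₀ j 0) (φ₀ j 0)⟩
      -- An old label sits at a position of an earlier row, where all families with the given prefix
      -- agree with `φ₀`; its link value is read off there. The value at other labels is irrelevant.
      refine ⟨fun l => if hl : l ∈ old j then
        L.edgeValue (φ₀ hl.choose) hl.choose_spec.2.choose else hι.some, ?_⟩
      intro ψ hψ
      obtain ⟨φ, hφ, rfl⟩ := Finset.mem_image.1 hψ
      obtain ⟨hφ, hpre⟩ := Finset.mem_filter.1 hφ
      refine ⟨hS φ hφ j, fun i i' => hw φ hφ j i j i', fun i hi => ?_⟩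
      simp only
      rw [dif_pos hi, ← hpre _ hi.choose_spec.1]
      exact hw φ hφ _ _ _ _ hi.choose_spec.2.choose_spec.symm
    by_cases hj : c j
    · obtain ⟨e, he1, he2⟩ := id hj
      have heold : w j e ∉ old j := by
        rintro ⟨j', hj', i, hi⟩
        exact he2 j' hj' i hi
      have hemem : w j e ∈ new j := (hlab e).resolve_left heold
      refine ⟨(new j).erase (w j e), Finset.erase_subset _ _, ?_, ?_⟩
      · rw [if_pos hj, Finset.card_erase_add_one hemem]
      · intro φ₀ hφ₀
        obtain ⟨t, ht⟩ := hdata φ₀ hφ₀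
        refine card_circuits_le_of_closing hD hD1 _ (fun ψ hψ => (ht ψ hψ).1) (w j) (old j) t _ e
          (fun ψ hψ => (ht ψ hψ).2.1) (fun ψ hψ => (ht ψ hψ).2.2) ?_
        intro k hk
        exact (hlab k).imp id fun hk' => Finset.mem_erase.2 ⟨he1 k hk, hk'⟩
    · refine ⟨new j, subset_rfl, by rw [if_neg hj, add_zero], ?_⟩
      intro φ₀ hφ₀
      obtain ⟨t, ht⟩ := hdata φ₀ hφ₀
      exact card_circuits_le hD hD1 _ (w j) (old j) t _
        (fun ψ hψ => (ht ψ hψ).2.1) (fun ψ hψ => (ht ψ hψ).2.2) hlab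
  choose A hA hcard hcount using hex
  refine ⟨∑ j, (1 + (A j).card), ?_, ?_⟩
  · have h1 : ∑ j, (new j).card ≤ (entries w).card := by
      rw [← Finset.card_biUnion]
      · apply Finset.card_le_card
        intro l hl
        obtain ⟨j, -, hl⟩ := Finset.mem_biUnion.1 hl
        obtain ⟨i, -, rfl⟩ := Finset.mem_image.1 (Finset.mem_filter.1 hl).1
        exact Finset.mem_image.2 ⟨(j, i), Finset.mem_univ _, rfl⟩
      · have key : ∀ a b, a < b → Disjoint (new a) (new b) := by
          intro a b hab
          rw [Finset.disjoint_left]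
          intro l hla hlb
          obtain ⟨i, -, rfl⟩ := Finset.mem_image.1 (Finset.mem_filter.1 hla).1
          exact (Finset.mem_filter.1 hlb).2 ⟨a, hab, i, rfl⟩
        intro a _ b _ hab
        rcases lt_or_gt_of_ne hab with h | h
        · exact key a b h
        · exact (key b a h).symm
    have h2 : (Finset.univ.filter c).card = ∑ j, if c j then 1 else 0 := by
      rw [Finset.card_filter]
    rw [h2, ← Finset.sum_add_distrib]
    calc ∑ j, (1 + (A j).card + if c j then 1 else 0) = ∑ j, (1 + (new j).card) := by
          refine Finset.sum_congr rfl fun j _ => ?_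
          rw [← hcard j]; ring
      _ ≤ m + (entries w).card := by
          rw [Finset.sum_add_distrib]
          simpa using h1
  · refine (card_le_prod_of_prefix S _ fun j φ₀ hφ₀ => hcount j φ₀ hφ₀).trans (le_of_eq ?_)
    rw [Finset.prod_mul_distrib, Finset.prod_pow_eq_pow_sum, Finset.prod_const, Finset.card_univ,
      Fintype.card_fin, ← pow_mul, mul_comm m h]

open Classical in
/-- The savings from closing circuits, counted for both orders of the circuits, and from entries
that occur more than twice add up to at least one for each circuit. -/
theorem closing_savings {m h : ℕ} {Λ : Type*} (w : Fin m → Fin h → Λ)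
    (hm : JointlyMatched w) (hc : CrossMatched w) :
    m + 2 * (entries w).card ≤ (Finset.univ.filter (Closing w (· < ·))).card +
      (Finset.univ.filter (Closing w (· > ·))).card + m * h := by
  choose f hf e e' hfe using hc
  -- Each row is charged to one entry that it shares with another row.
  let u : Fin m → Λ := fun j => w j (e j)
  let mult : Fin m → Λ → ℕ := fun j l => (Finset.univ.filter fun i => w j i = l).card
  let M : Λ → ℕ := fun l => (Finset.univ.filter fun q : Fin m × Fin h => w q.1 q.2 = l).card
  have hMsum : ∀ l, M l = ∑ j, mult j l := by
    intro l
    simp only [M, mult, Finset.card_filter]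
    rw [Fintype.sum_prod_type]
  have hM2 : ∀ l ∈ entries w, 2 ≤ M l := by
    intro l hl
    obtain ⟨q, -, rfl⟩ := Finset.mem_image.1 hl
    obtain ⟨q', hne, hq'⟩ := hm q
    exact Finset.one_lt_card.2 ⟨q', by simpa using hq', q, by simp, hne⟩
  have hMtot : ∑ l ∈ entries w, M l = m * h := by
    have := Finset.card_eq_sum_card_image (fun q : Fin m × Fin h => w q.1 q.2) Finset.univ
    rw [Finset.card_univ, Fintype.card_prod, Fintype.card_fin, Fintype.card_fin] at this
    exact this.symm
  have hu : ∀ j, u j ∈ entries w := fun j =>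
    Finset.mem_image.2 ⟨(j, e j), Finset.mem_univ _, rfl⟩
  have hpos : ∀ j l, mult j l ≠ 0 ↔ ∃ i, w j i = l := by
    intro j l
    simp only [mult, ne_eq, Finset.card_eq_zero]
    rw [← ne_eq, ← Finset.nonempty_iff_ne_empty]
    constructor
    · rintro ⟨i, hi⟩; exact ⟨i, by simpa using hi⟩
    · rintro ⟨i, hi⟩; exact ⟨i, by simpa using hi⟩
  have hone : ∀ j i, mult j (w j i) = 1 → ∀ i' ≠ i, w j i' ≠ w j i := by
    intro j i h1 i' hne heq
    obtain ⟨a, ha⟩ := Finset.card_eq_one.1 h1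
    have h2 : i ∈ ({a} : Finset (Fin h)) := ha ▸ (by simp)
    have h3 : i' ∈ ({a} : Finset (Fin h)) := ha ▸ (by simpa using heq)
    rw [Finset.mem_singleton] at h2 h3
    exact hne (h3.trans h2.symm)
  let cl : Fin m → ℕ := fun j => (if Closing w (· < ·) j then 1 else 0) +
    if Closing w (· > ·) j then 1 else 0
  -- The inequality is proved label by label. Every occurrence of `l` beyond the second pays for one
  -- row charged to `l`; the deficit of at most two is covered by the first and the last row
  -- containing `l`.
  have hloc : ∀ l ∈ entries w, (Finset.univ.filter fun j => u j = l).card + 2 ≤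
      ∑ j ∈ Finset.univ.filter (fun j => u j = l), cl j + M l := by
    intro l hl
    rcases (Finset.univ.filter fun j => u j = l).eq_empty_or_nonempty with hJ | ⟨j₀, hj₀⟩
    · rw [hJ]; simpa using hM2 l hl
    have hj₀ : u j₀ = l := by simpa using hj₀
    let R : Finset (Fin m) := Finset.univ.filter fun j => mult j l ≠ 0
    have hR : ∀ j, j ∈ R ↔ mult j l ≠ 0 := fun j => by simp [R]
    have hRj₀ : j₀ ∈ R := (hR _).2 ((hpos _ _).2 ⟨e j₀, hj₀⟩)
    have hRf : f j₀ ∈ R := (hR _).2 ((hpos _ _).2 ⟨e' j₀, (hfe j₀).trans hj₀⟩)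
    have hRne : R.Nonempty := ⟨_, hRj₀⟩
    have hab : R.min' hRne ≠ R.max' hRne := by
      intro hEq
      have h1 := (R.min'_le _ hRj₀).antisymm ((R.le_max' _ hRj₀).trans hEq.ge)
      have h2 := (R.min'_le _ hRf).antisymm ((R.le_max' _ hRf).trans hEq.ge)
      exact hf j₀ (h2.symm.trans h1)
    set a := R.min' hRne with ha
    set b := R.max' hRne with hb
    -- No row before the first one contains `l`, so a single occurrence there closes the row in the
    -- increasing order; the last row plays the same role in the decreasing order.
    have hca : u a = l → mult a l = 1 → Closing w (· < ·) a := by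
      intro hua h1
      refine ⟨e a, hone a _ (by rw [← hua] at h1; exact h1), fun j' hj' i hi => ?_⟩
      exact absurd (R.min'_le j' ((hR _).2 ((hpos _ _).2 ⟨i, hi.trans hua⟩))) (not_le.2 hj')
    have hcb : u b = l → mult b l = 1 → Closing w (· > ·) b := by
      intro hub h1
      refine ⟨e b, hone b _ (by rw [← hub] at h1; exact h1), fun j' hj' i hi => ?_⟩
      exact absurd (R.le_max' j' ((hR _).2 ((hpos _ _).2 ⟨i, hi.trans hub⟩))) (not_le.2 hj')
    have ham : mult a l ≠ 0 := (hR _).1 (R.min'_mem hRne)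
    have hbm : mult b l ≠ 0 := (hR _).1 (R.max'_mem hRne)
    have hpt : ∀ j, ((if u j = l then 1 else 0) + (if j = a then 1 else 0) +
        if j = b then 1 else 0) ≤ (if u j = l then cl j else 0) + mult j l := by
      intro j
      have hj1 : u j = l → mult j l ≠ 0 := fun h => (hpos _ _).2 ⟨e j, h⟩
      by_cases hja : j = a
      · subst hja
        rw [if_pos rfl, if_neg hab]
        by_cases hua : u a = l
        · rw [if_pos hua, if_pos hua]
          by_cases h1 : mult a l = 1
          · have : 1 ≤ cl a := by simp only [cl]; rw [if_pos (hca hua h1)]; lia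
            lia
          · lia
        · rw [if_neg hua, if_neg hua]; lia
      · rw [if_neg hja]
        by_cases hjb : j = b
        · subst hjb
          rw [if_pos rfl]
          by_cases hua : u b = l
          · rw [if_pos hua, if_pos hua]
            by_cases h1 : mult b l = 1
            · have : 1 ≤ cl b := by simp only [cl]; rw [if_pos (hcb hua h1)]; lia
              lia
            · lia
          · rw [if_neg hua, if_neg hua]; lia
        · rw [if_neg hjb]
          by_cases hua : u j = l
          · have := hj1 hua
            rw [if_pos hua, if_pos hua]; lia
          · rw [if_neg hua]; lia
    have hsum := Finset.sum_le_sum fun j (_ : j ∈ Finset.univ) => hpt j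
    rw [Finset.sum_add_distrib, Finset.sum_add_distrib, Finset.sum_add_distrib, ← hMsum,
      ← Finset.card_filter, Finset.sum_ite_eq', Finset.sum_ite_eq', if_pos (Finset.mem_univ _),
      if_pos (Finset.mem_univ _), ← Finset.sum_filter] at hsum
    lia
  have hsum := Finset.sum_le_sum hloc
  rw [Finset.sum_add_distrib, Finset.sum_add_distrib, hMtot, Finset.sum_const, smul_eq_mul,
    Finset.sum_fiberwise_of_maps_to (fun j _ => hu j),
    ← Finset.card_eq_sum_card_fiberwise (fun j _ => hu j)] at hsum
  simp only [cl] at hsum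
  rw [Finset.sum_add_distrib, ← Finset.card_filter, ← Finset.card_filter, Finset.card_univ,
    Fintype.card_fin] at hsum
  lia

/-- The count is made for the circuits in the given order and in the reversed order.
`closing_savings` bounds the sum of the two exponents by 4h + 4, so one of them is at most 2h + 2;
neither order alone need be good enough. -/
theorem card_families_le_of_matched {ι Λ : Type*} {L : Link ι} {D : ℕ} (hD : RowBound L D)
    (hD1 : 1 ≤ D) {n h : ℕ} (S : Finset (Fin 4 → Fin (h + 1) → Fin n))
    (hS : ∀ φ ∈ S, ∀ j, IsCircuit (φ j)) (w : Fin 4 → Fin h → Λ)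
    (hw : ∀ φ ∈ S, ∀ j i j' i', w j i = w j' i' →
      L.edgeValue (φ j) i = L.edgeValue (φ j') i')
    (hm : JointlyMatched w) (hc : CrossMatched w) :
    S.card ≤ n ^ (2 * h + 2) * D ^ (4 * h) := by
  classical
  rcases S.eq_empty_or_nonempty with rfl | ⟨φ, _⟩
  · simp
  have hn : 1 ≤ n := Nat.one_le_iff_ne_zero.2 (by rintro rfl; exact (φ 0 0).elim0)
  have hsav := closing_savings w hm hc
  obtain ⟨E, hE, hcard⟩ := card_families_le hD hD1 S hS w hw
  let S' := S.image fun φ => φ ∘ Fin.rev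
  obtain ⟨E', hE', hcard'⟩ := card_families_le hD hD1 S'
    (fun φ hφ j => by
      obtain ⟨ψ, hψ, rfl⟩ := Finset.mem_image.1 hφ
      exact hS ψ hψ _) (w ∘ Fin.rev)
    (fun φ hφ j i j' i' => by
      obtain ⟨ψ, hψ, rfl⟩ := Finset.mem_image.1 hφ
      exact hw ψ hψ _ _ _ _)
  have hS' : S'.card = S.card := by
    apply Finset.card_image_of_injective
    intro a b hab
    funext j
    have := congrFun hab j.rev
    simpa using this
  have hent : (entries (w ∘ Fin.rev)).card = (entries w).card := by
    congr 1
    ext l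
    simp only [entries, Finset.mem_image, Finset.mem_univ, true_and, Prod.exists,
      Function.comp_apply]
    exact ⟨fun ⟨a, b, hab⟩ => ⟨a.rev, b, hab⟩, fun ⟨a, b, hab⟩ => ⟨a.rev, b, by simpa using hab⟩⟩
  have hclo : (Finset.univ.filter (Closing (w ∘ Fin.rev) (· < ·))).card =
      (Finset.univ.filter (Closing w (· > ·))).card := by
    rw [← Finset.card_map (Fin.revPerm (n := 4)).toEmbedding]
    congr 1
    ext j
    simp only [Finset.mem_map_equiv, Finset.mem_filter, Finset.mem_univ, true_and, Closing,
      Function.comp_apply, Fin.revPerm_symm, Fin.revPerm_apply, Fin.rev_rev]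
    refine exists_congr fun e => and_congr_right fun _ => ?_
    constructor
    · intro H j' hj' i
      have := H j'.rev (Fin.rev_lt_rev.2 hj') i
      simpa using this
    · intro H j' hj' i
      exact H j'.rev (by rw [gt_iff_lt, ← Fin.rev_lt_rev, Fin.rev_rev]; exact hj') i
  rw [hS'] at hcard'
  rw [hent, hclo] at hE'
  rcases le_or_gt E (2 * h + 2) with h1 | h1
  · exact hcard.trans (Nat.mul_le_mul_right _ (Nat.pow_le_pow_right hn h1))
  · exact hcard'.trans (Nat.mul_le_mul_right _ (Nat.pow_le_pow_right hn (by lia)))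

/-- Each array has the same coincidences as an array with entries in a fixed finite type. -/
theorem exists_same_kernel {X ι : Type*} (v : X → ι) : ∃ w : X → X, ∀ a b, w a = w b ↔ v a = v b := by
  refine ⟨fun a => (⟨a, rfl⟩ : ∃ b, v b = v a).choose, fun a b => ⟨fun h => ?_, fun h => ?_⟩⟩
  · have h1 := (⟨a, rfl⟩ : ∃ c, v c = v a).choose_spec
    have h2 := (⟨b, rfl⟩ : ∃ c, v c = v b).choose_spec
    simp only at h
    rw [← h1, ← h2, h]
  · simp only [h]

-- Quadruples are sorted by the coincidence pattern of their link values, and the number of patterns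
-- does not depend on n.
open Classical in
theorem exists_card_crossMatched_le {ι : Type*} {L : Link ι} {D : ℕ} (hD : RowBound L D)
    (hD1 : 1 ≤ D) (h : ℕ) : ∃ K : ℕ, ∀ n : ℕ,
      (Finset.univ.filter fun φ : Fin 4 → Fin (h + 1) → Fin n => (∀ j, IsCircuit (φ j)) ∧
        JointlyMatched (fun j => L.edgeValue (φ j)) ∧
        CrossMatched (fun j => L.edgeValue (φ j))).card ≤ K * n ^ (2 * h + 2) := by
  let W := Fin 4 × Fin h → Fin 4 × Fin h
  refine ⟨Fintype.card W * D ^ (4 * h), fun n => ?_⟩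
  let S : W → Finset (Fin 4 → Fin (h + 1) → Fin n) := fun w =>
    Finset.univ.filter fun φ => ((∀ j, IsCircuit (φ j)) ∧
        JointlyMatched (fun j => L.edgeValue (φ j)) ∧
        CrossMatched (fun j => L.edgeValue (φ j))) ∧
        ∀ a b, w a = w b ↔ L.edgeValue (φ a.1) a.2 = L.edgeValue (φ b.1) b.2
  have hS : ∀ w, (S w).card ≤ n ^ (2 * h + 2) * D ^ (4 * h) := by
    intro w
    rcases (S w).eq_empty_or_nonempty with he | ⟨φ, hφ⟩
    · rw [he]; simp
    have hφ' := (Finset.mem_filter.1 hφ).2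
    refine card_families_le_of_matched hD hD1 (S w) (fun ψ hψ => (Finset.mem_filter.1 hψ).2.1.1)
      (fun j i => w (j, i))
      (fun ψ hψ j i j' i' hw => ((Finset.mem_filter.1 hψ).2.2 (j, i) (j', i')).1 hw) ?_ ?_
    · intro q
      obtain ⟨q', hne, hq'⟩ := hφ'.1.2.1 q
      exact ⟨q', hne, (hφ'.2 q' q).2 hq'⟩
    · intro j
      obtain ⟨j', hne, i, i', hi⟩ := hφ'.1.2.2 j
      exact ⟨j', hne, i, i', (hφ'.2 (j', i') (j, i)).2 hi⟩
  calc _ ≤ (Finset.univ.biUnion S).card := by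
        apply Finset.card_le_card
        intro φ hφ
        obtain ⟨w, hw⟩ := exists_same_kernel
          fun a : Fin 4 × Fin h => L.edgeValue (φ a.1) a.2
        exact Finset.mem_biUnion.2 ⟨w, Finset.mem_univ _,
          Finset.mem_filter.2 ⟨Finset.mem_univ _, (Finset.mem_filter.1 hφ).2, hw⟩⟩
    _ ≤ ∑ w, (S w).card := Finset.card_biUnion_le
    _ ≤ ∑ _w : W, n ^ (2 * h + 2) * D ^ (4 * h) := Finset.sum_le_sum fun w _ => hS w
    _ = _ := by rw [Finset.sum_const, smul_eq_mul, Finset.card_univ]; ring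

/-- Every value of `v` is taken at least twice. -/
def Matched {h : ℕ} {Λ : Type*} (v : Fin h → Λ) : Prop := ∀ i, ∃ j ≠ i, v j = v i

/-- Every value of `v` is taken exactly twice. -/
def PairMatched {h : ℕ} {Λ : Type*} (v : Fin h → Λ) : Prop :=
  ∀ i, {j | v j = v i}.ncard = 2

/-- The multiplicities are all at least 2, one of them is at least 3, and their sum is `h`. -/
theorem two_mul_card_image_lt {h : ℕ} {Λ : Type*} [DecidableEq Λ] (v : Fin h → Λ) (hm : Matched v)
    (hp : ¬ PairMatched v) : 2 * (Finset.univ.image v).card < h := by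
  have h1 := Finset.card_eq_sum_card_image v Finset.univ
  rw [Finset.card_univ, Fintype.card_fin] at h1
  have h2 : ∀ l ∈ Finset.univ.image v, 2 ≤ (Finset.univ.filter fun i => v i = l).card := by
    intro l hl
    obtain ⟨i, -, rfl⟩ := Finset.mem_image.1 hl
    obtain ⟨j, hne, hj⟩ := hm i
    exact Finset.one_lt_card.2 ⟨j, by simpa using hj, i, by simp, hne⟩
  unfold PairMatched at hp
  push Not at hp
  obtain ⟨i, hi⟩ := hp
  have h3 : 2 < (Finset.univ.filter fun j => v j = v i).card := by
    refine lt_of_le_of_ne (h2 _ (Finset.mem_image_of_mem _ (Finset.mem_univ i))) ?_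
    rw [← Set.ncard_coe_finset]
    simpa using hi.symm
  have h4 := Finset.sum_lt_sum h2 ⟨v i, Finset.mem_image_of_mem _ (Finset.mem_univ i), h3⟩
  rw [Finset.sum_const, smul_eq_mul] at h4
  lia

open Classical in
/-- Circuits whose link values are all matched, but not all exactly twice, are few. -/
theorem exists_card_matched_le {ι : Type*} {L : Link ι} {D : ℕ} (hD : RowBound L D)
    (hD1 : 1 ≤ D) (h : ℕ) : ∃ K : ℕ, ∀ n : ℕ,
      ((Finset.univ.filter fun φ : Fin (h + 1) → Fin n =>
        Matched (L.edgeValue φ) ∧ ¬ PairMatched (L.edgeValue φ)).card) ^ 2 ≤ K * n ^ (h + 1) := by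
  let W := Fin h → Fin h
  refine ⟨(Fintype.card W * D ^ h) ^ 2, fun n => ?_⟩
  rcases Nat.eq_zero_or_pos n with rfl | hn
  · have : IsEmpty (Fin (h + 1) → Fin 0) := ⟨fun φ => (φ 0).elim0⟩
    rw [Finset.univ_eq_empty]; simp
  let S : W → Finset (Fin (h + 1) → Fin n) := fun w =>
    Finset.univ.filter fun φ => (Matched (L.edgeValue φ) ∧ ¬ PairMatched (L.edgeValue φ)) ∧
        ∀ a b, w a = w b ↔ L.edgeValue φ a = L.edgeValue φ b
  have hS : ∀ w, (S w).card ≤ n ^ ((h + 1) / 2) * D ^ h := by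
    intro w
    rcases (S w).eq_empty_or_nonempty with he | ⟨φ, hφ⟩
    · rw [he]; simp
    have hφ' := (Finset.mem_filter.1 hφ).2
    have hlt : 2 * (Finset.univ.image w).card < h := by
      apply two_mul_card_image_lt
      · intro i
        obtain ⟨j, hne, hj⟩ := hφ'.1.1 i
        exact ⟨j, hne, (hφ'.2 _ _).2 hj⟩
      · intro hp
        apply hφ'.1.2
        intro i
        rw [← hp i]
        congr 1
        ext j
        exact (hφ'.2 j i).symm
    refine (card_circuits_le hD hD1 (S w) w ∅ (fun i => L.edgeValue φ i) (Finset.univ.image w)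
      (fun ψ hψ i j hw => ((Finset.mem_filter.1 hψ).2.2 i j).1 hw)
      (fun ψ hψ i hi => absurd hi (Set.notMem_empty _)) fun k =>
        Or.inr (Finset.mem_image_of_mem _ (Finset.mem_univ _))).trans ?_
    -- With b labels, 2b < h gives 1 + b ≤ (h + 1) / 2 even with rounding down. The final bound is
    -- on the square of the count, so half-integer exponents are avoided.
    exact Nat.mul_le_mul_right _ (Nat.pow_le_pow_right hn (by lia))
  have hle : (Finset.univ.filter fun φ : Fin (h + 1) → Fin n =>
        Matched (L.edgeValue φ) ∧ ¬ PairMatched (L.edgeValue φ)).card ≤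
        Fintype.card W * D ^ h * n ^ ((h + 1) / 2) := by
    calc _ ≤ (Finset.univ.biUnion S).card := by
          apply Finset.card_le_card
          intro φ hφ
          obtain ⟨w, hw⟩ := exists_same_kernel (L.edgeValue φ)
          exact Finset.mem_biUnion.2 ⟨w, Finset.mem_univ _,
            Finset.mem_filter.2 ⟨Finset.mem_univ _, (Finset.mem_filter.1 hφ).2, hw⟩⟩
      _ ≤ ∑ w, (S w).card := Finset.card_biUnion_le
      _ ≤ ∑ _w : W, n ^ ((h + 1) / 2) * D ^ h := Finset.sum_le_sum fun w _ => hS w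
      _ = _ := by rw [Finset.sum_const, smul_eq_mul, Finset.card_univ]; ring
  calc _ ≤ (Fintype.card W * D ^ h * n ^ ((h + 1) / 2)) ^ 2 := Nat.pow_le_pow_left hle 2
    _ = (Fintype.card W * D ^ h) ^ 2 * n ^ ((h + 1) / 2 * 2) := by ring
    _ ≤ _ := Nat.mul_le_mul_left _ (Nat.pow_le_pow_right hn (by lia))

end SchurHadamard

namespace SchurHadamard

/-! ### Words -/

/-- By the alphabetical rule a letter larger than `w'.1 i` could appear at `i` only if `w'.1 i` had
occurred earlier in `w`. It would then also occur earlier in `w'`, and the common coincidences would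
contradict that the letter at `i` is new. -/
theorem word_le_of_agree {h : ℕ} (w w' : Word h)
    (hk : ∀ i j, w.1 i = w.1 j ↔ w'.1 i = w'.1 j) (i : Fin h)
    (ih : ∀ j < i, w.1 j = w'.1 j) (hnew : ∀ j < i, w.1 j ≠ w.1 i) : w.1 i ≤ w'.1 i := by
  by_contra hlt
  push Not at hlt
  obtain ⟨j, hj, hj'⟩ := w.2 i (w'.1 i) hlt
  rw [ih j hj] at hj'
  exact hnew j hj ((hk j i).2 hj')

/-- A word is determined by its coincidences. -/
theorem word_ext {h : ℕ} {w w' : Word h} (hk : ∀ i j, w.1 i = w.1 j ↔ w'.1 i = w'.1 j) :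
    w = w' := by
  apply Subtype.ext
  funext i
  induction i using WellFoundedLT.induction with
  | ind i ih =>
    by_cases hex : ∃ j < i, w.1 j = w.1 i
    · obtain ⟨j, hj, hji⟩ := hex
      rw [← hji, ih j hj, (hk j i).1 hji]
    · push Not at hex
      apply le_antisymm
      · exact word_le_of_agree w w' hk i ih hex
      · exact word_le_of_agree w' w (fun a b => (hk a b).symm) i (fun j hj => (ih j hj).symm)
          fun j hj he => hex j hj ((hk j i).2 he)

/-- Every pattern of coincidences is the one of a word. -/
theorem exists_word {h : ℕ} {Λ : Type*} (v : Fin h → Λ) :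
    ∃ w : Word h, ∀ i j, w.1 i = w.1 j ↔ v i = v j := by
  classical
  -- The letter at `i` is the number of first-occurrence positions before the first occurrence of `v
  -- i`. `Nat.nth` inverts `Nat.count`, which shows that every smaller letter has been used before.
  let first : ℕ → Prop := fun a => ∃ ha : a < h, ∀ j : Fin h, j < ⟨a, ha⟩ → v j ≠ v ⟨a, ha⟩
  have hne : ∀ i, (Finset.univ.filter fun j => v j = v i).Nonempty := fun i => ⟨i, by simp⟩
  let f : Fin h → Fin h := fun i => (Finset.univ.filter fun j => v j = v i).min' (hne i)
  have hfv : ∀ i, v (f i) = v i := fun i => by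
    have := Finset.min'_mem _ (hne i)
    simpa using this
  have hfle : ∀ i j, v j = v i → f i ≤ j := fun i j hij =>
    Finset.min'_le _ _ (by simpa using hij)
  have hff : ∀ i, first (f i) := by
    intro i
    refine ⟨(f i).2, fun j hj he => ?_⟩
    exact absurd (hfle i j (he.trans (hfv i))) (not_le.2 hj)
  have hfin : (Set.ofPred first).Finite := by
    apply (Set.finite_lt_nat h).subset
    rintro a ⟨ha, _⟩
    exact ha
  let w : Fin h → Fin h := fun i =>
    ⟨Nat.count first (f i), lt_of_le_of_lt (Nat.count_le first) (f i).2⟩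
  have hww : ∀ i j, w i = w j ↔ v i = v j := by
    intro i j
    constructor
    · intro he
      have h1 := Nat.count_injective (hff i) (hff j) (congrArg Fin.val he)
      rw [← hfv i, ← hfv j, Fin.ext h1]
    · intro he
      have : f i = f j := by simp only [f, he]
      simp only [w, this]
  refine ⟨⟨w, ?_⟩, hww⟩
  intro i c hc
  have hc' : c.val < Nat.count first (f i) := hc
  have hcard : ∀ hf : (Set.ofPred first).Finite, c.val < hf.toFinset.card := fun hf =>
    hc'.trans (Nat.count_lt_card hf (hff i))
  have hp : first (Nat.nth first c) := Nat.nth_mem _ hcard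
  have hlt : Nat.nth first c < f i := Nat.nth_lt_of_lt_count hc'
  obtain ⟨hh, hfirst⟩ := id hp
  let j : Fin h := ⟨Nat.nth first c, hh⟩
  have hfj : f j = j := by
    apply le_antisymm (hfle j j rfl)
    by_contra hlt'
    push Not at hlt'
    exact hfirst _ hlt' (hfv j)
  refine ⟨j, lt_of_lt_of_le (show j < f i from hlt) (hfle i i rfl), ?_⟩
  apply Fin.ext
  simp only [w, hfj]
  exact Nat.count_nth hcard

theorem word_pairMatched_iff {h : ℕ} {Λ : Type*} {w : Word h} {v : Fin h → Λ}
    (hk : ∀ i j, w.1 i = w.1 j ↔ v i = v j) : w.PairMatched ↔ PairMatched v := by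
  refine forall_congr' fun i => ?_
  rw [← Set.ncard_coe_finset]
  have : (↑(Finset.univ.filter fun j => w.1 j = w.1 i) : Set (Fin h)) = {j | v j = v i} := by
    ext j
    simpa using hk j i
  rw [this]

theorem mem_pairMatchedWords {h : ℕ} {w : Word h} : w ∈ pairMatchedWords h ↔ w.PairMatched := by
  simp [pairMatchedWords]

/-- The involution that exchanges positions carrying the same letter. -/
theorem exists_partner {h : ℕ} {w : Word h} (hw : w.PairMatched) :
    ∃ s : Equiv.Perm (Fin h), (∀ i, s i ≠ i) ∧ ∀ i j, w.1 j = w.1 i ↔ j = i ∨ j = s i := by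
  have hex : ∀ i, ∃ j ≠ i, ∀ k, w.1 k = w.1 i ↔ k = i ∨ k = j := by
    intro i
    obtain ⟨a, b, hab, hs⟩ := Finset.card_eq_two.1 (hw i)
    have hmem : ∀ k, w.1 k = w.1 i ↔ k = a ∨ k = b := by
      intro k
      have : k ∈ Finset.univ.filter (fun j => w.1 j = w.1 i) ↔ k ∈ ({a, b} : Finset (Fin h)) := by
        rw [hs]
      simpa using this
    rcases (hmem i).1 rfl with rfl | rfl
    · exact ⟨b, hab.symm, hmem⟩
    · exact ⟨a, hab, fun k => (hmem k).trans or_comm⟩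
  choose f hf hfw using hex
  have hinv : Function.Involutive f := by
    intro i
    have h1 : w.1 (f i) = w.1 i := (hfw i (f i)).2 (Or.inr rfl)
    have h2 := (hfw (f i) i).1 h1.symm
    exact (h2.resolve_left (hf i).symm).symm
  exact ⟨hinv.toPerm f, hf, hfw⟩

/-- A pair-matched word is determined by the fixed-point-free involution that swaps equal letters,
and the permutations with k cycles of length 2 are counted by the formula for a conjugacy class. -/
theorem card_pairMatchedWords_mul_le (k : ℕ) :
    (pairMatchedWords (2 * k)).card * (2 ^ k * k.factorial) ≤ (2 * k).factorial := by
  classical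
  have hex : ∀ w : Word (2 * k), ∃ s : Equiv.Perm (Fin (2 * k)),
      w.PairMatched → (∀ i, s i ≠ i) ∧ ∀ i j, w.1 j = w.1 i ↔ j = i ∨ j = s i := by
    intro w
    by_cases hw : w.PairMatched
    · obtain ⟨s, hs⟩ := exists_partner hw
      exact ⟨s, fun _ => hs⟩
    · exact ⟨1, fun h => absurd h hw⟩
  choose s hs using hex
  have hcard : (pairMatchedWords (2 * k)).card ≤
      (Finset.univ.filter fun g : Equiv.Perm (Fin (2 * k)) =>
        g.cycleType = Multiset.replicate k 2).card := by
    apply Finset.card_le_card_of_injOn s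
    · intro w hw
      obtain ⟨hfix, hsw⟩ := hs w (mem_pairMatchedWords.1 (Finset.mem_coe.1 hw))
      have hsq : s w ^ 2 = 1 := by
        ext i
        have h1 : w.1 (s w i) = w.1 i := (hsw i (s w i)).2 (Or.inr rfl)
        have h2 := ((hsw (s w i) i).1 h1.symm).resolve_left (hfix i).symm
        rw [pow_two, Equiv.Perm.mul_apply, ← h2, Equiv.Perm.one_apply]
      have htwo : ∀ a ∈ (s w).cycleType, a = 2 := by
        intro a ha
        exact le_antisymm (Nat.le_of_dvd two_pos
          ((Equiv.Perm.dvd_of_mem_cycleType ha).trans (orderOf_dvd_of_pow_eq_one hsq)))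
          (Equiv.Perm.two_le_of_mem_cycleType ha)
      have hrep := Multiset.eq_replicate_card.2 htwo
      have hsum := (s w).sum_cycleType
      have hsupp : (s w).support = Finset.univ := by
        ext i; simp [hfix i]
      rw [hsupp, Finset.card_univ, Fintype.card_fin, hrep, Multiset.sum_replicate,
        smul_eq_mul] at hsum
      have hk : (s w).cycleType.card = k := by lia
      rw [Finset.mem_coe, Finset.mem_filter]
      exact ⟨Finset.mem_univ _, by rw [hrep, hk]⟩
    · intro w hw w' hw' hww'
      obtain ⟨-, hsw⟩ := hs w (mem_pairMatchedWords.1 (Finset.mem_coe.1 hw))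
      obtain ⟨-, hsw'⟩ := hs w' (mem_pairMatchedWords.1 (Finset.mem_coe.1 hw'))
      apply word_ext
      intro i j
      rw [hsw j i, hsw' j i, hww']
  refine (Nat.mul_le_mul_right _ hcard).trans ?_
  have hmul := Equiv.Perm.card_of_cycleType_mul_eq (Fin (2 * k)) (Multiset.replicate k 2)
  rw [Multiset.sum_replicate, Multiset.prod_replicate, Fintype.card_fin, smul_eq_mul,
    mul_comm k 2, Nat.sub_self, Nat.factorial_zero, one_mul] at hmul
  have hprod : ∏ n ∈ (Multiset.replicate k 2).toFinset,
      ((Multiset.replicate k 2).count n).factorial = k.factorial := by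
    rcases Nat.eq_zero_or_pos k with rfl | hk
    · simp
    · rw [Multiset.toFinset_replicate, if_neg hk.ne', Finset.prod_singleton,
        Multiset.count_replicate_self]
  rw [hprod] at hmul
  rw [hmul]
  split_ifs <;> simp

/-! ### The limit moments -/

/-- The free steps are the k first occurrences, so just k steps cost a factor `D`. This exact
exponent, rather than the crude `D ^ h` of `card_circuits_le`, is what the bound on the limit
moments requires. -/
theorem circuits_ncard_le {ι : Type*} {L : Link ι} {D : ℕ} (hD : RowBound L D)
    {n k : ℕ} {w : Word (2 * k)} (hw : w.PairMatched) :
    (circuits L n w).ncard ≤ n ^ (1 + k) * D ^ k := by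
  classical
  rcases (circuits L n w).eq_empty_or_nonempty with he | ⟨φ, _⟩
  · rw [he]; simp
  rw [Set.ncard_eq_toFinset_card _ (Set.toFinite _)]
  set F : Finset (Fin (2 * k)) := Finset.univ.filter fun i => ∀ j < i, w.1 j ≠ w.1 i with hF
  have hFcard : F.card = k := by
    have h1 := Finset.card_eq_sum_card_image w.1 Finset.univ
    rw [Finset.card_univ, Fintype.card_fin] at h1
    have h2 : ∀ l ∈ Finset.univ.image w.1, (Finset.univ.filter fun i => w.1 i = l).card = 2 := by
      intro l hl
      obtain ⟨i, -, rfl⟩ := Finset.mem_image.1 hl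
      exact hw i
    rw [Finset.sum_congr rfl h2, Finset.sum_const, smul_eq_mul] at h1
    have h3 : F.card = (Finset.univ.image w.1).card := by
      apply Finset.card_bij (fun i _ => w.1 i)
      · intro i _
        exact Finset.mem_image_of_mem _ (Finset.mem_univ _)
      · intro i hi j hj hij
        have hi' := (Finset.mem_filter.1 hi).2
        have hj' := (Finset.mem_filter.1 hj).2
        rcases lt_trichotomy i j with h | h | h
        · exact absurd hij (hj' i h)
        · exact h
        · exact absurd hij.symm (hi' j h)
      · intro l hl
        obtain ⟨i, -, rfl⟩ := Finset.mem_image.1 hl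
        have hne : (Finset.univ.filter fun j => w.1 j = w.1 i).Nonempty := ⟨i, by simp⟩
        refine ⟨(Finset.univ.filter fun j => w.1 j = w.1 i).min' hne, ?_, ?_⟩
        · rw [Finset.mem_filter]
          refine ⟨Finset.mem_univ _, fun j hj he => ?_⟩
          have hm := Finset.min'_mem _ hne
          rw [Finset.mem_filter] at hm
          exact absurd (Finset.min'_le _ j (by
            rw [Finset.mem_filter]; exact ⟨Finset.mem_univ _, he.trans hm.2⟩)) (not_le.2 hj)
        · have hm := Finset.min'_mem _ hne
          rw [Finset.mem_filter] at hm
          exact hm.2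
    lia
  have h := card_paths_le hD (Set.toFinite (circuits L n w)).toFinset F w.1 ∅
    (fun _ => L n (φ 0) (φ 0))
    (fun ψ hψ i j hij => (((Set.Finite.mem_toFinset _).1 hψ).2 i j).1 hij)
    (fun ψ hψ i hi => absurd hi (Set.notMem_empty _)) (by
      intro i hi
      right
      by_contra hcon
      push Not at hcon
      exact hi (Finset.mem_filter.2 ⟨Finset.mem_univ _, hcon⟩))
  rw [hFcard] at h
  refine h.trans (le_of_eq ?_)
  congr 2
  lia

-- Every circuit belongs to exactly one word for each link.
open Classical in
theorem sum_jointCircuits_ncard {ι κ : Type*} (LX : Link ι) (LY : Link κ) (h n : ℕ) :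
    ∑ w ∈ pairMatchedWords h, ∑ w' ∈ pairMatchedWords h, (jointCircuits LX LY n w w').ncard =
      (Finset.univ.filter fun φ : Fin (h + 1) → Fin n => IsCircuit φ ∧
        PairMatched (LX.edgeValue φ) ∧ PairMatched (LY.edgeValue φ)).card := by
  rw [← Finset.sum_product']
  have h1 : ∀ q : Word h × Word h, (jointCircuits LX LY n q.1 q.2).ncard =
      (jointCircuits LX LY n q.1 q.2).toFinset.card := fun q => Set.ncard_eq_toFinset_card' _
  simp_rw [h1]
  rw [← Finset.card_biUnion]
  · congr 1
    ext φ
    rw [Finset.mem_biUnion, Finset.mem_filter]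
    constructor
    · rintro ⟨⟨w, w'⟩, hq, hφ⟩
      rw [Finset.mem_product, mem_pairMatchedWords, mem_pairMatchedWords] at hq
      rw [Set.mem_toFinset] at hφ
      exact ⟨Finset.mem_univ _, hφ.1.1, (word_pairMatched_iff hφ.1.2).1 hq.1,
        (word_pairMatched_iff hφ.2.2).1 hq.2⟩
    · rintro ⟨-, hc, hX, hY⟩
      obtain ⟨w, hw⟩ := exists_word (LX.edgeValue φ)
      obtain ⟨w', hw'⟩ := exists_word (LY.edgeValue φ)
      refine ⟨(w, w'), ?_, ?_⟩
      · rw [Finset.mem_product, mem_pairMatchedWords, mem_pairMatchedWords]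
        exact ⟨(word_pairMatched_iff hw).2 hX, (word_pairMatched_iff hw').2 hY⟩
      · rw [Set.mem_toFinset]
        exact ⟨⟨hc, hw⟩, hc, hw'⟩
  · rintro ⟨a, a'⟩ _ ⟨b, b'⟩ _ hne
    rw [Function.onFun, Finset.disjoint_left]
    intro φ ha hb
    rw [Set.mem_toFinset] at ha hb
    apply hne
    have e1 : a = b := word_ext fun i j => (ha.1.2 i j).trans (hb.1.2 i j).symm
    have e2 : a' = b' := word_ext fun i j => (ha.2.2 i j).trans (hb.2.2 i j).symm
    rw [e1, e2]

open Classical in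
/-- The number of circuits that are pair-matched for both links. -/
noncomputable def pairCount {ι κ : Type*} (LX : Link ι) (LY : Link κ) (h n : ℕ) : ℕ :=
  (Finset.univ.filter fun φ : Fin (h + 1) → Fin n => IsCircuit φ ∧
        PairMatched (LX.edgeValue φ) ∧ PairMatched (LY.edgeValue φ)).card

theorem pairCount_comm {ι κ : Type*} (LX : Link ι) (LY : Link κ) (h n : ℕ) :
    pairCount LX LY h n = pairCount LY LX h n := by
  unfold pairCount
  congr 1
  ext φ
  simp only [Finset.mem_filter]
  tauto

theorem tendsto_pairCount {ι κ : Type*} {LX : Link ι} {LY : Link κ}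
    {p : (h : ℕ) → Word h → Word h → ℝ} (hp : IsWordLimit LX LY p) (k : ℕ) :
    Tendsto (fun n : ℕ => (pairCount LX LY (2 * k) n : ℝ) / (n : ℝ) ^ (1 + k)) atTop
      (𝓝 (limitMoment p (2 * k))) := by
  have h1 : limitMoment p (2 * k) = ∑ w ∈ pairMatchedWords (2 * k),
      ∑ w' ∈ pairMatchedWords (2 * k), p (2 * k) w w' := by
    rw [limitMoment, if_neg]
    simp
  rw [h1]
  have h2 : (fun n : ℕ => (pairCount LX LY (2 * k) n : ℝ) / (n : ℝ) ^ (1 + k)) = fun n =>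
      ∑ w ∈ pairMatchedWords (2 * k), ∑ w' ∈ pairMatchedWords (2 * k),
        ((jointCircuits LX LY n w w').ncard : ℝ) / (n : ℝ) ^ (1 + k) := by
    funext n
    rw [pairCount, ← sum_jointCircuits_ncard]
    push_cast
    simp_rw [Finset.sum_div]
  rw [h2]
  refine tendsto_finsetSum _ fun w hw => tendsto_finsetSum _ fun w' hw' => ?_
  exact hp k w w' (mem_pairMatchedWords.1 hw) (mem_pairMatchedWords.1 hw')

theorem pairCount_le {ι κ : Type*} {LX : Link ι} (LY : Link κ) {D : ℕ} (hD : RowBound LX D)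
    (k n : ℕ) :
    pairCount LX LY (2 * k) n ≤ (pairMatchedWords (2 * k)).card * (n ^ (1 + k) * D ^ k) := by
  classical
  calc pairCount LX LY (2 * k) n
      ≤ ((pairMatchedWords (2 * k)).biUnion fun w => (circuits LX n w).toFinset).card := by
        apply Finset.card_le_card
        intro φ hφ
        obtain ⟨-, hc, hX, -⟩ := Finset.mem_filter.1 hφ
        obtain ⟨w, hw⟩ := exists_word (LX.edgeValue φ)
        refine Finset.mem_biUnion.2 ⟨w, mem_pairMatchedWords.2 ((word_pairMatched_iff hw).2 hX), ?_⟩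
        rw [Set.mem_toFinset]
        exact ⟨hc, hw⟩
    _ ≤ ∑ w ∈ pairMatchedWords (2 * k), (circuits LX n w).toFinset.card := Finset.card_biUnion_le
    _ ≤ ∑ _w ∈ pairMatchedWords (2 * k), n ^ (1 + k) * D ^ k := by
        refine Finset.sum_le_sum fun w hw => ?_
        rw [← Set.ncard_eq_toFinset_card']
        exact circuits_ncard_le hD (mem_pairMatchedWords.1 hw)
    _ = _ := by rw [Finset.sum_const, smul_eq_mul]

/-- The second link only restricts the circuits further, and the count is symmetric in the links, so
a row bound for either one suffices. -/
theorem limitMoment_le_of_rowBound {ι κ : Type*} {LX : Link ι} {LY : Link κ}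
    {p : (h : ℕ) → Word h → Word h → ℝ} (hp : IsWordLimit LX LY p) {D : ℕ}
    (hD : RowBound LX D ∨ RowBound LY D) (k : ℕ) :
    limitMoment p (2 * k) ≤
      ((2 * k).factorial : ℝ) / (2 ^ k * (k.factorial : ℝ)) * (D : ℝ) ^ k := by
  refine le_of_tendsto (tendsto_pairCount hp k) ?_
  filter_upwards [eventually_gt_atTop 0] with n hn
  have h1 : pairCount LX LY (2 * k) n ≤
      (pairMatchedWords (2 * k)).card * (n ^ (1 + k) * D ^ k) := by
    rcases hD with hD | hD
    · exact pairCount_le LY hD k n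
    · rw [pairCount_comm]; exact pairCount_le LX hD k n
  have h2 := card_pairMatchedWords_mul_le k
  have hn' : (0 : ℝ) < (n : ℝ) ^ (1 + k) := by positivity
  rw [div_le_iff₀ hn']
  have h1' : (pairCount LX LY (2 * k) n : ℝ) ≤
      (pairMatchedWords (2 * k)).card * ((n : ℝ) ^ (1 + k) * (D : ℝ) ^ k) := by exact_mod_cast h1
  have h2' : ((pairMatchedWords (2 * k)).card : ℝ) ≤
      ((2 * k).factorial : ℝ) / (2 ^ k * (k.factorial : ℝ)) := by
    rw [le_div_iff₀ (by positivity)]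
    exact_mod_cast h2
  calc (pairCount LX LY (2 * k) n : ℝ) ≤ _ := h1'
    _ ≤ ((2 * k).factorial : ℝ) / (2 ^ k * (k.factorial : ℝ)) *
        ((n : ℝ) ^ (1 + k) * (D : ℝ) ^ k) := by gcongr
    _ = _ := by ring

theorem rowBound_toNat_min_Delta {ι κ : Type*} {LX : Link ι} {LY : Link κ}
    (hXB : LX.PropertyB) (hYB : LY.PropertyB) :
    RowBound LX (min LX.Delta LY.Delta).toNat ∨ RowBound LY (min LX.Delta LY.Delta).toNat := by
  rcases min_choice LX.Delta LY.Delta with h | h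
  · rw [h]; exact Or.inl (rowBound_toNat_Delta hXB)
  · rw [h]; exact Or.inr (rowBound_toNat_Delta hYB)

theorem one_le_toNat_min_Delta {ι κ : Type*} {LX : Link ι} {LY : Link κ}
    (hXB : LX.PropertyB) (hYB : LY.PropertyB) : 1 ≤ (min LX.Delta LY.Delta).toNat := by
  rcases min_choice LX.Delta LY.Delta with h | h
  · rw [h]; exact one_le_toNat_Delta hXB
  · rw [h]; exact one_le_toNat_Delta hYB

theorem pairMatched_two {Λ : Type*} {v : Fin 2 → Λ} (hv : v 0 = v 1) : PairMatched v := by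
  intro i
  have : {j | v j = v i} = Set.univ := by
    ext j
    fin_cases i <;> fin_cases j <;> simp [hv]
  rw [this, Set.ncard_univ]
  simp

/-- By symmetry of the links both edges of the circuit a, b, a have the same value, so all n² closed
paths of length 2 count. The normalisation excludes a limit law concentrated at 0. -/
theorem limitMoment_two {ι κ : Type*} {LX : Link ι} {LY : Link κ} (hX : LX.IsSymm)
    (hY : LY.IsSymm) {p : (h : ℕ) → Word h → Word h → ℝ} (hp : IsWordLimit LX LY p) :
    limitMoment p 2 = 1 := by
  refine tendsto_nhds_unique (tendsto_pairCount hp 1) ?_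
  refine tendsto_const_nhds.congr' ?_
  filter_upwards [eventually_gt_atTop 0] with n hn
  have h1 : pairCount LX LY (2 * 1) n = n ^ 2 := by
    classical
    unfold pairCount
    have : n ^ 2 = (Finset.univ : Finset (Fin n × Fin n)).card := by
      simp [pow_two]
    rw [this]
    refine Finset.card_bij (fun φ _ => (φ 0, φ 1)) (fun _ _ => Finset.mem_univ _) ?_ ?_
    · intro φ hφ ψ hψ he
      have h1 : φ 0 = φ 2 := (Finset.mem_filter.1 hφ).2.1
      have h2 : ψ 0 = ψ 2 := (Finset.mem_filter.1 hψ).2.1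
      obtain ⟨e0, e1⟩ := Prod.mk.inj he
      funext i
      fin_cases i
      · exact e0
      · exact e1
      · exact h1.symm.trans (e0.trans h2)
    · rintro ⟨a, b⟩ -
      refine ⟨![a, b, a], Finset.mem_filter.2 ⟨Finset.mem_univ _, rfl, ?_, ?_⟩, rfl⟩
      · exact pairMatched_two (hX n a b)
      · exact pairMatched_two (hY n a b)
  rw [h1]
  have : (n : ℝ) ≠ 0 := by positivity
  push_cast
  field_simp

end SchurHadamard

namespace SchurHadamard

/-! ### Families with uniformly bounded moments -/

section UniformMoments

variable {Ω A B : Type*} [MeasurableSpace Ω] {P : Measure Ω}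

/-- A family of random variables all of whose absolute moments are bounded uniformly. -/
def UniformMoments (P : Measure Ω) (f : A → Ω → ℝ) : Prop :=
  (∀ a, Measurable (f a)) ∧ ∀ m : ℕ, ∃ C : ℝ, ∀ a,
    Integrable (fun ω => |f a ω| ^ m) P ∧ ∫ ω, |f a ω| ^ m ∂P ≤ C

theorem UniformMoments.comp {f : A → Ω → ℝ} (hf : UniformMoments P f) (g : B → A) :
    UniformMoments P fun b => f (g b) :=
  ⟨fun b => hf.1 (g b), fun m => (hf.2 m).imp fun _ hC b => hC (g b)⟩

theorem UniformMoments.of_bound {f : A → Ω → ℝ} (hf : ∀ a, Measurable (f a))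
    (h : ∀ m : ℕ, ∃ g : A → Ω → ℝ, ∃ C : ℝ, ∀ a, Integrable (g a) P ∧ ∫ ω, g a ω ∂P ≤ C ∧
      ∀ᵐ ω ∂P, |f a ω| ^ m ≤ g a ω) : UniformMoments P f := by
  refine ⟨hf, fun m => ?_⟩
  obtain ⟨g, C, hg⟩ := h m
  refine ⟨C, fun a => ?_⟩
  obtain ⟨hi, hC, hle⟩ := hg a
  have hint : Integrable (fun ω => |f a ω| ^ m) P := by
    refine hi.mono' ((hf a).abs.pow_const m).aestronglyMeasurable ?_
    filter_upwards [hle] with ω hω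
    rwa [Real.norm_eq_abs, abs_of_nonneg (by positivity)]
  exact ⟨hint, (integral_mono_ae hint hi hle).trans hC⟩

/-- |fg|^m ≤ |f|^{2m} + |g|^{2m}, so no independence is needed. -/
theorem UniformMoments.mul {f g : A → Ω → ℝ} (hf : UniformMoments P f)
    (hg : UniformMoments P g) : UniformMoments P fun a ω => f a ω * g a ω := by
  refine UniformMoments.of_bound (fun a => (hf.1 a).mul (hg.1 a)) fun m => ?_
  obtain ⟨C, hC⟩ := hf.2 (2 * m)
  obtain ⟨C', hC'⟩ := hg.2 (2 * m)
  refine ⟨fun a ω => |f a ω| ^ (2 * m) + |g a ω| ^ (2 * m), C + C', fun a =>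
    ⟨(hC a).1.add (hC' a).1, ?_, ae_of_all _ fun ω => ?_⟩⟩
  · rw [integral_add (hC a).1 (hC' a).1]
    exact add_le_add (hC a).2 (hC' a).2
  · simp only [abs_mul, mul_pow, pow_mul']
    nlinarith [sq_nonneg (|f a ω| ^ m - |g a ω| ^ m), sq_nonneg (|f a ω| ^ m),
      sq_nonneg (|g a ω| ^ m)]

theorem UniformMoments.add {f g : A → Ω → ℝ} (hf : UniformMoments P f)
    (hg : UniformMoments P g) : UniformMoments P fun a ω => f a ω + g a ω := by
  refine UniformMoments.of_bound (fun a => (hf.1 a).add (hg.1 a)) fun m => ?_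
  obtain ⟨C, hC⟩ := hf.2 m
  obtain ⟨C', hC'⟩ := hg.2 m
  refine ⟨fun a ω => 2 ^ (m - 1) * (|f a ω| ^ m + |g a ω| ^ m), 2 ^ (m - 1) * (C + C'), fun a =>
    ⟨((hC a).1.add (hC' a).1).const_mul _, ?_, ae_of_all _ fun ω => ?_⟩⟩
  · rw [integral_const_mul, integral_add (hC a).1 (hC' a).1]
    exact mul_le_mul_of_nonneg_left (add_le_add (hC a).2 (hC' a).2) (by positivity)
  · exact (pow_le_pow_left₀ (abs_nonneg _) (abs_add_le _ _) m).trans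
      (add_pow_le (abs_nonneg _) (abs_nonneg _) m)

theorem UniformMoments.const [IsProbabilityMeasure P] {c : A → ℝ} {K : ℝ}
    (hc : ∀ a, |c a| ≤ K) : UniformMoments P fun a (_ : Ω) => c a := by
  refine ⟨fun a => measurable_const, fun m => ⟨K ^ m, fun a => ⟨integrable_const _, ?_⟩⟩⟩
  simpa using pow_le_pow_left₀ (abs_nonneg _) (hc a) m

/-- Taking the vector of indices as the parameter makes the bounds uniform over all circuits and all
n. -/
theorem UniformMoments.prod [IsProbabilityMeasure P] {f : B → Ω → ℝ} (hf : UniformMoments P f) :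
    ∀ h : ℕ, UniformMoments P fun (v : Fin h → B) ω => ∏ i, f (v i) ω := by
  intro h
  induction h with
  | zero =>
    simpa using UniformMoments.const (P := P) (A := Fin 0 → B) (c := fun _ => 1) (K := 1) (by simp)
  | succ h ih =>
    simp_rw [Fin.prod_univ_succ]
    exact (hf.comp fun v : Fin (h + 1) → B => v 0).mul (ih.comp fun (v : Fin (h + 1) → B) i => v i.succ)

theorem UniformMoments.integrable {f : A → Ω → ℝ} (hf : UniformMoments P f) (a : A) :
    Integrable (f a) P := by
  obtain ⟨C, hC⟩ := hf.2 1
  have := (hC a).1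
  simp only [pow_one] at this
  exact (integrable_norm_iff (hf.1 a).aestronglyMeasurable).1 this

theorem UniformMoments.exists_abs_integral_le {f : A → Ω → ℝ} (hf : UniformMoments P f) :
    ∃ K : ℝ, 0 ≤ K ∧ ∀ a, |∫ ω, f a ω ∂P| ≤ K := by
  obtain ⟨C, hC⟩ := hf.2 1
  refine ⟨max C 0, le_max_right _ _, fun a => (abs_integral_le_integral_abs).trans ?_⟩
  have := (hC a).2
  simp only [pow_one] at this
  exact this.trans (le_max_left _ _)

theorem UniformMoments.sub_integral [IsProbabilityMeasure P] {f : A → Ω → ℝ}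
    (hf : UniformMoments P f) : UniformMoments P fun a ω => f a ω - ∫ ω', f a ω' ∂P := by
  obtain ⟨K, -, hK⟩ := hf.exists_abs_integral_le
  simp_rw [sub_eq_add_neg]
  exact hf.add (UniformMoments.const (K := K) fun a => by rw [abs_neg]; exact hK a)

theorem UniformMoments.memLp {f : A → Ω → ℝ} (hf : UniformMoments P f) (a : A) {m : ℕ}
    (hm : m ≠ 0) : MemLp (f a) m P := by
  obtain ⟨C, hC⟩ := hf.2 m
  rw [← integrable_norm_rpow_iff (hf.1 a).aestronglyMeasurable (by simpa using hm)
    (by simp)]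
  simpa using (hC a).1

theorem InputA3.uniformMoments {x : A → Ω → ℝ} (hx : InputA3 P x) : UniformMoments P x :=
  ⟨hx.1.measurable, hx.2⟩

theorem InputA1.inputA3 [IsProbabilityMeasure P] {x : A → Ω → ℝ} (hx : InputA1 P x) :
    InputA3 P x := by
  obtain ⟨hs, C, hC⟩ := hx
  refine ⟨hs, (UniformMoments.of_bound hs.measurable fun m =>
    ⟨fun _ _ => C ^ m, C ^ m, fun a => ⟨integrable_const _, by simp, ?_⟩⟩).2⟩
  filter_upwards [hC a] with ω hω
  exact pow_le_pow_left₀ (abs_nonneg _) hω m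

end UniformMoments

/-! ### Expectations of products of independent variables -/

section Independence

variable {Ω ι κ : Type*} [MeasurableSpace Ω] {P : Measure Ω}

/-- The σ-algebra generated by the variables with index in `S`. -/
abbrev sigmaOf {Ω : Type*} (x : ι → Ω → ℝ) (S : Set ι) : MeasurableSpace Ω :=
  ⨆ i ∈ S, MeasurableSpace.comap (x i) inferInstance

theorem measurable_sigmaOf {Ω ι : Type*} {x : ι → Ω → ℝ} {S : Set ι} {i : ι} (hi : i ∈ S) :
    Measurable[sigmaOf x S] (x i) :=
  (comap_measurable (x i)).mono
    (le_iSup₂_of_le (f := fun i (_ : i ∈ S) => MeasurableSpace.comap (x i) inferInstance)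
      i hi le_rfl) le_rfl

theorem integral_mul_of_disjoint {x : ι → Ω → ℝ} (hx : ∀ i, Measurable (x i))
    (hi : iIndepFun x P) {S T : Set ι} (hST : Disjoint S T) {F G : Ω → ℝ}
    (hF : Measurable[sigmaOf x S] F) (hG : Measurable[sigmaOf x T] G) :
    ∫ ω, F ω * G ω ∂P = (∫ ω, F ω ∂P) * ∫ ω, G ω ∂P := by
  have hle : ∀ i, MeasurableSpace.comap (x i) inferInstance ≤ ‹MeasurableSpace Ω› :=
    fun i => (hx i).comap_le
  have h := indep_iSup_of_disjoint hle hi.iIndep hST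
  have hFG : IndepFun F G P := by
    rw [IndepFun_iff_Indep]
    exact indep_of_indep_of_le_left (indep_of_indep_of_le_right h hG.comap_le) hF.comap_le
  have hS : sigmaOf x S ≤ ‹MeasurableSpace Ω› := iSup₂_le fun i _ => hle i
  have hT : sigmaOf x T ≤ ‹MeasurableSpace Ω› := iSup₂_le fun i _ => hle i
  exact hFG.integral_fun_mul_eq_mul_integral (hF.mono hS le_rfl).aestronglyMeasurable
    (hG.mono hT le_rfl).aestronglyMeasurable

/-- The product of the variables with indices `v 0, …, v (h - 1)`. -/
def prodVar (x : ι → Ω → ℝ) {h : ℕ} (v : Fin h → ι) (ω : Ω) : ℝ := ∏ i, x (v i) ω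

theorem measurable_sigmaOf_prod {Ω ι : Type*} {x : ι → Ω → ℝ} {S : Set ι} {h : ℕ} {v : Fin h → ι}
    (s : Finset (Fin h)) (hv : ∀ i ∈ s, v i ∈ S) :
    Measurable[sigmaOf x S] fun ω => ∏ i ∈ s, x (v i) ω :=
  @Finset.measurable_fun_prod _ _ _ _ _ _ (sigmaOf x S) _ s fun i hi =>
    measurable_sigmaOf (hv i hi)

theorem measurable_sigmaOf_prodVar {Ω ι : Type*} {x : ι → Ω → ℝ} {S : Set ι} {h : ℕ} {v : Fin h → ι}
    (hv : ∀ i, v i ∈ S) : Measurable[sigmaOf x S] (prodVar x v) :=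
  measurable_sigmaOf_prod Finset.univ fun i _ => hv i

/-- A variable occurring once is independent of the remaining factors and has mean zero. -/
theorem integral_prodVar_eq_zero {x : ι → Ω → ℝ} (hx : StandardInput P x) {h : ℕ}
    {v : Fin h → ι} (hv : ¬ Matched v) : ∫ ω, prodVar x v ω ∂P = 0 := by
  classical
  unfold Matched at hv
  push Not at hv
  obtain ⟨i, hi⟩ := hv
  have h1 : ∀ ω, prodVar x v ω = x (v i) ω * ∏ j ∈ Finset.univ.erase i, x (v j) ω := fun ω =>
    (Finset.mul_prod_erase _ (fun j => x (v j) ω) (Finset.mem_univ i)).symm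
  simp_rw [h1]
  rw [integral_mul_of_disjoint hx.measurable hx.indep (S := {v i}) (T := {v i}ᶜ)
    disjoint_compl_right (measurable_sigmaOf rfl)
    (measurable_sigmaOf_prod _ fun j hj => hi j (Finset.ne_of_mem_erase hj)), hx.mean_zero,
    zero_mul]

theorem integral_sq_eq_one [IsProbabilityMeasure P] {x : ι → Ω → ℝ} (hx : StandardInput P x)
    (i : ι) : ∫ ω, x i ω ^ 2 ∂P = 1 := by
  have h := variance_eq_sub (hx.memLp i)
  rw [hx.variance_one, hx.mean_zero] at h
  simp at h
  exact h.symm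

theorem integral_prodVar_eq_one [IsProbabilityMeasure P] {x : ι → Ω → ℝ}
    (hx : StandardInput P x) {h : ℕ} {v : Fin h → ι} (hv : PairMatched v) :
    ∫ ω, prodVar x v ω ∂P = 1 := by
  classical
  have h1 : ∀ ω, prodVar x v ω = ∏ u : Finset.univ.image v, x u ω ^ 2 := by
    intro ω
    rw [prodVar, Finset.prod_comp (fun u => x u ω) v, ← Finset.prod_coe_sort]
    refine Finset.prod_congr rfl fun u _ => ?_
    obtain ⟨i, -, hi⟩ := Finset.mem_image.1 u.2
    congr 1
    rw [← hv i, ← Set.ncard_coe_finset]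
    congr 1
    ext j
    simp [hi]
  simp_rw [h1]
  have hind : iIndepFun (fun (u : Finset.univ.image v) ω => x u ω ^ 2) P :=
    (hx.indep.precomp (g := ((↑) : Finset.univ.image v → ι)) Subtype.val_injective).comp
      (fun _ t => t ^ 2) fun _ => by fun_prop
  rw [hind.integral_fun_prod_eq_prod_integral fun u =>
    ((hx.measurable u).pow_const 2).aestronglyMeasurable]
  exact Finset.prod_eq_one fun u _ => integral_sq_eq_one hx u

/-- A row that shares no variable with the others gives an independent centred factor. If instead
some variable occurs only once in the whole array, its own row has mean zero, so centring that row
changes nothing and the variable factors out. -/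
theorem integral_prod_centered_eq_zero {x : ι → Ω → ℝ} (hx : StandardInput P x) {m h : ℕ}
    {v : Fin m → Fin h → ι} (hv : ¬ (JointlyMatched v ∧ CrossMatched v)) [IsProbabilityMeasure P]
    (hint : ∀ j, Integrable (prodVar x (v j)) P) :
    ∫ ω, ∏ j, (prodVar x (v j) ω - ∫ ω', prodVar x (v j) ω' ∂P) ∂P = 0 := by
  classical
  have hsplit : ∀ j ω, ∏ j, (prodVar x (v j) ω - ∫ ω', prodVar x (v j) ω' ∂P) =
      (prodVar x (v j) ω - ∫ ω', prodVar x (v j) ω' ∂P) *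
        ∏ j' ∈ Finset.univ.erase j, (prodVar x (v j') ω - ∫ ω', prodVar x (v j') ω' ∂P) :=
    fun j ω => (Finset.mul_prod_erase _ _ (Finset.mem_univ j)).symm
  have hmeas : ∀ (T : Set ι) (j : Fin m), (∀ j' ≠ j, ∀ i, v j' i ∈ T) →
      Measurable[sigmaOf x T] fun ω => ∏ j' ∈ Finset.univ.erase j,
        (prodVar x (v j') ω - ∫ ω', prodVar x (v j') ω' ∂P) := by
    intro T j hT
    exact @Finset.measurable_fun_prod _ _ _ _ _ _ (sigmaOf x T) _ _ fun j' hj' =>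
      (measurable_sigmaOf_prodVar (hT j' (Finset.ne_of_mem_erase hj'))).sub_const _
  by_cases hc : CrossMatched v
  · have hj : ¬ JointlyMatched v := fun hj => hv ⟨hj, hc⟩
    unfold JointlyMatched at hj
    push Not at hj
    obtain ⟨⟨j, i⟩, hq⟩ := hj
    have hzero : ∫ ω, prodVar x (v j) ω ∂P = 0 := by
      apply integral_prodVar_eq_zero hx
      intro hm
      obtain ⟨i', hi', he⟩ := hm i
      exact hq (j, i') (by simp [hi']) he
    have h2 : ∀ ω, ∏ j, (prodVar x (v j) ω - ∫ ω', prodVar x (v j) ω' ∂P) =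
        x (v j i) ω * ((∏ i' ∈ Finset.univ.erase i, x (v j i') ω) *
          ∏ j' ∈ Finset.univ.erase j, (prodVar x (v j') ω - ∫ ω', prodVar x (v j') ω' ∂P)) := by
      intro ω
      rw [hsplit j, hzero, sub_zero, ← mul_assoc]
      congr 1
      exact (Finset.mul_prod_erase _ (fun i' => x (v j i') ω) (Finset.mem_univ i)).symm
    simp_rw [h2]
    rw [integral_mul_of_disjoint hx.measurable hx.indep (S := {v j i}) (T := {v j i}ᶜ)
      disjoint_compl_right (measurable_sigmaOf rfl), hx.mean_zero, zero_mul]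
    refine Measurable.mul (m := sigmaOf x {v j i}ᶜ) ?_ ?_
    · refine measurable_sigmaOf_prod _ fun i' hi' => hq (j, i') ?_
      simpa using Finset.ne_of_mem_erase hi'
    · refine hmeas _ j fun j' hj' i' => hq (j', i') ?_
      simp [hj']
  · unfold CrossMatched at hc
    push Not at hc
    obtain ⟨j, hj⟩ := hc
    simp_rw [hsplit j]
    have hdisj : Disjoint (Set.range (v j)) (Set.range (v j))ᶜ := disjoint_compl_right
    rw [integral_mul_of_disjoint hx.measurable hx.indep hdisj]
    · rw [integral_sub (hint j) (integrable_const _)]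
      simp
    · exact (measurable_sigmaOf_prodVar fun i => Set.mem_range_self i).sub_const _
    · refine hmeas _ j fun j' hj' i' => ?_
      rintro ⟨i, hi⟩
      exact hj j' hj' i i' hi.symm

/-- Functions of two independent families. -/
theorem integral_mul_of_indepFun {x : ι → Ω → ℝ} {y : κ → Ω → ℝ} (hx : ∀ i, Measurable (x i))
    (hy : ∀ j, Measurable (y j)) (hxy : IndepFun (fun ω i => x i ω) (fun ω j => y j ω) P)
    {F : (ι → ℝ) → ℝ} {G : (κ → ℝ) → ℝ} (hF : Measurable F) (hG : Measurable G) :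
    ∫ ω, F (fun i => x i ω) * G (fun j => y j ω) ∂P =
      (∫ ω, F (fun i => x i ω) ∂P) * ∫ ω, G (fun j => y j ω) ∂P :=
  (hxy.comp hF hG).integral_fun_mul_eq_mul_integral
    (hF.comp (measurable_pi_lambda _ hx)).aestronglyMeasurable
    (hG.comp (measurable_pi_lambda _ hy)).aestronglyMeasurable

end Independence

end SchurHadamard

namespace SchurHadamard

/-! ### Empirical spectral distributions of symmetric matrices -/

section Spectral

open Matrix

variable {n : ℕ}

theorem pow_apply_eq_sum_paths (A : Matrix (Fin n) (Fin n) ℝ) :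
    ∀ (h : ℕ) (i j : Fin n), (A ^ h) i j = ∑ φ : Fin (h + 1) → Fin n,
      if φ 0 = i ∧ φ (Fin.last h) = j then ∏ k : Fin h, A (φ k.castSucc) (φ k.succ) else 0 := by
  intro h
  induction h with
  | zero =>
    intro i j
    rw [pow_zero, ← (Equiv.funUnique (Fin 1) (Fin n)).symm.sum_comp]
    by_cases hij : i = j
    · subst hij; simp
    · rw [one_apply_ne hij]
      symm
      apply Finset.sum_eq_zero
      intro a _
      rw [if_neg]
      rintro ⟨h1, h2⟩
      exact hij (h1.symm.trans h2)
  | succ h ih =>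
    intro i j
    rw [pow_succ', mul_apply, ← (Fin.consEquiv fun _ : Fin (h + 2) => Fin n).sum_comp,
      Fintype.sum_prod_type]
    symm
    rw [Finset.sum_eq_single i]
    · simp_rw [ih, Finset.mul_sum]
      rw [Finset.sum_comm]
      refine Finset.sum_congr rfl fun φ _ => ?_
      symm
      rw [Finset.sum_eq_single (φ 0)]
      · have hl : Fin.last (h + 1) = (Fin.last h).succ := rfl
        simp only [Fin.consEquiv, Equiv.coe_fn_mk, Fin.cons_zero, true_and]
        rw [hl, Fin.cons_succ, Fin.prod_univ_succ]
        simp only [Fin.castSucc_zero, Fin.cons_zero, Fin.cons_succ, Fin.castSucc_succ]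
        split_ifs <;> simp
      · intro k _ hk
        rw [if_neg (fun h' => hk h'.1.symm), mul_zero]
      · simp
    · intro k _ hk
      apply Finset.sum_eq_zero
      intro φ _
      rw [if_neg]
      simp only [Fin.consEquiv, Equiv.coe_fn_mk, Fin.cons_zero]
      exact fun h' => hk h'.1
    · simp

open Classical in
theorem trace_pow_eq_sum_circuits (A : Matrix (Fin n) (Fin n) ℝ) (h : ℕ) :
    (A ^ h).trace = ∑ φ ∈ Finset.univ.filter (IsCircuit (h := h) (n := n)),
      ∏ k : Fin h, A (φ k.castSucc) (φ k.succ) := by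
  rw [Matrix.trace, Finset.sum_filter]
  simp_rw [diag_apply, pow_apply_eq_sum_paths]
  rw [Finset.sum_comm]
  refine Finset.sum_congr rfl fun φ _ => ?_
  rw [Finset.sum_eq_single (φ 0)]
  · simp only [true_and, IsCircuit, eq_comm]
  · intro k _ hk
    rw [if_neg (fun h' => hk h'.1.symm)]
  · simp

/-- An orthogonal diagonalization. -/
theorem exists_diagonalization {A : Matrix (Fin n) (Fin n) ℝ} (hA : A.IsHermitian) :
    ∃ U : Matrix (Fin n) (Fin n) ℝ, U * Uᵀ = 1 ∧ Uᵀ * U = 1 ∧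
      A = U * diagonal hA.eigenvalues * Uᵀ := by
  refine ⟨hA.eigenvectorUnitary, ?_, ?_, ?_⟩
  · have := Unitary.coe_mul_star_self hA.eigenvectorUnitary
    rwa [Unitary.coe_star, star_eq_conjTranspose, conjTranspose_eq_transpose_of_trivial] at this
  · have := Unitary.coe_star_mul_self hA.eigenvectorUnitary
    rwa [star_eq_conjTranspose, conjTranspose_eq_transpose_of_trivial] at this
  · have := hA.spectral_theorem
    rw [Unitary.conjStarAlgAut_apply, star_eq_conjTranspose,
      conjTranspose_eq_transpose_of_trivial] at this
    exact this

theorem esd_eq {A : Matrix (Fin n) (Fin n) ℝ} (hA : A.IsHermitian) :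
    esd A = (n : ENNReal)⁻¹ • ∑ i, Measure.dirac (hA.eigenvalues i) := by
  rw [esd, hA.roots_charpoly_eq_eigenvalues, Multiset.map_map]
  rfl

theorem isProbabilityMeasure_esd (hn : 0 < n) {A : Matrix (Fin n) (Fin n) ℝ}
    (hA : A.IsHermitian) : IsProbabilityMeasure (esd A) := by
  refine ⟨?_⟩
  rw [esd_eq hA, Measure.smul_apply, Measure.finsetSum_apply]
  simp only [measure_univ, Finset.sum_const, Finset.card_univ, Fintype.card_fin, nsmul_eq_mul,
    mul_one, smul_eq_mul]
  exact ENNReal.inv_mul_cancel (by exact_mod_cast hn.ne') (ENNReal.natCast_ne_top n)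

theorem integrable_esd (hn : 0 < n) {A : Matrix (Fin n) (Fin n) ℝ} (hA : A.IsHermitian)
    (f : ℝ → ℝ) : Integrable f (esd A) := by
  rw [esd_eq hA]
  refine Integrable.smul_measure ?_ (by simpa using hn.ne')
  rw [integrable_finsetSum_measure]
  exact fun i _ => integrable_dirac (by simp)

theorem integral_esd {A : Matrix (Fin n) (Fin n) ℝ} (hA : A.IsHermitian) (f : ℝ → ℝ) :
    ∫ t, f t ∂(esd A) = (n : ℝ)⁻¹ * ∑ i, f (hA.eigenvalues i) := by
  rw [esd_eq hA, integral_smul_measure, integral_finsetSum_measure]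
  · simp
  · exact fun i _ => integrable_dirac (by simp)

theorem esdMoment_eq {A : Matrix (Fin n) (Fin n) ℝ} (hA : A.IsHermitian) (h : ℕ) :
    esdMoment h A = (n : ℝ)⁻¹ * (A ^ h).trace := by
  rw [esdMoment, integral_esd hA]
  congr 1
  obtain ⟨U, hU, hU', hd⟩ := exists_diagonalization hA
  generalize hA.eigenvalues = a at hd ⊢
  have hpow : ∀ h : ℕ, A ^ h = U * diagonal (a ^ h) * Uᵀ := by
    intro h
    induction h with
    | zero => simp [hU]
    | succ h ih =>
      rw [pow_succ, ih]
      conv_lhs => rw [hd]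
      calc U * diagonal (a ^ h) * Uᵀ * (U * diagonal a * Uᵀ)
          = U * diagonal (a ^ h) * (Uᵀ * U) * diagonal a * Uᵀ := by
            simp only [Matrix.mul_assoc]
        _ = _ := by
            rw [hU', Matrix.mul_one, Matrix.mul_assoc U, diagonal_mul_diagonal, pow_succ]
            rfl
  rw [hpow, trace_mul_comm, ← Matrix.mul_assoc, hU', Matrix.one_mul, trace_diagonal]
  rfl

open Classical in
theorem esdCDF_eq {A : Matrix (Fin n) (Fin n) ℝ} (hA : A.IsHermitian) (t : ℝ) :
    esdCDF A t = (n : ℝ)⁻¹ * ∑ i, if hA.eigenvalues i ≤ t then (1 : ℝ) else 0 := by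
  rw [esdCDF, ← integral_indicator_one measurableSet_Iic, integral_esd hA]
  congr 1

/-- Comparison of spectral distribution functions in terms of the Frobenius norm of the
difference. -/
theorem esdCDF_le {A B : Matrix (Fin n) (Fin n) ℝ} (hA : A.IsHermitian)
    (hB : B.IsHermitian) (t : ℝ) {δ : ℝ} (hδ : 0 < δ) :
    esdCDF A t ≤ esdCDF B (t + δ) + (n : ℝ)⁻¹ * (∑ i, ∑ j, (A i j - B i j) ^ 2) / δ ^ 2 := by
  classical
  obtain ⟨U, hU, hU', hUd⟩ := exists_diagonalization hA
  obtain ⟨V, hV, hV', hVd⟩ := exists_diagonalization hB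
  set a := hA.eigenvalues
  set b := hB.eigenvalues
  have hfrob : ∀ M : Matrix (Fin n) (Fin n) ℝ, ∑ i, ∑ j, M i j ^ 2 = (M * Mᵀ).trace := by
    intro M
    simp [Matrix.trace, mul_apply, pow_two]
  -- `Q` compares the two eigenbases. It is orthogonal, so its squared entries form a doubly
  -- stochastic matrix, that is, a coupling of the two spectra.
  set Q := Uᵀ * V with hQ
  have hQ1 : Q * Qᵀ = 1 := by
    rw [hQ, transpose_mul, transpose_transpose, Matrix.mul_assoc, ← Matrix.mul_assoc V, hV,
      Matrix.one_mul, hU']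
  have hQ2 : Qᵀ * Q = 1 := by
    rw [hQ, transpose_mul, transpose_transpose, Matrix.mul_assoc, ← Matrix.mul_assoc U, hU,
      Matrix.one_mul, hV']
  have hrow : ∀ k, ∑ l, Q k l ^ 2 = 1 := by
    intro k
    have := congrFun (congrFun hQ1 k) k
    simpa [mul_apply, pow_two] using this
  have hcol : ∀ l, ∑ k, Q k l ^ 2 = 1 := by
    intro l
    have := congrFun (congrFun hQ2 l) l
    simpa [mul_apply, pow_two] using this
  -- The entries of this matrix are (a_k - b_l) Q_kl, and its Frobenius norm is that of `A - B`: the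
  -- squared distance is the transport cost of the coupling.
  have hN : Uᵀ * (A - B) * V = diagonal a * Q - Q * diagonal b := by
    rw [Matrix.mul_sub, Matrix.sub_mul]
    congr 1
    · calc Uᵀ * A * V = (Uᵀ * U) * diagonal a * (Uᵀ * V) := by
            conv_lhs => rw [hUd]
            simp only [Matrix.mul_assoc]
        _ = _ := by rw [hU', Matrix.one_mul]
    · calc Uᵀ * B * V = (Uᵀ * V) * diagonal b * (Vᵀ * V) := by
            conv_lhs => rw [hVd]
            simp only [Matrix.mul_assoc]
        _ = _ := by rw [hV', Matrix.mul_one]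
  have hsum : ∑ k, ∑ l, ((a k - b l) ^ 2 * Q k l ^ 2) = ∑ i, ∑ j, (A i j - B i j) ^ 2 := by
    have h1 : ∑ i, ∑ j, (A i j - B i j) ^ 2 = ((A - B) * (A - B)ᵀ).trace := hfrob (A - B)
    have h2 : ((A - B) * (A - B)ᵀ).trace =
        ((Uᵀ * (A - B) * V) * (Uᵀ * (A - B) * V)ᵀ).trace := by
      rw [transpose_mul, transpose_mul, transpose_transpose]
      calc ((A - B) * (A - B)ᵀ).trace = ((A - B) * (A - B)ᵀ * (U * Uᵀ)).trace := by
            rw [hU, Matrix.mul_one]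
        _ = (Uᵀ * ((A - B) * (A - B)ᵀ * U)).trace := by
            rw [← Matrix.mul_assoc, trace_mul_comm]
        _ = (Uᵀ * ((A - B) * (V * Vᵀ) * (A - B)ᵀ * U)).trace := by rw [hV, Matrix.mul_one]
        _ = _ := by simp only [Matrix.mul_assoc]
    rw [h1, h2, ← hfrob, hN]
    refine Finset.sum_congr rfl fun k _ => Finset.sum_congr rfl fun l _ => ?_
    rw [Matrix.sub_apply, diagonal_mul, mul_diagonal]
    ring
  rw [esdCDF_eq hA, esdCDF_eq hB, mul_div_assoc, ← mul_add]
  refine mul_le_mul_of_nonneg_left ?_ (by positivity)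
  calc ∑ k, (if a k ≤ t then (1 : ℝ) else 0)
      = ∑ k, ∑ l, (if a k ≤ t then (1 : ℝ) else 0) * Q k l ^ 2 := by
        refine Finset.sum_congr rfl fun k _ => ?_
        rw [← Finset.mul_sum, hrow, mul_one]
    -- If a_k ≤ t but b_l > t + δ, then (a_k - b_l)² / δ² exceeds 1.
    _ ≤ ∑ k, ∑ l, ((if b l ≤ t + δ then (1 : ℝ) else 0) * Q k l ^ 2 +
          (a k - b l) ^ 2 * Q k l ^ 2 / δ ^ 2) := by
        refine Finset.sum_le_sum fun k _ => Finset.sum_le_sum fun l _ => ?_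
        rw [mul_div_right_comm, ← add_mul]
        refine mul_le_mul_of_nonneg_right ?_ (sq_nonneg _)
        have h0 : 0 ≤ (a k - b l) ^ 2 / δ ^ 2 := by positivity
        split_ifs with h1 h2 h2
        · linarith
        · rw [zero_add, le_div_iff₀ (by positivity), one_mul]
          push Not at h2
          nlinarith
        · linarith
        · linarith
    _ = _ := by
        simp_rw [Finset.sum_add_distrib]
        congr 1
        · rw [Finset.sum_comm]
          refine Finset.sum_congr rfl fun l _ => ?_
          rw [← Finset.mul_sum, hcol, mul_one]
        · rw [← hsum, Finset.sum_div]
          refine Finset.sum_congr rfl fun k _ => ?_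
          rw [Finset.sum_div]

end Spectral

/-! ### The moments of the patterned product as sums over circuits -/

section Product

variable {Ω ι κ : Type*} {LX : Link ι} {LY : Link κ}

theorem isHermitian_scaledProduct (hX : LX.IsSymm) (hY : LY.IsSymm) (x : ι → Ω → ℝ)
    (y : κ → Ω → ℝ) (n : ℕ) (ω : Ω) : (scaledProduct LX LY x y n ω).IsHermitian := by
  ext i j
  simp [scaledProduct, patterned, hX n i j, hY n i j]

open Classical in
theorem esdMoment_scaledProduct (hX : LX.IsSymm) (hY : LY.IsSymm) (x : ι → Ω → ℝ)
    (y : κ → Ω → ℝ) (h n : ℕ) (ω : Ω) :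
    esdMoment h (scaledProduct LX LY x y n ω) = (Real.sqrt n ^ (h + 2))⁻¹ *
      ∑ φ ∈ Finset.univ.filter (IsCircuit (h := h) (n := n)),
        prodVar x (LX.edgeValue φ) ω * prodVar y (LY.edgeValue φ) ω := by
  rw [esdMoment_eq (isHermitian_scaledProduct hX hY x y n ω), trace_pow_eq_sum_circuits]
  -- The power of `Real.sqrt n` comprises h factors from the scaling of the matrix and two from the
  -- mass 1/n of an eigenvalue.
  rw [pow_add, mul_inv, Real.sq_sqrt (Nat.cast_nonneg n), mul_comm _ (n : ℝ)⁻¹, mul_assoc]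
  congr 1
  rw [Finset.mul_sum]
  refine Finset.sum_congr rfl fun φ _ => ?_
  simp only [scaledProduct, patterned, Matrix.smul_apply, Matrix.hadamard_apply, Matrix.of_apply,
    smul_eq_mul, Finset.prod_mul_distrib, Finset.prod_const, Finset.card_univ, Fintype.card_fin,
    prodVar, Link.edgeValue, inv_pow]

end Product

end SchurHadamard

namespace SchurHadamard

/-! ### Limits of the expected spectral moments. -/

section Moments

variable {Ω ι κ : Type*} [MeasurableSpace Ω] {P : Measure Ω} [IsProbabilityMeasure P]
  {LX : Link ι} {LY : Link κ} {x : ι → Ω → ℝ} {y : κ → Ω → ℝ}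

theorem pairMatched_even {h : ℕ} {Λ : Type*} {v : Fin h → Λ} (hv : PairMatched v) : Even h := by
  classical
  have h1 := Finset.card_eq_sum_card_image v Finset.univ
  rw [Finset.card_univ, Fintype.card_fin] at h1
  rw [h1, Finset.sum_congr rfl fun l hl => ?_, Finset.sum_const, smul_eq_mul]
  · exact even_two.mul_left _
  · obtain ⟨i, -, rfl⟩ := Finset.mem_image.1 hl
    rw [← hv i, ← Set.ncard_coe_finset]
    simp

theorem tendsto_pairCount_div_sqrt {p : (h : ℕ) → Word h → Word h → ℝ}
    (hp : IsWordLimit LX LY p) (h : ℕ) :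
    Tendsto (fun n : ℕ => (Real.sqrt n ^ (h + 2))⁻¹ * (pairCount LX LY h n : ℝ)) atTop
      (𝓝 (limitMoment p h)) := by
  rcases Nat.even_or_odd h with he | ho
  · obtain ⟨k, rfl⟩ := he.two_dvd
    refine (tendsto_pairCount hp k).congr fun n => ?_
    rw [show 2 * k + 2 = 2 * (1 + k) by ring, pow_mul, Real.sq_sqrt (Nat.cast_nonneg n),
      div_eq_inv_mul]
  · have h0 : ∀ n, pairCount LX LY h n = 0 := by
      intro n
      classical
      rw [pairCount, Finset.card_eq_zero, Finset.filter_eq_empty_iff]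
      intro φ _ hφ
      exact Nat.not_even_iff_odd.2 ho (pairMatched_even hφ.2.1)
    simp [h0, limitMoment, ho]

theorem measurable_prod_eval {h : ℕ} (v : Fin h → ι) :
    Measurable fun z : ι → ℝ => ∏ i, z (v i) := by
  fun_prop

theorem integral_prodVar_mul {P : Measure Ω} (hx : ∀ i, Measurable (x i)) (hy : ∀ j, Measurable (y j))
    (hxy : IndepFun (fun ω i => x i ω) (fun ω j => y j ω) P) {h h' : ℕ} (v : Fin h → ι)
    (u : Fin h' → κ) : ∫ ω, prodVar x v ω * prodVar y u ω ∂P =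
      (∫ ω, prodVar x v ω ∂P) * ∫ ω, prodVar y u ω ∂P :=
  integral_mul_of_indepFun hx hy hxy (measurable_prod_eval v) (measurable_prod_eval u)

theorem InputA3.uniformMoments_prodVar (hx : InputA3 P x) (h : ℕ) :
    UniformMoments P fun v : Fin h → ι => prodVar x v :=
  hx.uniformMoments.prod h

-- A circuit contributes to the difference only if it is matched for both links and fails to be
-- pair-matched for one of them. There are O(n^{(h+1)/2}) such circuits, one factor √n below the
-- normalisation.
open Classical in
theorem exists_abs_sum_sub_pairCount_le (hXB : LX.PropertyB) (hYB : LY.PropertyB)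
    (hx : InputA3 P x) (hy : InputA3 P y) (h : ℕ) : ∃ K : ℝ, 0 ≤ K ∧ ∀ n : ℕ,
      |∑ φ ∈ Finset.univ.filter (IsCircuit (h := h) (n := n)),
        (∫ ω, prodVar x (LX.edgeValue φ) ω ∂P) * (∫ ω, prodVar y (LY.edgeValue φ) ω ∂P) -
        pairCount LX LY h n| ≤ K * Real.sqrt n ^ (h + 1) := by
  obtain ⟨Kx, hKx0, hKx⟩ := (hx.uniformMoments_prodVar h).exists_abs_integral_le
  obtain ⟨Ky, hKy0, hKy⟩ := (hy.uniformMoments_prodVar h).exists_abs_integral_le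
  obtain ⟨Nx, hNx⟩ := exists_card_matched_le (rowBound_toNat_Delta hXB) (one_le_toNat_Delta hXB) h
  obtain ⟨Ny, hNy⟩ := exists_card_matched_le (rowBound_toNat_Delta hYB) (one_le_toNat_Delta hYB) h
  refine ⟨(Kx * Ky) * (Real.sqrt Nx + Real.sqrt Ny), by positivity, fun n => ?_⟩
  set bad_x := Finset.univ.filter fun φ : Fin (h + 1) → Fin n =>
        Matched (LX.edgeValue φ) ∧ ¬ PairMatched (LX.edgeValue φ) with hbx
  set bad_y := Finset.univ.filter fun φ : Fin (h + 1) → Fin n =>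
        Matched (LY.edgeValue φ) ∧ ¬ PairMatched (LY.edgeValue φ) with hby
  have hroot : ∀ N c : ℕ, c ^ 2 ≤ N * n ^ (h + 1) →
      (c : ℝ) ≤ Real.sqrt N * Real.sqrt n ^ (h + 1) := by
    intro N c hc
    refine (pow_le_pow_iff_left₀ (by positivity) (by positivity) two_ne_zero).1 ?_
    rw [mul_pow, ← pow_mul, mul_comm (h + 1) 2, pow_mul, Real.sq_sqrt (Nat.cast_nonneg _),
      Real.sq_sqrt (Nat.cast_nonneg _)]
    exact_mod_cast hc
  have hcx := hroot _ _ (hNx n)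
  have hcy := hroot _ _ (hNy n)
  have hcount : (pairCount LX LY h n : ℝ) =
      ∑ φ ∈ Finset.univ.filter (IsCircuit (h := h) (n := n)),
        if PairMatched (LX.edgeValue φ) ∧ PairMatched (LY.edgeValue φ) then (1 : ℝ) else 0 := by
    rw [Finset.sum_boole, Finset.filter_filter, pairCount]
  rw [hcount, ← Finset.sum_sub_distrib]
  calc |∑ φ ∈ Finset.univ.filter (IsCircuit (h := h) (n := n)),
        ((∫ ω, prodVar x (LX.edgeValue φ) ω ∂P) * (∫ ω, prodVar y (LY.edgeValue φ) ω ∂P) -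
        if PairMatched (LX.edgeValue φ) ∧ PairMatched (LY.edgeValue φ) then (1 : ℝ) else 0)|
      ≤ ∑ φ ∈ Finset.univ.filter (IsCircuit (h := h) (n := n)),
        |(∫ ω, prodVar x (LX.edgeValue φ) ω ∂P) * (∫ ω, prodVar y (LY.edgeValue φ) ω ∂P) -
        if PairMatched (LX.edgeValue φ) ∧ PairMatched (LY.edgeValue φ) then (1 : ℝ) else 0| :=
        Finset.abs_sum_le_sum_abs _ _
    _ ≤ ∑ φ ∈ Finset.univ.filter (IsCircuit (h := h) (n := n)),
        (Kx * Ky) * ((if φ ∈ bad_x then 1 else 0) + if φ ∈ bad_y then 1 else 0) := by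
        refine Finset.sum_le_sum fun φ _ => ?_
        have hrhs : 0 ≤ (Kx * Ky) * (((if φ ∈ bad_x then 1 else 0) : ℝ) +
            if φ ∈ bad_y then 1 else 0) := by
          refine mul_nonneg (by positivity) (add_nonneg ?_ ?_) <;> split_ifs <;> norm_num
        by_cases hpp : PairMatched (LX.edgeValue φ) ∧ PairMatched (LY.edgeValue φ)
        · rw [if_pos hpp, integral_prodVar_eq_one hx.1 hpp.1, integral_prodVar_eq_one hy.1 hpp.2]
          simpa using hrhs
        rw [if_neg hpp, sub_zero, abs_mul]
        by_cases hmx : Matched (LX.edgeValue φ)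
        · by_cases hmy : Matched (LY.edgeValue φ)
          · have hle : |∫ ω, prodVar x (LX.edgeValue φ) ω ∂P| *
                |∫ ω, prodVar y (LY.edgeValue φ) ω ∂P| ≤ Kx * Ky :=
              mul_le_mul (hKx _) (hKy _) (abs_nonneg _) hKx0
            have hone : (1 : ℝ) ≤ (if φ ∈ bad_x then 1 else 0) + if φ ∈ bad_y then 1 else 0 := by
              by_cases hpx : PairMatched (LX.edgeValue φ)
              · have : φ ∈ bad_y := Finset.mem_filter.2
                  ⟨Finset.mem_univ _, hmy, fun hpy => hpp ⟨hpx, hpy⟩⟩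
                rw [if_pos this]
                split_ifs <;> norm_num
              · have : φ ∈ bad_x := Finset.mem_filter.2 ⟨Finset.mem_univ _, hmx, hpx⟩
                rw [if_pos this]
                split_ifs <;> norm_num
            calc _ ≤ Kx * Ky * 1 := by rw [mul_one]; exact hle
              _ ≤ _ := mul_le_mul_of_nonneg_left hone (by positivity)
          · rw [integral_prodVar_eq_zero hy.1 hmy]
            simpa using hrhs
        · rw [integral_prodVar_eq_zero hx.1 hmx]
          simpa using hrhs
    _ ≤ ∑ φ : Fin (h + 1) → Fin n,
        (Kx * Ky) * (((if φ ∈ bad_x then 1 else 0) : ℝ) + if φ ∈ bad_y then 1 else 0) := by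
        refine Finset.sum_le_sum_of_subset_of_nonneg (Finset.filter_subset _ _) fun φ _ _ => ?_
        refine mul_nonneg (by positivity) (add_nonneg ?_ ?_) <;> split_ifs <;> norm_num
    _ = (Kx * Ky) * ((bad_x.card : ℝ) + bad_y.card) := by
        rw [← Finset.mul_sum, Finset.sum_add_distrib, Finset.sum_boole, Finset.sum_boole,
          Finset.filter_mem_eq_inter, Finset.filter_mem_eq_inter, Finset.univ_inter,
          Finset.univ_inter]
    _ ≤ (Kx * Ky) * (Real.sqrt Nx * Real.sqrt n ^ (h + 1) +
          Real.sqrt Ny * Real.sqrt n ^ (h + 1)) := by gcongr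
    _ = _ := by ring

theorem integrable_prodVar_mul (hx : InputA3 P x) (hy : InputA3 P y) {h h' : ℕ} (v : Fin h → ι)
    (u : Fin h' → κ) : Integrable (fun ω => prodVar x v ω * prodVar y u ω) P :=
  (((hx.uniformMoments_prodVar h).comp fun _ : Unit => v).mul
    ((hy.uniformMoments_prodVar h').comp fun _ : Unit => u)).integrable ()

open Classical in
theorem integral_esdMoment (hX : LX.IsSymm) (hY : LY.IsSymm) (hx : InputA3 P x)
    (hy : InputA3 P y) (hxy : IndepFun (fun ω i => x i ω) (fun ω j => y j ω) P) (h n : ℕ) :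
    ∫ ω, esdMoment h (scaledProduct LX LY x y n ω) ∂P = (Real.sqrt n ^ (h + 2))⁻¹ *
      ∑ φ ∈ Finset.univ.filter (IsCircuit (h := h) (n := n)),
        (∫ ω, prodVar x (LX.edgeValue φ) ω ∂P) * ∫ ω, prodVar y (LY.edgeValue φ) ω ∂P := by
  simp_rw [esdMoment_scaledProduct hX hY]
  rw [integral_const_mul, integral_finsetSum _ fun φ _ => integrable_prodVar_mul hx hy _ _]
  congr 1
  exact Finset.sum_congr rfl fun φ _ =>
    integral_prodVar_mul hx.1.measurable hy.1.measurable hxy _ _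

theorem uniformMoments_esdMoment (hX : LX.IsSymm) (hY : LY.IsSymm) (hx : InputA3 P x)
    (hy : InputA3 P y) (h n : ℕ) :
    UniformMoments P fun (_ : Unit) ω => esdMoment h (scaledProduct LX LY x y n ω) := by
  classical
  simp_rw [esdMoment_scaledProduct hX hY]
  refine (UniformMoments.const (c := fun _ => _) fun _ => le_rfl).mul ?_
  induction Finset.univ.filter (IsCircuit (h := h) (n := n)) using Finset.induction_on with
  | empty =>
    simpa using UniformMoments.const (P := P) (A := Unit) (c := fun _ => 0) (K := 0) (by simp)
  | insert φ s hφ ih =>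
    simp_rw [Finset.sum_insert hφ]
    exact (((hx.uniformMoments_prodVar h).comp fun _ : Unit => LX.edgeValue φ).mul
      ((hy.uniformMoments_prodVar h).comp fun _ : Unit => LY.edgeValue φ)).add ih

theorem expectedMomentsTendsto (hX : LX.IsSymm) (hY : LY.IsSymm) (hXB : LX.PropertyB)
    (hYB : LY.PropertyB) {p : (h : ℕ) → Word h → Word h → ℝ} (hp : IsWordLimit LX LY p)
    (hx : InputA3 P x) (hy : InputA3 P y)
    (hxy : IndepFun (fun ω i => x i ω) (fun ω j => y j ω) P) :
    ExpectedMomentsTendsto P (scaledProduct LX LY x y) (limitMoment p) := by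
  classical
  intro h
  refine ⟨fun n => (uniformMoments_esdMoment hX hY hx hy h n).integrable (), ?_⟩
  obtain ⟨K, hK0, hK⟩ := exists_abs_sum_sub_pairCount_le hXB hYB hx hy h
  have hlim : Tendsto (fun n : ℕ => ∫ ω, esdMoment h (scaledProduct LX LY x y n ω) ∂P -
      (Real.sqrt n ^ (h + 2))⁻¹ * (pairCount LX LY h n : ℝ)) atTop (𝓝 0) := by
    have hz : Tendsto (fun n : ℕ => K * (Real.sqrt n)⁻¹) atTop (𝓝 0) := by
      have h1 : Tendsto (fun n : ℕ => (Real.sqrt n)⁻¹) atTop (𝓝 0) :=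
        (Real.tendsto_sqrt_atTop.comp tendsto_natCast_atTop_atTop).inv_tendsto_atTop
      simpa using h1.const_mul K
    refine squeeze_zero_norm' ?_ hz
    filter_upwards [eventually_gt_atTop 0] with n hn
    have hs : 0 < Real.sqrt n := Real.sqrt_pos.2 (by exact_mod_cast hn)
    rw [integral_esdMoment hX hY hx hy hxy, ← mul_sub, Real.norm_eq_abs, abs_mul,
      abs_of_pos (by positivity)]
    calc _ ≤ (Real.sqrt n ^ (h + 2))⁻¹ * (K * Real.sqrt n ^ (h + 1)) := by
          gcongr; exact hK n
      _ = _ := by rw [pow_succ' _ (h + 1)]; field_simp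
  simpa using hlim.add (tendsto_pairCount_div_sqrt hp h)

/-! ### Fourth central moments and almost sure convergence of the spectral moments. -/

open Classical in
theorem integral_sum_pow_four_le {P : Measure Ω} {T : Type*} (C : Finset T) (f : T → Ω → ℝ)
    (good : (Fin 4 → T) → Prop) {K : ℝ} (hint : ∀ V : Fin 4 → T, Integrable (fun ω => ∏ j, f (V j) ω) P)
    (hbad : ∀ V, ¬ good V → ∫ ω, ∏ j, f (V j) ω ∂P = 0)
    (hK : ∀ V : Fin 4 → T, |∫ ω, ∏ j, f (V j) ω ∂P| ≤ K) :
    Integrable (fun ω => (∑ φ ∈ C, f φ ω) ^ 4) P ∧ ∫ ω, (∑ φ ∈ C, f φ ω) ^ 4 ∂P ≤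
      K * ((Fintype.piFinset fun _ : Fin 4 => C).filter good).card := by
  have hexp : ∀ ω, (∑ φ ∈ C, f φ ω) ^ 4 =
      ∑ V ∈ Fintype.piFinset fun _ : Fin 4 => C, ∏ j, f (V j) ω := by
    intro ω
    rw [← Finset.prod_univ_sum (fun _ : Fin 4 => C) fun _ φ => f φ ω]
    simp
  simp_rw [hexp]
  refine ⟨integrable_finsetSum _ fun V _ => hint V, ?_⟩
  rw [integral_finsetSum _ fun V _ => hint V, ← Finset.sum_filter_add_sum_filter_not _ good,
    Finset.sum_eq_zero (s := Finset.filter (fun V => ¬ good V) _)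
      fun V hV => hbad V (Finset.mem_filter.1 hV).2, add_zero, mul_comm, ← nsmul_eq_mul]
  exact Finset.sum_le_card_nsmul _ _ _ fun V _ => (le_abs_self _).trans (hK V)

/-- Each summand XY - EX EY is split as (X - EX)Y + EX(Y - EY). By independence of the families, the
fourth moment of the first part involves only quadruples cross-matched for the X-link, that of the
second only those cross-matched for the Y-link. The count n^{2h+2} against the normalisation
n^{2h+4} leaves n^{-2}. -/
theorem exists_fourth_moment_le (hX : LX.IsSymm) (hY : LY.IsSymm) (hXB : LX.PropertyB)
    (hYB : LY.PropertyB) (hx : InputA3 P x) (hy : InputA3 P y)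
    (hxy : IndepFun (fun ω i => x i ω) (fun ω j => y j ω) P) (h : ℕ) : ∃ K : ℝ, ∀ n : ℕ, 0 < n →
      ∫ ω, (esdMoment h (scaledProduct LX LY x y n ω) -
        ∫ ω', esdMoment h (scaledProduct LX LY x y n ω') ∂P) ^ 4 ∂P ≤ K * ((n : ℝ) ^ 2)⁻¹ := by
  classical
  have ux := hx.uniformMoments_prodVar h
  have uy := hy.uniformMoments_prodVar h
  obtain ⟨Kx, hKx0, hKx⟩ := ux.exists_abs_integral_le
  obtain ⟨Kx4, hKx40, hKx4⟩ := (ux.sub_integral.prod 4).exists_abs_integral_le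
  obtain ⟨Ky4, hKy40, hKy4⟩ := (uy.sub_integral.prod 4).exists_abs_integral_le
  obtain ⟨Ly4, hLy40, hLy4⟩ := (uy.prod 4).exists_abs_integral_le
  obtain ⟨Nx, hNx⟩ :=
    exists_card_crossMatched_le (rowBound_toNat_Delta hXB) (one_le_toNat_Delta hXB) h
  obtain ⟨Ny, hNy⟩ :=
    exists_card_crossMatched_le (rowBound_toNat_Delta hYB) (one_le_toNat_Delta hYB) h
  refine ⟨8 * (Kx4 * Ly4 * Nx + Kx ^ 4 * Ky4 * Ny), fun n hn => ?_⟩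
  set C := Finset.univ.filter (IsCircuit (h := h) (n := n)) with hC
  let eX : (Fin (h + 1) → Fin n) → ℝ := fun φ => ∫ ω, prodVar x (LX.edgeValue φ) ω ∂P
  let eY : (Fin (h + 1) → Fin n) → ℝ := fun φ => ∫ ω, prodVar y (LY.edgeValue φ) ω ∂P
  let f₁ : (Fin (h + 1) → Fin n) → Ω → ℝ := fun φ ω =>
    (prodVar x (LX.edgeValue φ) ω - eX φ) * prodVar y (LY.edgeValue φ) ω
  let f₂ : (Fin (h + 1) → Fin n) → Ω → ℝ := fun φ ω =>
    eX φ * (prodVar y (LY.edgeValue φ) ω - eY φ)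
  have hcard : ∀ (N : ℕ) (good : (Fin 4 → Fin (h + 1) → Fin n) → Prop),
      (Finset.univ.filter fun φ : Fin 4 → Fin (h + 1) → Fin n => (∀ j, IsCircuit (φ j)) ∧
        good φ).card ≤ N * n ^ (2 * h + 2) →
      (((Fintype.piFinset fun _ : Fin 4 => C).filter good).card : ℝ) ≤
        N * (n : ℝ) ^ (2 * h + 2) := by
    intro N good hle
    have : ((Fintype.piFinset fun _ : Fin 4 => C).filter good).card ≤ N * n ^ (2 * h + 2) := by
      refine le_trans (Finset.card_le_card ?_) hle
      intro V hV
      obtain ⟨hV, hg⟩ := Finset.mem_filter.1 hV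
      rw [Fintype.mem_piFinset] at hV
      exact Finset.mem_filter.2
        ⟨Finset.mem_univ _, fun j => (Finset.mem_filter.1 (hV j)).2, hg⟩
    exact_mod_cast this
  have hprod₁ : ∀ V : Fin 4 → Fin (h + 1) → Fin n, ∫ ω, ∏ j, f₁ (V j) ω ∂P =
      (∫ ω, ∏ j, (prodVar x (LX.edgeValue (V j)) ω - eX (V j)) ∂P) *
        ∫ ω, ∏ j, prodVar y (LY.edgeValue (V j)) ω ∂P := by
    intro V
    simp only [f₁, Finset.prod_mul_distrib]
    exact integral_mul_of_indepFun hx.1.measurable hy.1.measurable hxy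
      (F := fun z => ∏ j, ((∏ i, z (LX.edgeValue (V j) i)) - eX (V j)))
      (G := fun z => ∏ j, ∏ i, z (LY.edgeValue (V j) i)) (by fun_prop) (by fun_prop)
  have hprod₂ : ∀ V : Fin 4 → Fin (h + 1) → Fin n, ∫ ω, ∏ j, f₂ (V j) ω ∂P =
      (∏ j, eX (V j)) * ∫ ω, ∏ j, (prodVar y (LY.edgeValue (V j)) ω - eY (V j)) ∂P := by
    intro V
    simp only [f₂, Finset.prod_mul_distrib]
    rw [integral_const_mul]
  obtain ⟨hi₁, hb₁⟩ := integral_sum_pow_four_le (P := P) C f₁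
    (fun V => JointlyMatched (fun j => LX.edgeValue (V j)) ∧
      CrossMatched (fun j => LX.edgeValue (V j))) (K := Kx4 * Ly4)
    (fun V => by
      simp only [f₁, Finset.prod_mul_distrib]
      exact (((ux.sub_integral.prod 4).comp fun _ : Unit => fun j => LX.edgeValue (V j)).mul
        ((uy.prod 4).comp fun _ : Unit => fun j => LY.edgeValue (V j))).integrable ())
    (fun V hV => by
      rw [hprod₁, integral_prod_centered_eq_zero hx.1 hV fun j => ux.integrable _, zero_mul])
    (fun V => by
      rw [hprod₁, abs_mul]
      exact mul_le_mul (hKx4 fun j => LX.edgeValue (V j)) (hLy4 fun j => LY.edgeValue (V j))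
        (abs_nonneg _) hKx40)
  obtain ⟨hi₂, hb₂⟩ := integral_sum_pow_four_le (P := P) C f₂
    (fun V => JointlyMatched (fun j => LY.edgeValue (V j)) ∧
      CrossMatched (fun j => LY.edgeValue (V j))) (K := Kx ^ 4 * Ky4)
    (fun V => by
      simp only [f₂, Finset.prod_mul_distrib]
      exact ((uy.sub_integral.prod 4).integrable fun j => LY.edgeValue (V j)).const_mul _)
    (fun V hV => by
      rw [hprod₂, integral_prod_centered_eq_zero hy.1 hV fun j => uy.integrable _, mul_zero])
    (fun V => by
      rw [hprod₂, abs_mul]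
      refine mul_le_mul ?_ (hKy4 fun j => LY.edgeValue (V j)) (abs_nonneg _) (by positivity)
      rw [Finset.abs_prod]
      calc ∏ j : Fin 4, |eX (V j)| ≤ ∏ _j : Fin 4, Kx :=
            Finset.prod_le_prod (fun _ _ => abs_nonneg _) fun j _ => hKx _
        _ = Kx ^ 4 := by simp)
  have hdecomp : ∀ ω, esdMoment h (scaledProduct LX LY x y n ω) -
      ∫ ω', esdMoment h (scaledProduct LX LY x y n ω') ∂P =
      (Real.sqrt n ^ (h + 2))⁻¹ * (∑ φ ∈ C, f₁ φ ω + ∑ φ ∈ C, f₂ φ ω) := by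
    intro ω
    rw [integral_esdMoment hX hY hx hy hxy, esdMoment_scaledProduct hX hY, ← mul_sub,
      ← Finset.sum_sub_distrib, ← Finset.sum_add_distrib]
    congr 1
    refine Finset.sum_congr rfl fun φ _ => ?_
    simp only [f₁, f₂, eX, eY]
    ring
  have hn' : (0 : ℝ) < n := by exact_mod_cast hn
  have hscale : ((Real.sqrt n ^ (h + 2))⁻¹) ^ 4 = ((n : ℝ) ^ (2 * h + 4))⁻¹ := by
    rw [inv_pow, ← pow_mul, show (h + 2) * 4 = 2 * (2 * h + 4) by ring, pow_mul,
      Real.sq_sqrt hn'.le]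
  simp_rw [hdecomp, mul_pow, hscale]
  rw [integral_const_mul]
  have hsum : ∫ ω, (∑ φ ∈ C, f₁ φ ω + ∑ φ ∈ C, f₂ φ ω) ^ 4 ∂P ≤
      8 * (Kx4 * Ly4 * Nx + Kx ^ 4 * Ky4 * Ny) * (n : ℝ) ^ (2 * h + 2) := by
    calc ∫ ω, (∑ φ ∈ C, f₁ φ ω + ∑ φ ∈ C, f₂ φ ω) ^ 4 ∂P
        ≤ ∫ ω, 8 * ((∑ φ ∈ C, f₁ φ ω) ^ 4 + (∑ φ ∈ C, f₂ φ ω) ^ 4) ∂P := by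
          refine integral_mono_of_nonneg (ae_of_all _ fun ω => by positivity)
            ((hi₁.add hi₂).const_mul 8) (ae_of_all _ fun ω => ?_)
          simp only
          generalize (∑ φ ∈ C, f₁ φ ω) = a
          generalize (∑ φ ∈ C, f₂ φ ω) = b
          have h2 : (a + b) ^ 2 ≤ 2 * (a ^ 2 + b ^ 2) := by nlinarith [sq_nonneg (a - b)]
          calc (a + b) ^ 4 = ((a + b) ^ 2) ^ 2 := by ring
            _ ≤ (2 * (a ^ 2 + b ^ 2)) ^ 2 := pow_le_pow_left₀ (sq_nonneg _) h2 2
            _ ≤ 8 * (a ^ 4 + b ^ 4) := by nlinarith [sq_nonneg (a ^ 2 - b ^ 2)]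
      _ = 8 * (∫ ω, (∑ φ ∈ C, f₁ φ ω) ^ 4 ∂P + ∫ ω, (∑ φ ∈ C, f₂ φ ω) ^ 4 ∂P) := by
          rw [integral_const_mul, integral_add hi₁ hi₂]
      _ ≤ 8 * (Kx4 * Ly4 * (Nx * (n : ℝ) ^ (2 * h + 2)) +
            Kx ^ 4 * Ky4 * (Ny * (n : ℝ) ^ (2 * h + 2))) := by
          gcongr
          · exact hb₁.trans (mul_le_mul_of_nonneg_left (hcard Nx _ (by convert hNx n)) (by positivity))
          · exact hb₂.trans (mul_le_mul_of_nonneg_left (hcard Ny _ (by convert hNy n)) (by positivity))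
      _ = _ := by ring
  calc _ ≤ ((n : ℝ) ^ (2 * h + 4))⁻¹ *
        (8 * (Kx4 * Ly4 * Nx + Kx ^ 4 * Ky4 * Ny) * (n : ℝ) ^ (2 * h + 2)) := by gcongr
    _ = _ := by
      rw [show 2 * h + 4 = (2 * h + 2) + 2 by ring, pow_add _ (2 * h + 2) 2]
      field_simp

theorem fourthMomentSummable (hX : LX.IsSymm) (hY : LY.IsSymm) (hXB : LX.PropertyB)
    (hYB : LY.PropertyB) (hx : InputA3 P x) (hy : InputA3 P y)
    (hxy : IndepFun (fun ω i => x i ω) (fun ω j => y j ω) P) :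
    FourthMomentSummable P (scaledProduct LX LY x y) := by
  intro h
  refine ⟨fun n => by
    simpa using (uniformMoments_esdMoment hX hY hx hy h n).memLp () (m := 4) (by norm_num), ?_⟩
  obtain ⟨K, hK⟩ := exists_fourth_moment_le hX hY hXB hYB hx hy hxy h
  have hs : Summable fun n : ℕ => K * ((n : ℝ) ^ 2)⁻¹ :=
    (Real.summable_nat_pow_inv.2 one_lt_two).mul_left K
  rw [← summable_nat_add_iff 1]
  refine Summable.of_nonneg_of_le (fun n => integral_nonneg fun ω => by positivity)
    (fun n => hK (n + 1) n.succ_pos) ((summable_nat_add_iff 1).2 hs)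

/-- Almost surely all moments converge. -/
theorem ae_tendsto_esdMoment {A : (n : ℕ) → Ω → Matrix (Fin n) (Fin n) ℝ} {β : ℕ → ℝ}
    (hE : ExpectedMomentsTendsto P A β) (hF : FourthMomentSummable P A) :
    ∀ᵐ ω ∂P, ∀ h : ℕ, Tendsto (fun n => esdMoment h (A n ω)) atTop (𝓝 (β h)) := by
  rw [ae_all_iff]
  intro h
  obtain ⟨hLp, hsum⟩ := hF h
  set m : ℕ → ℝ := fun n => ∫ ω', esdMoment h (A n ω') ∂P
  have hint : ∀ n, Integrable (fun ω => (esdMoment h (A n ω) - m n) ^ 4) P := by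
    intro n
    have h1 : MemLp (fun ω => esdMoment h (A n ω) - m n) 4 P := (hLp n).sub (memLp_const _)
    have h2 := h1.integrable_norm_pow (by norm_num : (4 : ℕ) ≠ 0)
    refine h2.congr (ae_of_all _ fun ω => ?_)
    simp only [Real.norm_eq_abs]
    exact Even.pow_abs (by decide) _
  -- By monotone convergence the sum of the fourth powers has finite expectation, so it is almost
  -- surely finite and its terms tend to 0.
  have hae : ∀ᵐ ω ∂P, Summable fun n => (esdMoment h (A n ω) - m n) ^ 4 := by
    have hlt : ∫⁻ ω, ∑' n, ENNReal.ofReal ((esdMoment h (A n ω) - m n) ^ 4) ∂P ≠ ⊤ := by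
      rw [lintegral_tsum fun n => (hint n).aestronglyMeasurable.aemeasurable.ennreal_ofReal]
      have : ∀ n, ∫⁻ ω, ENNReal.ofReal ((esdMoment h (A n ω) - m n) ^ 4) ∂P =
          ENNReal.ofReal (∫ ω, (esdMoment h (A n ω) - m n) ^ 4 ∂P) := fun n =>
        (ofReal_integral_eq_lintegral_ofReal (hint n) (ae_of_all _ fun ω => by positivity)).symm
      simp_rw [this]
      exact hsum.tsum_ofReal_ne_top
    have hmeas : AEMeasurable (fun ω => ∑' n, ENNReal.ofReal ((esdMoment h (A n ω) - m n) ^ 4))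
        P := AEMeasurable.tsum fun n =>
          (hint n).aestronglyMeasurable.aemeasurable.ennreal_ofReal
    filter_upwards [ae_lt_top' hmeas hlt] with ω hω
    have := ENNReal.summable_toReal hω.ne
    refine this.congr fun n => ?_
    rw [ENNReal.toReal_ofReal (by positivity)]
  filter_upwards [hae] with ω hω
  have h0 : Tendsto (fun n => (esdMoment h (A n ω) - m n) ^ 4) atTop (𝓝 0) :=
    hω.tendsto_atTop_zero
  have h1 : Tendsto (fun n => esdMoment h (A n ω) - m n) atTop (𝓝 0) := by
    rw [tendsto_zero_iff_norm_tendsto_zero]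
    have h2 := (h0.sqrt).sqrt
    rw [Real.sqrt_zero, Real.sqrt_zero] at h2
    refine h2.congr fun n => ?_
    rw [show (4 : ℕ) = 2 * 2 by norm_num, pow_mul, Real.sqrt_sq (sq_nonneg _),
      Real.sqrt_sq_eq_abs, Real.norm_eq_abs]
  simpa [m] using h1.add (hE h).2

end Moments

end SchurHadamard

namespace SchurHadamard

/-! ### The method of moments -/

section MomentMethod

/-- `β` is the moment sequence of `μ`. -/
def HasMoments (μ : Measure ℝ) (β : ℕ → ℝ) : Prop :=
  ∀ h : ℕ, Integrable (fun t : ℝ => t ^ h) μ ∧ ∫ t, t ^ h ∂μ = β h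

/-- The even terms of `β` are at most the moments of a centred Gaussian law of variance `D`. -/
def GaussianGrowth (β : ℕ → ℝ) (D : ℝ) : Prop :=
  ∀ k : ℕ, β (2 * k) ≤ ((2 * k).factorial : ℝ) / (2 ^ k * (k.factorial : ℝ)) * D ^ k

/-- Bounding the truncation error by f²/M makes it uniform along a sequence of measures under which
f² has bounded integrals. -/
theorem abs_sub_clip_le (f M : ℝ) (hM : 0 < M) : |f - max (-M) (min f M)| ≤ f ^ 2 / M := by
  have hf : 0 ≤ f ^ 2 / M := by positivity
  rcases le_total f M with h1 | h1
  · rw [min_eq_left h1]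
    rcases le_total (-M) f with h2 | h2
    · rw [max_eq_right h2, sub_self, abs_zero]
      exact hf
    · rw [max_eq_left h2, abs_of_nonpos (by linarith), le_div_iff₀ hM]
      nlinarith
  · rw [min_eq_right h1, max_eq_right (by linarith), abs_of_nonneg (by linarith),
      le_div_iff₀ hM]
    nlinarith

/-- A continuous function cut off at levels `-M` and `M`. -/
noncomputable def clip (f : C(ℝ, ℝ)) (M : ℝ) (hM : 0 < M) : BoundedContinuousFunction ℝ ℝ :=
  BoundedContinuousFunction.ofNormedAddCommGroup (fun t => max (-M) (min (f t) M))
    (by fun_prop) M fun t => by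
      rw [Real.norm_eq_abs, abs_le]
      exact ⟨le_max_left _ _, max_le (by linarith) (min_le_right _ _)⟩

theorem abs_integral_sub_clip_le {ν : Measure ℝ} [IsProbabilityMeasure ν] (f : C(ℝ, ℝ))
    (hf : Integrable f ν) (hf2 : Integrable (fun t => f t ^ 2) ν) {M : ℝ} (hM : 0 < M) :
    |∫ t, f t ∂ν - ∫ t, clip f M hM t ∂ν| ≤ (∫ t, f t ^ 2 ∂ν) / M := by
  rw [← integral_sub hf ((clip f M hM).integrable ν), ← integral_div]
  refine abs_integral_le_integral_abs.trans ?_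
  refine integral_mono_of_nonneg (ae_of_all _ fun t => abs_nonneg _) (hf2.div_const M)
    (ae_of_all _ fun t => abs_sub_clip_le (f t) M hM)

/-- A form of Fatou's lemma: weak convergence handles the truncations of `f`, and monotone
convergence removes the truncation. -/
theorem integrable_of_weak_limit {γ : Type*} {F : Filter γ} [F.NeBot]
    {ν : γ → ProbabilityMeasure ℝ} {μ : ProbabilityMeasure ℝ} (hν : Tendsto ν F (𝓝 μ))
    (f : C(ℝ, ℝ)) (hf0 : ∀ t, 0 ≤ f t) (hint : ∀ᶠ i in F, Integrable f (ν i : Measure ℝ)) {b : ℝ}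
    (hlim : Tendsto (fun i => ∫ t, f t ∂(ν i : Measure ℝ)) F (𝓝 b)) :
    Integrable f (μ : Measure ℝ) ∧ ∫ t, f t ∂(μ : Measure ℝ) ≤ b := by
  rw [ProbabilityMeasure.tendsto_iff_forall_integral_tendsto] at hν
  have hclip : ∀ M : ℕ, ∫ t, clip f (M + 1) (by positivity) t ∂(μ : Measure ℝ) ≤ b := by
    intro M
    refine le_of_tendsto_of_tendsto (hν (clip f (M + 1) (by positivity))) hlim ?_
    filter_upwards [hint] with i hi
    refine integral_mono ((clip f (M + 1) (by positivity)).integrable _) hi fun t => ?_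
    exact max_le (by have := hf0 t; linarith [(Nat.cast_nonneg M : (0 : ℝ) ≤ M)])
      (min_le_left _ _)
  have hclip0 : ∀ (M : ℕ) t, (clip f (M + 1) (by positivity)) t = min (f t) (M + 1) := by
    intro M t
    refine max_eq_right ?_
    have := hf0 t
    have hM := (Nat.cast_nonneg M : (0 : ℝ) ≤ M)
    exact le_min (by linarith) (by linarith)
  have hb : 0 ≤ b := le_trans (integral_nonneg fun t => by
    rw [hclip0]; exact le_min (hf0 t) (by positivity)) (hclip 0)
  have hlint : ∫⁻ t, ENNReal.ofReal (f t) ∂(μ : Measure ℝ) ≤ ENNReal.ofReal b := by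
    have hmono : Tendsto (fun M : ℕ => ∫⁻ t, ENNReal.ofReal (min (f t) (M + 1)) ∂(μ : Measure ℝ))
        atTop (𝓝 (∫⁻ t, ENNReal.ofReal (f t) ∂(μ : Measure ℝ))) := by
      refine lintegral_tendsto_of_tendsto_of_monotone (fun M => ?_) (ae_of_all _ fun t => ?_)
        (ae_of_all _ fun t => ?_)
      · have hm : Measurable f := f.continuous.measurable
        fun_prop
      · intro a c hac
        apply ENNReal.ofReal_le_ofReal
        apply min_le_min_left
        have : (a : ℝ) ≤ c := by exact_mod_cast hac
        linarith
      · refine tendsto_const_nhds.congr' ?_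
        filter_upwards [eventually_ge_atTop ⌈f t⌉₊] with M hM
        rw [min_eq_left]
        have : f t ≤ (M : ℝ) := (Nat.le_ceil _).trans (by exact_mod_cast hM)
        linarith
    refine le_of_tendsto' hmono fun M => ?_
    simp_rw [← hclip0]
    rw [← ofReal_integral_eq_lintegral_ofReal ((clip f (M + 1) (by positivity)).integrable _)]
    · exact ENNReal.ofReal_le_ofReal (hclip M)
    · exact ae_of_all _ fun t => by
        rw [hclip0]
        exact le_min (hf0 t) (by positivity)
  have hfi : Integrable f (μ : Measure ℝ) := by
    refine ⟨f.continuous.aestronglyMeasurable, ?_⟩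
    rw [hasFiniteIntegral_iff_ofReal (ae_of_all _ hf0)]
    exact lt_of_le_of_lt hlint ENNReal.ofReal_lt_top
  refine ⟨hfi, ?_⟩
  rw [← ENNReal.ofReal_le_ofReal_iff hb, ofReal_integral_eq_lintegral_ofReal hfi
    (ae_of_all _ hf0)]
  exact hlint

/-- Moments pass to weak limits if all moments converge. -/
theorem hasMoments_of_weak_limit {γ : Type*} {F : Filter γ} [F.NeBot]
    {ν : γ → ProbabilityMeasure ℝ} {μ : ProbabilityMeasure ℝ} (hν : Tendsto ν F (𝓝 μ))
    {β : ℕ → ℝ} (hint : ∀ h : ℕ, ∀ᶠ i in F, Integrable (fun t : ℝ => t ^ h) (ν i : Measure ℝ))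
    (hlim : ∀ h : ℕ, Tendsto (fun i => ∫ t, t ^ h ∂(ν i : Measure ℝ)) F (𝓝 (β h))) :
    HasMoments μ β := by
  let pw : ℕ → C(ℝ, ℝ) := fun h => ⟨fun t => t ^ h, by fun_prop⟩
  -- The exponent is written `h * 2` so that `pow_mul` shows a square, which gives nonnegativity and
  -- the control of the truncation of `t ^ h`.
  have heven : ∀ h : ℕ, Integrable (fun t : ℝ => t ^ (h * 2)) (μ : Measure ℝ) ∧
      ∫ t, t ^ (h * 2) ∂(μ : Measure ℝ) ≤ β (h * 2) := fun h =>
    integrable_of_weak_limit hν (pw (h * 2)) (fun t => by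
      simp only [pw, ContinuousMap.coe_mk, pow_mul]; positivity) (hint _) (hlim _)
  intro h
  have hi : Integrable (fun t : ℝ => t ^ h) (μ : Measure ℝ) := by
    refine ((integrable_const (1 : ℝ)).add (heven h).1).mono' (by fun_prop)
      (ae_of_all _ fun t => ?_)
    rw [Real.norm_eq_abs]
    simp only [Pi.add_apply, pow_mul]
    have := sq_abs (t ^ h)
    nlinarith [sq_nonneg (|t ^ h| - 1), sq_nonneg (|t ^ h|), abs_nonneg (t ^ h)]
  refine ⟨hi, ?_⟩
  -- Truncating `t ^ h` at level `M` costs at most `β (h * 2) / M` both for `μ` and in the limit of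
  -- the approximating measures; then M → ∞.
  have hbound : ∀ M : ℝ, 0 < M → |∫ t, t ^ h ∂(μ : Measure ℝ) - β h| ≤ 2 * β (h * 2) / M := by
    intro M hM
    have h1 : |∫ t, t ^ h ∂(μ : Measure ℝ) - ∫ t, clip (pw h) M hM t ∂(μ : Measure ℝ)| ≤
        β (h * 2) / M := by
      refine (abs_integral_sub_clip_le (pw h) hi ?_ hM).trans ?_
      · simpa only [pw, ContinuousMap.coe_mk, pow_mul] using (heven h).1
      · gcongr
        simpa only [pw, ContinuousMap.coe_mk, pow_mul] using (heven h).2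
    have h2 : |β h - ∫ t, clip (pw h) M hM t ∂(μ : Measure ℝ)| ≤ β (h * 2) / M := by
      rw [ProbabilityMeasure.tendsto_iff_forall_integral_tendsto] at hν
      refine le_of_tendsto_of_tendsto ((hlim h).sub (hν (clip (pw h) M hM))).abs
        ((hlim (h * 2)).div_const M) ?_
      filter_upwards [hint h, hint (h * 2)] with i hi1 hi2
      have := abs_integral_sub_clip_le (ν := (ν i : Measure ℝ)) (pw h) hi1
        (by simpa only [pw, ContinuousMap.coe_mk, pow_mul] using hi2) hM
      simpa only [pw, ContinuousMap.coe_mk, pow_mul] using this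
    calc |∫ t, t ^ h ∂(μ : Measure ℝ) - β h|
        = |(∫ t, t ^ h ∂(μ : Measure ℝ) - ∫ t, clip (pw h) M hM t ∂(μ : Measure ℝ)) -
            (β h - ∫ t, clip (pw h) M hM t ∂(μ : Measure ℝ))| := by congr 1; ring
      _ ≤ _ := abs_sub _ _
      _ ≤ β (h * 2) / M + β (h * 2) / M := add_le_add h1 h2
      _ = _ := by ring
  have h0 : |∫ t, t ^ h ∂(μ : Measure ℝ) - β h| ≤ 0 := by
    have ht : Tendsto (fun M : ℝ => 2 * β (h * 2) / M) atTop (𝓝 0) :=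
      tendsto_const_nhds.div_atTop tendsto_id
    refine ge_of_tendsto ht ?_
    filter_upwards [eventually_gt_atTop 0] with M hM using hbound M hM
  exact sub_eq_zero.1 (abs_nonpos_iff.1 h0)

theorem isTightMeasureSet_of_second_moment {S : Set (Measure ℝ)} {K : ℝ}
    (hS : ∀ ν ∈ S, IsProbabilityMeasure ν ∧ Integrable (fun t : ℝ => t ^ 2) ν ∧
      ∫ t, t ^ 2 ∂ν ≤ K) : IsTightMeasureSet S := by
  apply isTightMeasureSet_of_tendsto_measure_norm_gt
  have ht : Tendsto (fun r : ℝ => ENNReal.ofReal (K / r ^ 2)) atTop (𝓝 0) := by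
    rw [← ENNReal.ofReal_zero]
    refine (ENNReal.continuous_ofReal.tendsto 0).comp ?_
    exact tendsto_const_nhds.div_atTop (tendsto_pow_atTop two_ne_zero)
  refine tendsto_of_tendsto_of_tendsto_of_le_of_le' tendsto_const_nhds ht
    (Eventually.of_forall fun _ => zero_le) ?_
  filter_upwards [eventually_gt_atTop 0] with r hr
  refine iSup₂_le fun ν hν => ?_
  obtain ⟨hp, hi, hK⟩ := hS ν hν
  have hsub : {x : ℝ | r < ‖x‖} ⊆ {x | r ^ 2 ≤ x ^ 2} := by
    intro x hx
    have hx' : r < |x| := hx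
    have := sq_abs x
    simp only [Set.mem_ofPred_eq]
    nlinarith
  refine (measure_mono hsub).trans ?_
  have hmk := mul_meas_ge_le_integral_of_nonneg (ae_of_all ν fun t : ℝ => sq_nonneg t) hi (r ^ 2)
  rw [← ofReal_measureReal]
  apply ENNReal.ofReal_le_ofReal
  rw [le_div_iff₀ (by positivity), mul_comm]
  exact hmk.trans hK

theorem summable_gaussian (s : ℝ) :
    HasSum (fun k : ℕ => (s / 2) ^ k / (k.factorial : ℝ)) (Real.exp (s / 2)) := by
  have := NormedSpace.expSeries_div_hasSum_exp (𝔸 := ℝ) (s / 2)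
  rwa [← Real.exp_eq_exp_ℝ] at this

/-- The factor (2k)! cancels: the even terms of the generating series are dominated by those of
exp(D t²/2), the Gaussian one. -/
theorem growth_term_le {β : ℕ → ℝ} {D : ℝ} (hg : GaussianGrowth β D) (t : ℝ) (k : ℕ) :
    t ^ (2 * k) * β (2 * k) / ((2 * k).factorial : ℝ) ≤
      (D * t ^ 2 / 2) ^ k / (k.factorial : ℝ) := by
  have hf : (0 : ℝ) < (2 * k).factorial := by exact_mod_cast Nat.factorial_pos _
  have ht : 0 ≤ t ^ (2 * k) := by rw [pow_mul]; positivity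
  calc t ^ (2 * k) * β (2 * k) / ((2 * k).factorial : ℝ)
      ≤ t ^ (2 * k) * (((2 * k).factorial : ℝ) / (2 ^ k * (k.factorial : ℝ)) * D ^ k) /
          ((2 * k).factorial : ℝ) := by
        gcongr
        exact hg k
    _ = _ := by
        rw [div_pow, mul_pow, pow_mul]
        field_simp

/-- cosh has only even, nonnegative terms, so it can be integrated termwise and needs only the bound
on even moments; exp|u| ≤ 2 cosh u. -/
theorem integrable_exp_abs {μ : Measure ℝ} [IsProbabilityMeasure μ] {β : ℕ → ℝ} {D : ℝ}
    (hμ : HasMoments μ β) (hg : GaussianGrowth β D) (s : ℝ) :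
    Integrable (fun x : ℝ => Real.exp |s * x|) μ := by
  have hcosh : Integrable (fun x : ℝ => Real.cosh (s * x)) μ := by
    have hpos : ∀ (x : ℝ) (k : ℕ), 0 ≤ (s * x) ^ (2 * k) / ((2 * k).factorial : ℝ) := by
      intro x k
      rw [pow_mul]; positivity
    have hsum : ∀ x : ℝ, HasSum (fun k : ℕ => (s * x) ^ (2 * k) / ((2 * k).factorial : ℝ))
        (Real.cosh (s * x)) := fun x => Real.hasSum_cosh (s * x)
    refine ⟨by fun_prop, ?_⟩
    rw [hasFiniteIntegral_iff_ofReal (ae_of_all _ fun x => (Real.cosh_pos _).le)]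
    have h1 : ∀ x : ℝ, ENNReal.ofReal (Real.cosh (s * x)) =
        ∑' k : ℕ, ENNReal.ofReal ((s * x) ^ (2 * k) / ((2 * k).factorial : ℝ)) := by
      intro x
      rw [← (hsum x).tsum_eq, ENNReal.ofReal_tsum_of_nonneg (hpos x) (hsum x).summable]
    simp_rw [h1]
    rw [lintegral_tsum fun k => by fun_prop]
    have h2 : ∀ k : ℕ, ∫⁻ x, ENNReal.ofReal ((s * x) ^ (2 * k) / ((2 * k).factorial : ℝ)) ∂μ =
        ENNReal.ofReal (s ^ (2 * k) * β (2 * k) / ((2 * k).factorial : ℝ)) := by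
      intro k
      have hi : Integrable (fun x : ℝ => (s * x) ^ (2 * k) / ((2 * k).factorial : ℝ)) μ := by
        simp_rw [mul_pow]
        exact ((hμ (2 * k)).1.const_mul _).div_const _
      rw [← ofReal_integral_eq_lintegral_ofReal hi (ae_of_all _ fun x => hpos x k)]
      congr 1
      simp_rw [mul_pow]
      rw [integral_div, integral_const_mul, (hμ (2 * k)).2]
    simp_rw [h2]
    refine lt_of_le_of_lt (ENNReal.tsum_le_tsum fun k =>
      ENNReal.ofReal_le_ofReal (growth_term_le hg s k)) ?_
    exact (summable_gaussian (D * s ^ 2)).summable.tsum_ofReal_lt_top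
  refine (hcosh.const_mul 2).mono' (by fun_prop) (ae_of_all _ fun x => ?_)
  rw [Real.norm_eq_abs, Real.abs_exp, ← Real.cosh_abs, Real.cosh_eq]
  have := Real.exp_pos (-|s * x|)
  linarith

/-- The exponential series is integrated termwise under the dominating function exp(|z| |x|). The
transform is therefore a power series whose coefficients are the moments, which gives determinacy.
-/
theorem hasSum_complexMGF {μ : Measure ℝ} [IsProbabilityMeasure μ] {β : ℕ → ℝ} {D : ℝ}
    (hμ : HasMoments μ β) (hg : GaussianGrowth β D) (z : ℂ) :
    HasSum (fun k : ℕ => z ^ k * (β k : ℂ) / (k.factorial : ℂ)) (complexMGF id μ z) := by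
  have hexp : ∀ w : ℂ, HasSum (fun k : ℕ => w ^ k / (k.factorial : ℂ)) (Complex.exp w) := by
    intro w
    have := NormedSpace.expSeries_div_hasSum_exp (𝔸 := ℂ) w
    rwa [← Complex.exp_eq_exp_ℂ] at this
  have hexpr : ∀ w : ℝ, HasSum (fun k : ℕ => w ^ k / (k.factorial : ℝ)) (Real.exp w) := by
    intro w
    have := NormedSpace.expSeries_div_hasSum_exp (𝔸 := ℝ) w
    rwa [← Real.exp_eq_exp_ℝ] at this
  have key := hasSum_integral_of_dominated_convergence (μ := μ)
    (F := fun (k : ℕ) (x : ℝ) => (z * x) ^ k / (k.factorial : ℂ))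
    (f := fun x : ℝ => Complex.exp (z * x))
    (fun k x => |‖z‖ * x| ^ k / (k.factorial : ℝ))
    (fun k => by fun_prop)
    (fun k => ae_of_all _ fun x => by
      rw [norm_div, norm_pow, norm_mul, Complex.norm_real, Complex.norm_natCast, abs_mul, abs_norm,
        Real.norm_eq_abs])
    (ae_of_all _ fun x => (hexpr _).summable)
    (by
      simp_rw [(hexpr _).tsum_eq]
      exact integrable_exp_abs hμ hg ‖z‖)
    (ae_of_all _ fun x => hexp _)
  have hterm : ∀ k : ℕ, ∫ x : ℝ, (z * x) ^ k / (k.factorial : ℂ) ∂μ =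
      z ^ k * (β k : ℂ) / (k.factorial : ℂ) := by
    intro k
    simp_rw [mul_pow]
    rw [integral_div, integral_const_mul, ← (hμ k).2]
    congr 2
    rw [← integral_complex_ofReal]
    simp
  simp_rw [hterm] at key
  exact key

/-- A measure with moments of Gaussian growth is determined by its moments. -/
theorem eq_of_hasMoments {μ μ' : Measure ℝ} [IsProbabilityMeasure μ] [IsProbabilityMeasure μ']
    {β : ℕ → ℝ} {D : ℝ} (hμ : HasMoments μ β) (hμ' : HasMoments μ' β) (hg : GaussianGrowth β D) :
    μ = μ' :=
  Measure.ext_of_complexMGF_id_eq (funext fun z =>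
    (hasSum_complexMGF hμ hg z).unique (hasSum_complexMGF hμ' hg z))

/-- With the odd moments zero, the generating function is its even series, dominated term by term by
that of exp(D t²/2). -/
theorem hasSubgaussianMGF_of_hasMoments {μ : Measure ℝ} [IsProbabilityMeasure μ] {β : ℕ → ℝ}
    {D : NNReal} (hμ : HasMoments μ β) (hg : GaussianGrowth β D) (hodd : ∀ h, Odd h → β h = 0) :
    HasSubgaussianMGF id D μ := by
  have hint : ∀ t : ℝ, Integrable (fun x : ℝ => Real.exp (t * x)) μ := by
    intro t
    refine (integrable_exp_abs hμ hg t).mono' (by fun_prop) (ae_of_all _ fun x => ?_)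
    rw [Real.norm_eq_abs, Real.abs_exp]
    exact Real.exp_le_exp.2 (le_abs_self _)
  refine ⟨hint, fun t => ?_⟩
  have h1 : HasSum (fun k : ℕ => t ^ k * β k / (k.factorial : ℝ)) (mgf id μ t) := by
    have := hasSum_complexMGF hμ hg (t : ℂ)
    rw [complexMGF_ofReal] at this
    rw [← Complex.hasSum_ofReal]
    simpa using this
  have h2 : HasSum (fun k : ℕ => t ^ (2 * k) * β (2 * k) / ((2 * k).factorial : ℝ))
      (mgf id μ t) := by
    refine ((mul_right_injective₀ (two_ne_zero' ℕ)).hasSum_iff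
      (f := fun k : ℕ => t ^ k * β k / (k.factorial : ℝ)) ?_).2 h1
    intro k hk
    have : Odd k := by
      rw [← Nat.not_even_iff_odd]
      intro he
      obtain ⟨j, hj⟩ := he.two_dvd
      exact hk ⟨j, hj.symm⟩
    rw [hodd k this]
    simp
  exact hasSum_le (growth_term_le hg t) h2 (summable_gaussian (D * t ^ 2))

/-- Weak convergence from convergence of moments. -/
theorem tendsto_of_tendsto_moments {ν : ℕ → ProbabilityMeasure ℝ} {μ : ProbabilityMeasure ℝ}
    {β : ℕ → ℝ} {D : ℝ} (hμ : HasMoments μ β) (hg : GaussianGrowth β D)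
    (hint : ∀ (h n : ℕ), Integrable (fun t : ℝ => t ^ h) (ν n : Measure ℝ))
    (hlim : ∀ h : ℕ, Tendsto (fun n => ∫ t, t ^ h ∂(ν n : Measure ℝ)) atTop (𝓝 (β h))) :
    Tendsto ν atTop (𝓝 μ) := by
  obtain ⟨K, hK⟩ := (hlim 2).bddAbove_range
  have htight : IsTightMeasureSet {((ρ : ProbabilityMeasure ℝ) : Measure ℝ) | ρ ∈ Set.range ν} := by
    apply isTightMeasureSet_of_second_moment (K := K)
    rintro _ ⟨_, ⟨n, rfl⟩, rfl⟩
    exact ⟨inferInstance, hint 2 n, hK ⟨n, rfl⟩⟩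
  have hcomp := isCompact_closure_of_isTightMeasureSet htight
  -- Along every ultrafilter, tightness provides some weak limit; it inherits the moments `β`, so it
  -- is `μ` by determinacy. No subsequences are needed.
  rw [tendsto_iff_ultrafilter]
  intro g hgle
  obtain ⟨μ', -, hμ'⟩ := hcomp.ultrafilter_le_nhds (g.map ν) (by
    rw [le_principal_iff, Ultrafilter.mem_coe, Ultrafilter.mem_map]
    exact Filter.univ_mem' fun n => subset_closure ⟨n, rfl⟩)
  have hg' : Tendsto ν g (𝓝 μ') := hμ'
  have hm' := hasMoments_of_weak_limit hg' (fun h => Eventually.of_forall (hint h))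
    fun h => (hlim h).mono_left hgle
  have heq : (μ : Measure ℝ) = (μ' : Measure ℝ) := eq_of_hasMoments hμ hm' hg
  have : μ = μ' := Subtype.ext heq
  rwa [this]

/-- A sequence that is the limit of moment sequences is a moment sequence. -/
theorem exists_hasMoments {ν : ℕ → ProbabilityMeasure ℝ} {β : ℕ → ℝ}
    (hint : ∀ (h n : ℕ), Integrable (fun t : ℝ => t ^ h) (ν n : Measure ℝ))
    (hlim : ∀ h : ℕ, Tendsto (fun n => ∫ t, t ^ h ∂(ν n : Measure ℝ)) atTop (𝓝 (β h))) :
    ∃ μ : ProbabilityMeasure ℝ, HasMoments μ β := by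
  obtain ⟨K, hK⟩ := (hlim 2).bddAbove_range
  have htight : IsTightMeasureSet {((ρ : ProbabilityMeasure ℝ) : Measure ℝ) | ρ ∈ Set.range ν} := by
    apply isTightMeasureSet_of_second_moment (K := K)
    rintro _ ⟨_, ⟨n, rfl⟩, rfl⟩
    exact ⟨inferInstance, hint 2 n, hK ⟨n, rfl⟩⟩
  have hcomp := isCompact_closure_of_isTightMeasureSet htight
  let g : Ultrafilter ℕ := Ultrafilter.of atTop
  obtain ⟨μ', -, hμ'⟩ := hcomp.ultrafilter_le_nhds (g.map ν) (by
    rw [le_principal_iff, Ultrafilter.mem_coe, Ultrafilter.mem_map]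
    exact Filter.univ_mem' fun n => subset_closure ⟨n, rfl⟩)
  have hg' : Tendsto ν g (𝓝 μ') := hμ'
  exact ⟨μ', hasMoments_of_weak_limit hg' (fun h => Eventually.of_forall (hint h))
    fun h => (hlim h).mono_left (Ultrafilter.of_le _)⟩

theorem tendsto_cdf_of_tendsto {ν : ℕ → ProbabilityMeasure ℝ} {μ : ProbabilityMeasure ℝ}
    (hν : Tendsto ν atTop (𝓝 μ)) {t : ℝ} (ht : ContinuousAt (cdf (μ : Measure ℝ)) t) :
    Tendsto (fun n => (ν n : Measure ℝ).real (Set.Iic t)) atTop (𝓝 (cdf (μ : Measure ℝ) t)) := by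
  have hnull : (μ : Measure ℝ) (frontier (Set.Iic t)) = 0 := by
    -- The boundary of the half-line is the point `t`, whose mass is the jump of the distribution
    -- function there.
    rw [frontier_Iic]
    conv_lhs => rw [← measure_cdf (μ : Measure ℝ)]
    rw [StieltjesFunction.measure_singleton, ht.continuousWithinAt.leftLim_eq, sub_self,
      ENNReal.ofReal_zero]
  have h := ProbabilityMeasure.tendsto_measure_of_null_frontier_of_tendsto' hν hnull
  rw [cdf_eq_real]
  exact (ENNReal.tendsto_toReal (measure_ne_top _ _)).comp h

/-- Distribution functions are close if finitely many moments are. -/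
theorem exists_moments_close {μ : ProbabilityMeasure ℝ}
    {β : ℕ → ℝ} {D : ℝ} (hμ : HasMoments μ β) (hg : GaussianGrowth β D) {t : ℝ}
    (ht : ContinuousAt (cdf (μ : Measure ℝ)) t) {ε : ℝ} (hε : 0 < ε) :
    ∃ (H : ℕ) (η : ℝ), 0 < η ∧ ∀ ν : ProbabilityMeasure ℝ,
      (∀ h, Integrable (fun s : ℝ => s ^ h) (ν : Measure ℝ)) →
      (∀ h < H, |∫ s, s ^ h ∂(ν : Measure ℝ) - β h| < η) →
      |(ν : Measure ℝ).real (Set.Iic t) - cdf (μ : Measure ℝ) t| < ε := by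
  by_contra hcon
  push Not at hcon
  -- If the claim fails, counterexamples with n moments within 1/(n+1) form a sequence whose moments
  -- all converge, contradicting weak convergence.
  have hcon' : ∀ n : ℕ, ∃ ν : ProbabilityMeasure ℝ,
      (∀ h, Integrable (fun s : ℝ => s ^ h) (ν : Measure ℝ)) ∧
      (∀ h < n, |∫ s, s ^ h ∂(ν : Measure ℝ) - β h| < 1 / ((n : ℝ) + 1)) ∧
      ε ≤ |(ν : Measure ℝ).real (Set.Iic t) - cdf (μ : Measure ℝ) t| := fun n =>
    hcon n (1 / ((n : ℝ) + 1)) (by positivity)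
  choose ν hint hmom hfar using hcon'
  have hlim : ∀ h : ℕ, Tendsto (fun n => ∫ s, s ^ h ∂(ν n : Measure ℝ)) atTop (𝓝 (β h)) := by
    intro h
    rw [tendsto_iff_norm_sub_tendsto_zero]
    refine squeeze_zero' (Eventually.of_forall fun _ => norm_nonneg _) ?_
      tendsto_one_div_add_atTop_nhds_zero_nat
    filter_upwards [eventually_gt_atTop h] with n hn
    exact (hmom n h hn).le
  have hw := tendsto_of_tendsto_moments hμ hg (fun h n => hint n h) hlim
  have hc := tendsto_cdf_of_tendsto hw ht
  rw [tendsto_iff_norm_sub_tendsto_zero] at hc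
  exact absurd (ge_of_tendsto' hc hfar) (not_le.2 hε)

end MomentMethod

end SchurHadamard

namespace SchurHadamard

/-! ### Spectral distributions with convergent moments -/

/-- The empirical spectral distribution as a probability measure. -/
noncomputable def esdProb {n : ℕ} (hn : 0 < n) {A : Matrix (Fin n) (Fin n) ℝ}
    (hA : A.IsHermitian) : ProbabilityMeasure ℝ :=
  ⟨esd A, isProbabilityMeasure_esd hn hA⟩

theorem tendsto_esdCDF_of_moments {A : (n : ℕ) → Matrix (Fin n) (Fin n) ℝ}
    (hA : ∀ n, (A n).IsHermitian) {μ : ProbabilityMeasure ℝ} {β : ℕ → ℝ} {D : ℝ}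
    (hμ : HasMoments μ β) (hg : GaussianGrowth β D)
    (hlim : ∀ h : ℕ, Tendsto (fun n => esdMoment h (A n)) atTop (𝓝 (β h))) {t : ℝ}
    (ht : ContinuousAt (cdf (μ : Measure ℝ)) t) :
    Tendsto (fun n => esdCDF (A n) t) atTop (𝓝 (cdf (μ : Measure ℝ) t)) := by
  -- The spectral measure of the empty matrix is zero, not a probability measure, so the sequence
  -- starts at n = 1.
  rw [← tendsto_add_atTop_iff_nat 1]
  let ν : ℕ → ProbabilityMeasure ℝ := fun n => esdProb n.succ_pos (hA (n + 1))
  have hw : Tendsto ν atTop (𝓝 μ) := tendsto_of_tendsto_moments hμ hg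
    (fun h n => integrable_esd n.succ_pos (hA (n + 1)) _)
    fun h => (tendsto_add_atTop_iff_nat 1).2 (hlim h)
  exact tendsto_cdf_of_tendsto hw ht

theorem exists_hasMoments_of_esdMoment {A : (n : ℕ) → Matrix (Fin n) (Fin n) ℝ}
    (hA : ∀ n, (A n).IsHermitian) {β : ℕ → ℝ}
    (hlim : ∀ h : ℕ, Tendsto (fun n => esdMoment h (A n)) atTop (𝓝 (β h))) :
    ∃ μ : ProbabilityMeasure ℝ, HasMoments μ β :=
  exists_hasMoments (ν := fun n => esdProb n.succ_pos (hA (n + 1)))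
    (fun _ n => integrable_esd n.succ_pos (hA (n + 1)) _)
    fun h => (tendsto_add_atTop_iff_nat 1).2 (hlim h)

/-! ### Existence of the limit law -/

section Rademacher

/-- The uniform law on `{-1, 1}`. -/
noncomputable def rademacher : Measure ℝ :=
  (2 : ENNReal)⁻¹ • (Measure.dirac 1 + Measure.dirac (-1))

instance isProbabilityMeasure_rademacher : IsProbabilityMeasure rademacher := by
  refine ⟨?_⟩
  rw [rademacher, Measure.smul_apply, Measure.add_apply, measure_univ, measure_univ, smul_eq_mul,
    one_add_one_eq_two]
  exact ENNReal.inv_mul_cancel two_ne_zero ENNReal.ofNat_ne_top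

theorem integral_rademacher (f : ℝ → ℝ) : ∫ t, f t ∂rademacher = (f 1 + f (-1)) / 2 := by
  rw [rademacher, integral_smul_measure, integral_add_measure (integrable_dirac (by simp))
    (integrable_dirac (by simp)), integral_dirac, integral_dirac]
  simp
  ring

theorem ae_rademacher : ∀ᵐ t ∂rademacher, |t| ≤ 1 := by
  rw [rademacher]
  refine Measure.ae_smul_measure ?_ _
  rw [ae_add_measure_iff, ae_dirac_iff (measurableSet_le (by fun_prop) (by fun_prop)),
    ae_dirac_iff (measurableSet_le (by fun_prop) (by fun_prop))]
  norm_num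

variable {ι κ : Type*}

theorem inputA1_rademacher {σ : Type*} {f : ι → σ} (hf : Function.Injective f) :
    InputA1 (Measure.infinitePi fun _ : σ => rademacher) (fun i (ω : σ → ℝ) => ω (f i)) := by
  set P := Measure.infinitePi fun _ : σ => rademacher
  have hpres : ∀ i, MeasurePreserving (fun ω : σ → ℝ => ω (f i)) P rademacher := fun i =>
    measurePreserving_eval_infinitePi (fun _ : σ => rademacher) (f i)
  have hbound : ∀ i, ∀ᵐ ω ∂P, |ω (f i)| ≤ 1 := fun i =>
    (hpres i).quasiMeasurePreserving.ae ae_rademacher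
  have hmean : ∀ (i : ι) (g : ℝ → ℝ), Measurable g →
      ∫ ω, g (ω (f i)) ∂P = (g 1 + g (-1)) / 2 := by
    intro i g hg
    rw [← integral_rademacher g, ← (hpres i).map_eq, integral_map
      (measurable_pi_apply _).aemeasurable hg.aestronglyMeasurable]
  have hm : ∀ i, ∫ ω, ω (f i) ∂P = 0 := fun i => by
    have := hmean i id measurable_id
    simpa using this
  refine ⟨⟨fun i => measurable_pi_apply _, ?_, fun i => ?_, hm, fun i => ?_⟩, 1, hbound⟩
  · exact (iIndepFun_infinitePi (P := fun _ : σ => rademacher) (X := fun _ t => t)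
      fun _ => measurable_id).precomp hf
  · exact MemLp.of_bound (measurable_pi_apply _).aestronglyMeasurable 1 (hbound i)
  · rw [variance_eq_integral (measurable_pi_apply _).aemeasurable, hm i]
    have := hmean i (fun t => (t - 0) ^ 2) (by fun_prop)
    simpa using this

theorem indepFun_coordinates (ι κ : Type*) :
    IndepFun (fun (ω : ι ⊕ κ → ℝ) (i : ι) => ω (Sum.inl i)) (fun ω (j : κ) => ω (Sum.inr j))
      (Measure.infinitePi fun _ : ι ⊕ κ => rademacher) := by
  have hind : iIndepFun (fun (s : ι ⊕ κ) (ω : ι ⊕ κ → ℝ) => ω s)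
      (Measure.infinitePi fun _ : ι ⊕ κ => rademacher) :=
    iIndepFun_infinitePi (P := fun _ : ι ⊕ κ => rademacher) (X := fun _ t => t)
      fun _ => measurable_id
  have h := indep_iSup_of_disjoint (fun s => (measurable_pi_apply s).comap_le) hind.iIndep
    Set.isCompl_range_inl_range_inr.disjoint
  rw [IndepFun_iff_Indep]
  refine indep_of_indep_of_le_left (indep_of_indep_of_le_right h ?_) ?_
  · refine Measurable.comap_le (@measurable_pi_lambda _ _ _ (sigmaOf _ _) _ _ fun j => ?_)
    exact measurable_sigmaOf (x := fun (s : ι ⊕ κ) (ω : ι ⊕ κ → ℝ) => ω s) (Set.mem_range_self j)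
  · refine Measurable.comap_le (@measurable_pi_lambda _ _ _ (sigmaOf _ _) _ _ fun j => ?_)
    exact measurable_sigmaOf (x := fun (s : ι ⊕ κ) (ω : ι ⊕ κ → ℝ) => ω s) (Set.mem_range_self j)

/-- Independent signs indexed by `ι ⊕ κ` supply both input families on one product space. Almost
surely all moments converge, so one outcome already exhibits the limit sequence as a limit of moment
sequences. -/
theorem exists_limit_law {LX : Link ι} {LY : Link κ} (hX : LX.IsSymm) (hY : LY.IsSymm)
    (hXB : LX.PropertyB) (hYB : LY.PropertyB) {p : (h : ℕ) → Word h → Word h → ℝ}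
    (hp : IsWordLimit LX LY p) : ∃ μ : ProbabilityMeasure ℝ, HasMoments μ (limitMoment p) := by
  have hx := (inputA1_rademacher (Sum.inl_injective (α := ι) (β := κ))).inputA3
  have hy := (inputA1_rademacher (Sum.inr_injective (α := ι) (β := κ))).inputA3
  have hxy := indepFun_coordinates ι κ
  obtain ⟨ω, hω⟩ := (ae_tendsto_esdMoment (expectedMomentsTendsto hX hY hXB hYB hp hx hy hxy)
    (fourthMomentSummable hX hY hXB hYB hx hy hxy)).exists
  exact exists_hasMoments_of_esdMoment (fun n => isHermitian_scaledProduct hX hY _ _ n ω) hω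

end Rademacher

theorem gaussianGrowth_limitMoment {ι κ : Type*} {LX : Link ι} {LY : Link κ}
    (hXB : LX.PropertyB) (hYB : LY.PropertyB) {p : (h : ℕ) → Word h → Word h → ℝ}
    (hp : IsWordLimit LX LY p) :
    GaussianGrowth (limitMoment p) ((min LX.Delta LY.Delta).toNat : ℝ) := fun k =>
  limitMoment_le_of_rowBound hp (rowBound_toNat_min_Delta hXB hYB) k

/-! ### Carleman's condition -/

/-- A vanishing even moment would force the law to be the point mass at 0, against a nonzero second
moment. Positivity is what makes the negative powers in Carleman's series monotone. -/
theorem even_moment_pos {μ : Measure ℝ} [IsProbabilityMeasure μ] {β : ℕ → ℝ}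
    (hμ : HasMoments μ β) (h2 : β 2 ≠ 0) (k : ℕ) : 0 < β (2 * k) := by
  have hnn : 0 ≤ᵐ[μ] fun t : ℝ => t ^ (2 * k) := ae_of_all _ fun t => by
    simp only [Pi.zero_apply, pow_mul]
    positivity
  rw [← (hμ (2 * k)).2]
  refine lt_of_le_of_ne (integral_nonneg_of_ae hnn) fun h0 => h2 ?_
  have hz := (integral_eq_zero_iff_of_nonneg_ae hnn (hμ (2 * k)).1).1 h0.symm
  have hz' : ∀ᵐ t ∂μ, t ^ 2 = 0 := by
    filter_upwards [hz] with t ht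
    have ht0 : t = 0 := eq_zero_of_pow_eq_zero ht
    rw [ht0]; norm_num
  rw [← (hμ 2).2, integral_congr_ae hz', integral_zero]

/-- (2k)!/k! is a product of k factors, each at most 2k. -/
theorem factorial_ratio_le (k : ℕ) :
    ((2 * k).factorial : ℝ) / (2 ^ k * (k.factorial : ℝ)) ≤ (k : ℝ) ^ k := by
  have h1 := Nat.factorial_mul_descFactorial (n := 2 * k) (k := k) (by lia)
  have h2 := Nat.descFactorial_le_pow (2 * k) k
  rw [show 2 * k - k = k by lia] at h1
  rw [div_le_iff₀ (by positivity)]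
  have h3 : (2 * k).factorial ≤ k.factorial * (2 * k) ^ k := by
    rw [← h1]; exact Nat.mul_le_mul_left _ h2
  have h4 : ((2 * k).factorial : ℝ) ≤ k.factorial * (2 * (k : ℝ)) ^ k := by exact_mod_cast h3
  calc ((2 * k).factorial : ℝ) ≤ k.factorial * (2 * (k : ℝ)) ^ k := h4
    _ = _ := by rw [mul_pow]; ring

/-- From β_{2k} ≤ (kD)^k the k-th term is at least (kD)^{-1/2}, and the sum of k^{-1/2} diverges. -/
theorem carleman_of_growth {β : ℕ → ℝ} {D : ℝ} (hD : 0 < D) (hg : GaussianGrowth β D)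
    (hpos : ∀ k, 0 < β (2 * k)) : Carleman β := by
  intro hs
  have hle : ∀ h : ℕ, (D ^ (-(1 : ℝ) / 2)) * ((h + 1 : ℕ) : ℝ) ^ (-(1 : ℝ) / 2) ≤
      (β (2 * (h + 1))) ^ (-(1 : ℝ) / (2 * ((h : ℝ) + 1))) := by
    intro h
    have hk : (0 : ℝ) < (h + 1 : ℕ) := by positivity
    have h1 : β (2 * (h + 1)) ≤ (((h + 1 : ℕ) : ℝ) * D) ^ (h + 1) := by
      rw [mul_pow]
      exact (hg (h + 1)).trans
        (mul_le_mul_of_nonneg_right (factorial_ratio_le (h + 1)) (by positivity))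
    have h2 : ((((h + 1 : ℕ) : ℝ) * D) ^ (h + 1)) ^ (-(1 : ℝ) / (2 * ((h : ℝ) + 1))) =
        (((h + 1 : ℕ) : ℝ) * D) ^ (-(1 : ℝ) / 2) := by
      rw [← Real.rpow_natCast, ← Real.rpow_mul (by positivity)]
      congr 1
      push_cast
      field_simp
    rw [mul_comm, ← Real.mul_rpow hk.le hD.le, ← h2]
    refine Real.rpow_le_rpow_of_nonpos (hpos (h + 1)) h1 ?_
    apply div_nonpos_of_nonpos_of_nonneg <;> [norm_num; positivity]
  have hs' := Summable.of_nonneg_of_le (fun h => by positivity) hle hs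
  rw [summable_mul_left_iff (by positivity : (D ^ (-(1 : ℝ) / 2)) ≠ 0),
    summable_nat_add_iff (f := fun k : ℕ => (k : ℝ) ^ (-(1 : ℝ) / 2)) 1,
    Real.summable_nat_rpow] at hs'
  norm_num at hs'

end SchurHadamard

namespace SchurHadamard

/-! ### Truncation -/

section Truncation

variable {Ω ι κ : Type*} [MeasurableSpace Ω] {P : Measure Ω} [IsProbabilityMeasure P]

open Classical in
/-- The identity on `[-M, M]`, zero elsewhere. -/
noncomputable def cutoff (M s : ℝ) : ℝ := if |s| ≤ M then s else 0

theorem measurable_cutoff (M : ℝ) : Measurable (cutoff M) := by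
  unfold cutoff
  exact Measurable.ite (measurableSet_le (by fun_prop) measurable_const) measurable_id
    measurable_const

theorem abs_cutoff_le {M : ℝ} (hM : 0 ≤ M) (s : ℝ) : |cutoff M s| ≤ M := by
  unfold cutoff
  split_ifs with h
  · exact h
  · simpa using hM

theorem tendsto_integral_sub_cutoff {P : Measure Ω} {X : Ω → ℝ} (hX : Measurable X) (hX2 : MemLp X 2 P) :
    Tendsto (fun M : ℕ => ∫ ω, (X ω - cutoff M (X ω)) ^ 2 ∂P) atTop (𝓝 0) := by
  have h := tendsto_integral_of_dominated_convergence (μ := P)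
    (F := fun (M : ℕ) ω => (X ω - cutoff M (X ω)) ^ 2) (f := fun _ => 0) (fun ω => X ω ^ 2)
    (fun M => ((hX.sub ((measurable_cutoff M).comp hX)).pow_const 2).aestronglyMeasurable)
    hX2.integrable_sq
    (fun M => ae_of_all _ fun ω => by
      rw [Real.norm_eq_abs, abs_of_nonneg (sq_nonneg _), cutoff]
      split_ifs
      · simp [sq_nonneg]
      · simp)
    (ae_of_all _ fun ω => by
      refine tendsto_const_nhds.congr' ?_
      filter_upwards [eventually_ge_atTop ⌈|X ω|⌉₊] with M hM
      have : |X ω| ≤ (M : ℝ) := (Nat.le_ceil _).trans (by exact_mod_cast hM)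
      rw [cutoff, if_pos this]
      simp)
  simpa using h

/-- A square integrable standardized variable is approximated by bounded standardized functions of
itself. -/
theorem exists_bounded_approx {X : Ω → ℝ} (hX : Measurable X) (hX2 : MemLp X 2 P)
    (hmean : ∫ ω, X ω ∂P = 0) (hvar : ∫ ω, X ω ^ 2 ∂P = 1) {ε : ℝ} (hε : 0 < ε) :
    ∃ g : ℝ → ℝ, Measurable g ∧ (∃ C, ∀ s, |g s| ≤ C) ∧ ∫ ω, g (X ω) ∂P = 0 ∧
      ∫ ω, g (X ω) ^ 2 ∂P = 1 ∧ ∫ ω, (X ω - g (X ω)) ^ 2 ∂P ≤ ε := by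
  -- The level ε/2 serves the final estimate; 1/4 keeps the variance of the truncation away from 0,
  -- so that it can be rescaled.
  obtain ⟨M, hM⟩ := ((tendsto_integral_sub_cutoff hX hX2).eventually
    (gt_mem_nhds (show (0 : ℝ) < min (ε / 2) (1 / 4) by positivity))).exists
  set a := ∫ ω, (X ω - cutoff M (X ω)) ^ 2 ∂P with ha
  have ha1 : a ≤ ε / 2 := hM.le.trans (min_le_left _ _)
  have ha2 : a ≤ 1 / 4 := hM.le.trans (min_le_right _ _)
  set m := ∫ ω, cutoff M (X ω) ∂P with hm
  set f : ℝ → ℝ := fun s => cutoff M s - m with hf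
  have hfm : Measurable f := (measurable_cutoff M).sub_const m
  have hfb : ∀ s, |f s| ≤ M + |m| := fun s =>
    (abs_sub _ _).trans (add_le_add (abs_cutoff_le (Nat.cast_nonneg M) s) le_rfl)
  have hz : Measurable fun ω => f (X ω) := hfm.comp hX
  have hcut : Measurable fun ω => cutoff M (X ω) := (measurable_cutoff M).comp hX
  have hzL : MemLp (fun ω => f (X ω)) 2 P :=
    MemLp.of_bound hz.aestronglyMeasurable _ (ae_of_all _ fun ω => hfb _)
  have hcL : MemLp (fun ω => cutoff M (X ω)) 2 P :=
    MemLp.of_bound hcut.aestronglyMeasurable M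
      (ae_of_all _ fun ω => abs_cutoff_le (Nat.cast_nonneg M) _)
  have hX1 : Integrable X P := hX2.integrable one_le_two
  have hc1 : Integrable (fun ω => cutoff M (X ω)) P := hcL.integrable one_le_two
  have hz1 : Integrable (fun ω => f (X ω)) P := hzL.integrable one_le_two
  have hz0 : ∫ ω, f (X ω) ∂P = 0 := by
    simp only [hf]
    rw [integral_sub hc1 (integrable_const _)]
    simp [hm]
  have hXz : Integrable (fun ω => X ω * f (X ω)) P := hX2.integrable_mul hzL
  set v := ∫ ω, f (X ω) ^ 2 ∂P with hv
  set c := ∫ ω, X ω * f (X ω) ∂P with hc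
  have hquad : ∀ r : ℝ, ∫ ω, (X ω - r * f (X ω)) ^ 2 ∂P = 1 - 2 * r * c + r ^ 2 * v := by
    intro r
    have h1 : ∀ ω, (X ω - r * f (X ω)) ^ 2 =
        X ω ^ 2 - 2 * r * (X ω * f (X ω)) + r ^ 2 * f (X ω) ^ 2 := fun ω => by ring
    have h2 : Integrable (fun ω => X ω ^ 2 - 2 * r * (X ω * f (X ω))) P :=
      hX2.integrable_sq.sub (hXz.const_mul _)
    simp_rw [h1]
    rw [integral_add h2 (hzL.integrable_sq.const_mul _),
      integral_sub hX2.integrable_sq (hXz.const_mul _), integral_const_mul, integral_const_mul,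
      hvar]
  -- Since `X` is centred, centring the cutoff replaces the second moment of the error by its
  -- variance, which is no larger.
  have hle : 1 - 2 * c + v ≤ a := by
    have h1 := hquad 1
    have h2 : ∫ ω, (X ω - 1 * f (X ω)) ^ 2 ∂P ≤ a := by
      have hmem : MemLp (fun ω => X ω - cutoff M (X ω)) 2 P := hX2.sub hcL
      have hE : ∫ ω, (X ω - cutoff M (X ω)) ∂P = -m := by
        rw [integral_sub hX1 hc1, hmean, ← hm]; ring
      have hV := variance_le_expectation_sq (μ := P) hmem.aestronglyMeasurable
      rw [variance_eq_integral hmem.aestronglyMeasurable.aemeasurable, hE] at hV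
      refine le_trans (le_of_eq ?_) hV
      refine integral_congr_ae (ae_of_all _ fun ω => ?_)
      simp only [hf]
      ring
    rw [h1] at h2
    linarith
  -- Nonnegativity at r = 2 gives 4c ≤ 1 + 4v, while `hle` gives 4c ≥ 3/2 + 2v.
  have hv4 : 1 / 4 ≤ v := by
    have h2 := hquad 2
    have h3 : 0 ≤ ∫ ω, (X ω - 2 * f (X ω)) ^ 2 ∂P := integral_nonneg fun ω => sq_nonneg _
    rw [h2] at h3
    linarith
  set σ := Real.sqrt v with hσ
  have hσ2 : σ ^ 2 = v := Real.sq_sqrt (by linarith)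
  have hσh : 1 / 2 ≤ σ := by
    rw [hσ]
    apply Real.le_sqrt_of_sq_le
    linarith
  have hσ0 : 0 < σ := by linarith
  refine ⟨fun s => σ⁻¹ * f s, hfm.const_mul _, ⟨σ⁻¹ * (M + |m|), fun s => ?_⟩, ?_, ?_, ?_⟩
  · rw [abs_mul, abs_of_pos (inv_pos.2 hσ0)]
    exact mul_le_mul_of_nonneg_left (hfb s) (inv_pos.2 hσ0).le
  · rw [integral_const_mul, hz0, mul_zero]
  · simp_rw [mul_pow]
    rw [integral_const_mul, ← hv, ← hσ2]
    field_simp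
  · rw [hquad, ← hσ2]
    have h1 : 1 - 2 * σ⁻¹ * c + σ⁻¹ ^ 2 * σ ^ 2 = (2 * σ - 2 * c) / σ := by
      field_simp
      ring
    rw [h1, div_le_iff₀ hσ0]
    rw [← hσ2] at hle
    -- 2σ ≤ 1 + σ² gives 2σ - 2c ≤ a ≤ ε/2, and ε/2 ≤ εσ because σ ≥ 1/2.
    nlinarith [sq_nonneg (σ - 1)]

/-- Inputs with uniformly bounded moments that approximate a given input. -/
theorem exists_inputA3_approx {x : ι → Ω → ℝ} (hx : InputA2 P x ∨ InputA3 P x) {ε : ℝ}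
    (hε : 0 < ε) : ∃ g : ℝ → ℝ, Measurable g ∧ InputA3 P (fun i ω => g (x i ω)) ∧
      ∀ i, ∫ ω, (x i ω - g (x i ω)) ^ 2 ∂P ≤ ε := by
  rcases hx with ⟨hs, hid⟩ | hx
  · rcases isEmpty_or_nonempty ι with hι | ⟨⟨i₀⟩⟩
    · exact ⟨id, measurable_id, ⟨hs, fun m => ⟨0, fun i => isEmptyElim i⟩⟩, fun i => isEmptyElim i⟩
    -- One function built for a single index serves all indices, since the variables are identically
    -- distributed; under (A3) the identity will do.
    obtain ⟨g, hg, ⟨C, hC⟩, hg0, hg1, hgε⟩ := exists_bounded_approx (hs.measurable i₀) (hs.memLp i₀)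
      (hs.mean_zero i₀) (integral_sq_eq_one hs i₀) hε
    have htrans : ∀ (u : ℝ → ℝ), Measurable u → ∀ i,
        ∫ ω, u (x i ω) ∂P = ∫ ω, u (x i₀ ω) ∂P := fun u hu i =>
      ((hid i i₀).comp hu).integral_eq
    have hmean : ∀ i, ∫ ω, g (x i ω) ∂P = 0 := fun i => (htrans g hg i).trans hg0
    have hmeas : ∀ i, Measurable fun ω => g (x i ω) := fun i => hg.comp (hs.measurable i)
    refine ⟨g, hg, InputA1.inputA3 ⟨⟨hmeas, hs.indep.comp (fun _ => g) fun _ => hg, fun i => ?_,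
      hmean, fun i => ?_⟩, C, fun i => ae_of_all _ fun ω => hC _⟩, fun i => ?_⟩
    · exact MemLp.of_bound (hmeas i).aestronglyMeasurable C (ae_of_all _ fun ω => hC _)
    · rw [variance_eq_integral (hmeas i).aemeasurable, hmean i]
      simp_rw [sub_zero]
      exact (htrans (fun s => g s ^ 2) (hg.pow_const 2) i).trans hg1
    · exact (htrans (fun s => (s - g s) ^ 2) ((measurable_id.sub hg).pow_const 2) i).trans_le hgε
  · exact ⟨id, measurable_id, hx, fun i => by simpa using hε.le⟩

theorem standardInput_of_or {P : Measure Ω} {x : ι → Ω → ℝ} (hx : InputA2 P x ∨ InputA3 P x) :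
    StandardInput P x := hx.elim And.left And.left

/-- The mean square distance of the entries of two products. -/
theorem integral_sq_sub_le {x : ι → Ω → ℝ} {y : κ → Ω → ℝ} {g k : ℝ → ℝ}
    (hg : Measurable g) (hk : Measurable k) (hx : StandardInput P x) (hy : StandardInput P y)
    (hx' : StandardInput P fun i ω => g (x i ω)) (hy' : StandardInput P fun j ω => k (y j ω))
    (hxy : IndepFun (fun ω i => x i ω) (fun ω j => y j ω) P) {ε : ℝ}
    (hεx : ∀ i, ∫ ω, (x i ω - g (x i ω)) ^ 2 ∂P ≤ ε)
    (hεy : ∀ j, ∫ ω, (y j ω - k (y j ω)) ^ 2 ∂P ≤ ε) (i : ι) (j : κ) :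
    Integrable (fun ω => (x i ω * y j ω - g (x i ω) * k (y j ω)) ^ 2) P ∧
      ∫ ω, (x i ω * y j ω - g (x i ω) * k (y j ω)) ^ 2 ∂P ≤ 4 * ε := by
  have hprod : ∀ u w : ℝ → ℝ, Measurable u → Measurable w → Integrable (fun ω => u (x i ω)) P →
      Integrable (fun ω => w (y j ω)) P → Integrable (fun ω => u (x i ω) * w (y j ω)) P ∧
      ∫ ω, u (x i ω) * w (y j ω) ∂P = (∫ ω, u (x i ω) ∂P) * ∫ ω, w (y j ω) ∂P := by
    intro u w hu hw hiu hiw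
    have hF : Measurable fun z : ι → ℝ => u (z i) := hu.comp (measurable_pi_apply i)
    have hG : Measurable fun z : κ → ℝ => w (z j) := hw.comp (measurable_pi_apply j)
    exact ⟨(hxy.comp hF hG).integrable_mul hiu hiw,
      integral_mul_of_indepFun hx.measurable hy.measurable hxy hF hG⟩
  have h1 := hprod (fun s => (s - g s) ^ 2) (fun s => s ^ 2) ((measurable_id.sub hg).pow_const 2)
    (by fun_prop) ((hx.memLp i).sub (hx'.memLp i)).integrable_sq (hy.memLp j).integrable_sq
  have h2 := hprod (fun s => g s ^ 2) (fun s => (s - k s) ^ 2) (hg.pow_const 2)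
    ((measurable_id.sub hk).pow_const 2) (hx'.memLp i).integrable_sq
    ((hy.memLp j).sub (hy'.memLp j)).integrable_sq
  rw [integral_sq_eq_one hy] at h1
  rw [integral_sq_eq_one hx' i] at h2
  have hdom : Integrable (fun ω => 2 * ((x i ω - g (x i ω)) ^ 2 * y j ω ^ 2) +
      2 * (g (x i ω) ^ 2 * (y j ω - k (y j ω)) ^ 2)) P :=
    (h1.1.const_mul 2).add (h2.1.const_mul 2)
  have hle : ∀ ω, (x i ω * y j ω - g (x i ω) * k (y j ω)) ^ 2 ≤
      2 * ((x i ω - g (x i ω)) ^ 2 * y j ω ^ 2) +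
      2 * (g (x i ω) ^ 2 * (y j ω - k (y j ω)) ^ 2) := by
    intro ω
    -- The difference is (x - g)y + g(y - k). By independence and unit second moments each square
    -- has mean at most ε, hence 4ε in total.
    nlinarith [sq_nonneg ((x i ω - g (x i ω)) * y j ω - g (x i ω) * (y j ω - k (y j ω)))]
  have hmeas : Measurable fun ω => (x i ω * y j ω - g (x i ω) * k (y j ω)) ^ 2 :=
    (((hx.measurable i).mul (hy.measurable j)).sub
      ((hx'.measurable i).mul (hy'.measurable j))).pow_const 2
  have hint : Integrable (fun ω => (x i ω * y j ω - g (x i ω) * k (y j ω)) ^ 2) P := by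
    refine hdom.mono' hmeas.aestronglyMeasurable (ae_of_all _ fun ω => ?_)
    rw [Real.norm_eq_abs, abs_of_nonneg (sq_nonneg _)]
    exact hle ω
  refine ⟨hint, (integral_mono hint hdom hle).trans ?_⟩
  rw [integral_add (h1.1.const_mul 2) (h2.1.const_mul 2), integral_const_mul, integral_const_mul,
    h1.2, h2.2]
  have := hεx i
  have := hεy j
  linarith

end Truncation

/-! ### Convergence almost surely and in probability -/

section Convergence

variable {Ω ι κ : Type*} [MeasurableSpace Ω] {P : Measure Ω} [IsProbabilityMeasure P]
  {LX : Link ι} {LY : Link κ} {x : ι → Ω → ℝ} {y : κ → Ω → ℝ}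

theorem lsdAlmostSurely_of_inputA3 (hX : LX.IsSymm) (hY : LY.IsSymm) (hXB : LX.PropertyB)
    (hYB : LY.PropertyB) {p : (h : ℕ) → Word h → Word h → ℝ} (hp : IsWordLimit LX LY p)
    (hx : InputA3 P x) (hy : InputA3 P y)
    (hxy : IndepFun (fun ω i => x i ω) (fun ω j => y j ω) P) {μ : ProbabilityMeasure ℝ}
    (hμ : HasMoments μ (limitMoment p)) :
    LSDAlmostSurely P (scaledProduct LX LY x y) μ := by
  filter_upwards [ae_tendsto_esdMoment (expectedMomentsTendsto hX hY hXB hYB hp hx hy hxy)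
    (fourthMomentSummable hX hY hXB hYB hx hy hxy)] with ω hω t ht
  exact tendsto_esdCDF_of_moments (fun n => isHermitian_scaledProduct hX hY _ _ n ω) hμ
    (gaussianGrowth_limitMoment hXB hYB hp) hω ht

/-- The event is covered by finitely many events on moments, which are measurable polynomials in the
inputs and converge in probability. Monotonicity of the measure holds for arbitrary sets, so
measurability of the distribution function is never needed. -/
theorem tendsto_measureReal_esdCDF (hX : LX.IsSymm) (hY : LY.IsSymm) (hXB : LX.PropertyB)
    (hYB : LY.PropertyB) {p : (h : ℕ) → Word h → Word h → ℝ} (hp : IsWordLimit LX LY p)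
    (hx : InputA3 P x) (hy : InputA3 P y)
    (hxy : IndepFun (fun ω i => x i ω) (fun ω j => y j ω) P) {μ : ProbabilityMeasure ℝ}
    (hμ : HasMoments μ (limitMoment p)) {t : ℝ} (ht : ContinuousAt (cdf (μ : Measure ℝ)) t)
    {ε : ℝ} (hε : 0 < ε) :
    Tendsto (fun n => P.real {ω | ε ≤ |esdCDF (scaledProduct LX LY x y n ω) t -
      cdf (μ : Measure ℝ) t|}) atTop (𝓝 0) := by
  obtain ⟨H, η, hη, hclose⟩ :=
    exists_moments_close hμ (gaussianGrowth_limitMoment hXB hYB hp) ht hε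
  have hae := ae_tendsto_esdMoment (expectedMomentsTendsto hX hY hXB hYB hp hx hy hxy)
    (fourthMomentSummable hX hY hXB hYB hx hy hxy)
  have hmom : ∀ h, Tendsto (fun n => P.real {ω | η ≤
      ‖esdMoment h (scaledProduct LX LY x y n ω) - limitMoment p h‖}) atTop (𝓝 0) := by
    intro h
    refine tendstoInMeasure_iff_measureReal_norm.1 (tendstoInMeasure_of_tendsto_ae (fun n =>
      ((uniformMoments_esdMoment hX hY hx hy h n).1 ()).aestronglyMeasurable) ?_) η hη
    filter_upwards [hae] with ω hω using hω h
  have hsum := tendsto_finsetSum (Finset.range H) fun h _ => hmom h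
  rw [Finset.sum_const_zero] at hsum
  refine squeeze_zero' (Eventually.of_forall fun n => measureReal_nonneg) ?_ hsum
  filter_upwards [eventually_gt_atTop 0] with n hn
  refine le_trans (measureReal_mono ?_ (measure_ne_top _ _)) (measureReal_biUnion_finset_le _ _)
  intro ω hω
  by_contra hcon
  simp only [Set.mem_iUnion, Finset.mem_range, Set.mem_ofPred_eq, exists_prop, not_exists, not_and,
    not_le, Real.norm_eq_abs] at hcon
  have hA := isHermitian_scaledProduct hX hY x y n ω
  have := hclose (esdProb hn hA) (fun h => integrable_esd hn hA _) hcon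
  exact absurd this (not_lt.2 hω)

/-- Arbitrarily close to any point there are continuity points of a distribution function. -/
theorem exists_continuousAt_cdf (μ : Measure ℝ) {a b : ℝ} (hab : a < b) :
    ∃ s ∈ Set.Ioo a b, ContinuousAt (cdf μ) s := by
  have hd : Dense {s : ℝ | ¬ ContinuousAt (cdf μ) s}ᶜ :=
    (monotone_cdf μ).countable_not_continuousAt.dense_compl ℝ
  obtain ⟨s, hs, hs'⟩ := hd.exists_between hab
  exact ⟨s, hs', not_not.1 hs⟩

/-- Markov's inequality: with the scaling, the quantity is an average over the n² positions, each
with mean at most 4ε whatever the dependence between entries. -/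
theorem measureReal_frobenius_ge_le {g k : ℝ → ℝ}
    (hg : Measurable g) (hk : Measurable k) (hx : StandardInput P x) (hy : StandardInput P y)
    (hx' : StandardInput P fun i ω => g (x i ω)) (hy' : StandardInput P fun j ω => k (y j ω))
    (hxy : IndepFun (fun ω i => x i ω) (fun ω j => y j ω) P) {ε : ℝ} (hε : 0 ≤ ε)
    (hεx : ∀ i, ∫ ω, (x i ω - g (x i ω)) ^ 2 ∂P ≤ ε)
    (hεy : ∀ j, ∫ ω, (y j ω - k (y j ω)) ^ 2 ∂P ≤ ε) (n : ℕ) {c : ℝ} (hc : 0 < c) :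
    P.real {ω | c ≤ (n : ℝ)⁻¹ * ∑ i, ∑ j, (scaledProduct LX LY x y n ω i j -
      scaledProduct LX LY (fun i ω => g (x i ω)) (fun j ω => k (y j ω)) n ω i j) ^ 2} ≤
      4 * ε / c := by
  have hent := integral_sq_sub_le hg hk hx hy hx' hy' hxy hεx hεy
  have heq : ∀ ω, (n : ℝ)⁻¹ * ∑ i, ∑ j, (scaledProduct LX LY x y n ω i j -
      scaledProduct LX LY (fun i ω => g (x i ω)) (fun j ω => k (y j ω)) n ω i j) ^ 2 =
      ((n : ℝ)⁻¹ * (n : ℝ)⁻¹) * ∑ i, ∑ j, (x (LX n i j) ω * y (LY n i j) ω -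
        g (x (LX n i j) ω) * k (y (LY n i j) ω)) ^ 2 := by
    intro ω
    rw [mul_assoc]
    congr 1
    simp_rw [Finset.mul_sum]
    refine Finset.sum_congr rfl fun i _ => Finset.sum_congr rfl fun j _ => ?_
    simp only [scaledProduct, patterned, Matrix.smul_apply, Matrix.hadamard_apply, Matrix.of_apply,
      smul_eq_mul]
    rw [← mul_sub, mul_pow, inv_pow, Real.sq_sqrt (Nat.cast_nonneg n)]
  simp_rw [heq]
  have hint : Integrable (fun ω => ((n : ℝ)⁻¹ * (n : ℝ)⁻¹) * ∑ i, ∑ j,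
      (x (LX n i j) ω * y (LY n i j) ω - g (x (LX n i j) ω) * k (y (LY n i j) ω)) ^ 2) P :=
    (integrable_finsetSum _ fun i _ => integrable_finsetSum _ fun j _ => (hent _ _).1).const_mul _
  have hmk := mul_meas_ge_le_integral_of_nonneg (μ := P)
    (ae_of_all _ fun ω => by simp only [Pi.zero_apply]; positivity) hint c
  rw [le_div_iff₀ hc, mul_comm]
  refine hmk.trans ?_
  rw [integral_const_mul, integral_finsetSum _ fun i _ =>
    integrable_finsetSum _ fun j _ => (hent _ _).1]
  simp_rw [integral_finsetSum _ fun j _ => (hent (LX n _ j) (LY n _ j)).1]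
  calc ((n : ℝ)⁻¹ * (n : ℝ)⁻¹) * ∑ i, ∑ j, ∫ ω, (x (LX n i j) ω * y (LY n i j) ω -
        g (x (LX n i j) ω) * k (y (LY n i j) ω)) ^ 2 ∂P
      ≤ ((n : ℝ)⁻¹ * (n : ℝ)⁻¹) * ∑ _i : Fin n, ∑ _j : Fin n, 4 * ε := by
        gcongr
        exact (hent _ _).2
    _ = ((n : ℝ)⁻¹ * n) * ((n : ℝ)⁻¹ * n) * (4 * ε) := by
        simp only [Finset.sum_const, Finset.card_univ, Fintype.card_fin, nsmul_eq_mul]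
        ring
    _ ≤ 1 * 1 * (4 * ε) := by
        have : (n : ℝ)⁻¹ * n ≤ 1 := inv_mul_le_one
        gcongr
    _ = 4 * ε := by ring

theorem lsdInProbability (hX : LX.IsSymm) (hY : LY.IsSymm) (hXB : LX.PropertyB)
    (hYB : LY.PropertyB) {p : (h : ℕ) → Word h → Word h → ℝ} (hp : IsWordLimit LX LY p)
    (hx : InputA2 P x ∨ InputA3 P x) (hy : InputA2 P y ∨ InputA3 P y)
    (hxy : IndepFun (fun ω i => x i ω) (fun ω j => y j ω) P) {μ : ProbabilityMeasure ℝ}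
    (hμ : HasMoments μ (limitMoment p)) :
    LSDInProbability P (scaledProduct LX LY x y) μ := by
  intro t ht
  rw [tendstoInMeasure_iff_measureReal_norm]
  intro ε hε
  obtain ⟨δ₀, hδ₀, hnear⟩ := Metric.continuousAt_iff.1 ht (ε / 4) (by positivity)
  obtain ⟨s₁, ⟨hs₁, hs₁'⟩, hc₁⟩ :=
    exists_continuousAt_cdf (μ : Measure ℝ) (show t < t + δ₀ by linarith)
  obtain ⟨s₂, ⟨hs₂, hs₂'⟩, hc₂⟩ :=
    exists_continuousAt_cdf (μ : Measure ℝ) (show t - δ₀ < t by linarith)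
  have hn₁ : |cdf (μ : Measure ℝ) s₁ - cdf (μ : Measure ℝ) t| < ε / 4 :=
    hnear (by rw [Real.dist_eq, abs_of_pos (by linarith)]; linarith)
  have hn₂ : |cdf (μ : Measure ℝ) s₂ - cdf (μ : Measure ℝ) t| < ε / 4 :=
    hnear (by rw [Real.dist_eq, abs_of_neg (by linarith)]; linarith)
  -- Below this threshold the Frobenius term in `esdCDF_le` is less than ε/4 for both shifts.
  set c := min ((s₁ - t) ^ 2) ((t - s₂) ^ 2) * (ε / 4) with hc
  have hcpos : 0 < c := by
    have h1 : 0 < s₁ - t := by linarith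
    have h2 : 0 < t - s₂ := by linarith
    positivity
  rw [Metric.tendsto_atTop]
  intro θ hθ
  -- The accuracy cθ/16 makes the bound of `measureReal_frobenius_ge_le` equal to θ/4, uniformly in
  -- n.
  obtain ⟨g, hg, hgx, hgε⟩ := exists_inputA3_approx hx (show 0 < c * θ / 16 by positivity)
  obtain ⟨k, hk, hky, hkε⟩ := exists_inputA3_approx hy (show 0 < c * θ / 16 by positivity)
  have hG : Measurable fun (z : ι → ℝ) (i : ι) => g (z i) :=
    measurable_pi_lambda _ fun i => hg.comp (measurable_pi_apply i)
  have hK : Measurable fun (z : κ → ℝ) (j : κ) => k (z j) :=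
    measurable_pi_lambda _ fun j => hk.comp (measurable_pi_apply j)
  have hind : IndepFun (fun ω i => g (x i ω)) (fun ω j => k (y j ω)) P :=
    hxy.comp hG hK
  have ht₁ := tendsto_measureReal_esdCDF hX hY hXB hYB hp hgx hky hind hμ hc₁
    (show 0 < ε / 4 by positivity)
  have ht₂ := tendsto_measureReal_esdCDF hX hY hXB hYB hp hgx hky hind hμ hc₂
    (show 0 < ε / 4 by positivity)
  have hsum := ht₁.add ht₂
  rw [add_zero] at hsum
  obtain ⟨N, hN⟩ := (hsum.eventually (gt_mem_nhds (show (0 : ℝ) < θ / 2 by positivity))).exists_forall_of_atTop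
  refine ⟨N, fun n hn => ?_⟩
  rw [Real.dist_eq, sub_zero, abs_of_nonneg measureReal_nonneg]
  set A' := scaledProduct LX LY (fun i ω => g (x i ω)) (fun j ω => k (y j ω)) with hA'
  have hW := measureReal_frobenius_ge_le (LX := LX) (LY := LY) hg hk (standardInput_of_or hx)
    (standardInput_of_or hy) hgx.1 hky.1 hxy (by positivity) hgε hkε n hcpos
  have hsub : {ω | ε ≤ ‖esdCDF (scaledProduct LX LY x y n ω) t - cdf (μ : Measure ℝ) t‖} ⊆
      ({ω | ε / 4 ≤ |esdCDF (A' n ω) s₁ - cdf (μ : Measure ℝ) s₁|} ∪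
        {ω | ε / 4 ≤ |esdCDF (A' n ω) s₂ - cdf (μ : Measure ℝ) s₂|}) ∪
      {ω | c ≤ (n : ℝ)⁻¹ * ∑ i, ∑ j, (scaledProduct LX LY x y n ω i j - A' n ω i j) ^ 2} := by
    intro ω hω
    by_contra hcon
    simp only [Set.mem_union, Set.mem_ofPred_eq, not_or, not_le] at hcon
    obtain ⟨⟨h1, h2⟩, h3⟩ := hcon
    have hA := isHermitian_scaledProduct hX hY x y n ω
    have hB : (A' n ω).IsHermitian := isHermitian_scaledProduct hX hY _ _ n ω
    -- The value at `t` is squeezed between values of the approximating matrix at `s₂` and `s₁`.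
    -- Three errors of ε/4 occur on either side: the Frobenius term, the convergence at `s₁` or
    -- `s₂`, and the oscillation of the limit.
    have hu := esdCDF_le hA hB t (show 0 < s₁ - t by linarith)
    have hl := esdCDF_le hB hA s₂ (show 0 < t - s₂ by linarith)
    rw [show t + (s₁ - t) = s₁ by ring] at hu
    rw [show s₂ + (t - s₂) = t by ring] at hl
    have hsymm : ∑ i, ∑ j, (A' n ω i j - scaledProduct LX LY x y n ω i j) ^ 2 =
        ∑ i, ∑ j, (scaledProduct LX LY x y n ω i j - A' n ω i j) ^ 2 :=
      Finset.sum_congr rfl fun i _ => Finset.sum_congr rfl fun j _ => by ring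
    rw [hsymm] at hl
    set W := (n : ℝ)⁻¹ * ∑ i, ∑ j, (scaledProduct LX LY x y n ω i j - A' n ω i j) ^ 2
    have hd₁ : W / (s₁ - t) ^ 2 < ε / 4 := by
      have h0 : 0 < (s₁ - t) ^ 2 := pow_pos (by linarith) 2
      rw [div_lt_iff₀ h0, mul_comm]
      exact h3.trans_le (mul_le_mul_of_nonneg_right (min_le_left _ _) (by positivity))
    have hd₂ : W / (t - s₂) ^ 2 < ε / 4 := by
      have h0 : 0 < (t - s₂) ^ 2 := pow_pos (by linarith) 2
      rw [div_lt_iff₀ h0, mul_comm]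
      exact h3.trans_le (mul_le_mul_of_nonneg_right (min_le_right _ _) (by positivity))
    have hω' : ε ≤ |esdCDF (scaledProduct LX LY x y n ω) t - cdf (μ : Measure ℝ) t| := hω
    rw [abs_lt] at h1 h2 hn₁ hn₂
    rcases abs_cases (esdCDF (scaledProduct LX LY x y n ω) t - cdf (μ : Measure ℝ) t) with h | h
    · linarith
    · linarith
  calc _ ≤ _ := measureReal_mono hsub
    _ ≤ _ := measureReal_union_le _ _
    _ ≤ _ := add_le_add (measureReal_union_le _ _) hW
    _ < θ / 2 + 4 * (c * θ / 16) / c := by gcongr; exact hN n hn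
    _ ≤ θ := by
      rw [show 4 * (c * θ / 16) / c = θ / 4 by field_simp; norm_num]
      linarith

end Convergence

end SchurHadamard

/-! ### Assembly of the theorem. -/

open SchurHadamard in
theorem mainTheorem1 {ι : Type*} {κ : Type*} (LX : Link ι) (LY : Link κ)
    (hXsymm : LX.IsSymm) (hYsymm : LY.IsSymm)
    (hXB : LX.PropertyB) (hYB : LY.PropertyB)
    (p : (h : ℕ) → Word h → Word h → ℝ) (hp : IsWordLimit LX LY p) :
    (∀ k : ℕ, limitMoment p (2 * k) ≤
      ((2 * k).factorial : ℝ) / (2 ^ k * (k.factorial : ℝ)) *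
        ((min LX.Delta LY.Delta).toNat : ℝ) ^ k) ∧
    Carleman (limitMoment p) ∧
    ∃ μ : Measure ℝ, IsProbabilityMeasure μ ∧
      (∀ h : ℕ, Integrable (fun t : ℝ => t ^ h) μ ∧ ∫ t, t ^ h ∂μ = limitMoment p h) ∧
      (∃ c : NNReal, HasSubgaussianMGF id c μ) ∧
      ∀ (Ω : Type*) [MeasurableSpace Ω] (P : Measure Ω) [IsProbabilityMeasure P]
        (x : ι → Ω → ℝ) (y : κ → Ω → ℝ),
        IndepFun (fun ω i => x i ω) (fun ω j => y j ω) P →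
        (InputA1 P x → InputA1 P y →
          ExpectedMomentsTendsto P (scaledProduct LX LY x y) (limitMoment p) ∧
          FourthMomentSummable P (scaledProduct LX LY x y) ∧
          LSDAlmostSurely P (scaledProduct LX LY x y) μ) ∧
        (LX.GrowthCond → LY.GrowthCond →
          (InputA3 P x → InputA3 P y → LSDAlmostSurely P (scaledProduct LX LY x y) μ) ∧
          (InputA2 P x ∨ InputA3 P x → InputA2 P y ∨ InputA3 P y →
            LSDInProbability P (scaledProduct LX LY x y) μ)) := by
  have hg := gaussianGrowth_limitMoment hXB hYB hp
  obtain ⟨μ, hμ⟩ := exists_limit_law hXsymm hYsymm hXB hYB hp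
  have hD : (0 : ℝ) < ((min LX.Delta LY.Delta).toNat : ℝ) := by
    exact_mod_cast one_le_toNat_min_Delta hXB hYB
  refine ⟨hg, carleman_of_growth hD hg (even_moment_pos hμ ?_), μ, inferInstance, hμ,
    ⟨((min LX.Delta LY.Delta).toNat : NNReal), ?_⟩, ?_⟩
  · rw [limitMoment_two hXsymm hYsymm hp]
    exact one_ne_zero
  · refine hasSubgaussianMGF_of_hasMoments hμ (by simpa using hg) fun h hh => ?_
    rw [limitMoment, if_pos hh]
  · intro Ω _ P _ x y hxy
    refine ⟨fun hx hy => ⟨?_, ?_, ?_⟩, fun _ _ => ⟨fun hx hy => ?_, fun hx hy => ?_⟩⟩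
    · exact expectedMomentsTendsto hXsymm hYsymm hXB hYB hp hx.inputA3 hy.inputA3 hxy
    · exact fourthMomentSummable hXsymm hYsymm hXB hYB hx.inputA3 hy.inputA3 hxy
    · exact lsdAlmostSurely_of_inputA3 hXsymm hYsymm hXB hYB hp hx.inputA3 hy.inputA3 hxy hμ
    · exact lsdAlmostSurely_of_inputA3 hXsymm hYsymm hXB hYB hp hx hy hxy hμ
    · exact lsdInProbability hXsymm hYsymm hXB hYB hp hx hy hxy hμ
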